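/- Let $K$ be a field. All operads are non-symmetric operads in $K$-vector spaces, with spaces of operations $\mathcal P(n)$, $n\ge 1$. Let $\mathcal P_\Delta$ be the operad of the standard simplices: $\mathcal P_\Delta(n)=C_*(\Delta^{n-1})$ is the vector space with basis the nonempty subsets of $[n]=\{1,\dots,n\}$ (the cells of $\Delta^{n-1}$), the unit is $\{1\}\subset[1]$, and for $X\subset [n]$ and $X_j\subset[i_j]$ ($1\le j\le n$) the composition is $$\gamma(X;X_1,\dots,X_n)=\mathrm{bij}\Big(\bigcup_{j\in X}X_j\Big)\subset[i_1+\cdots+i_n],$$ where $\mathrm{bij}:[i_1]\sqcup\cdots\sqcup[i_n]\to[i_1+\cdots+i_n]$ is the concatenation bijection. (Its algebras are the associative trialgebras.) Let $\mathcal P^{\mathcal K}$ be the operad of dendriform trialgebras: the binary quadratic operad generated by three operations $\prec,\succ,\cdot$ subject to the seven relations $$\begin{aligned} (x\prec y)\prec z&=x\prec(y*z), & (x\succ y)\prec z&=x\succ(y\prec z), & (x*y)\succ z&=x\succ(y\succ z),\\ (x\succ y)\cdot z&=x\succ(y\cdot z), & (x\prec y)\cdot z&=x\cdot(y\succ z),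 & (x\cdot y)\prec z&=x\cdot(y\prec z),\\ (x\cdot y)\cdot z&=x\cdot(y\cdot z), \end{aligned}$$ where $x*y=x\prec y+x\succ y+x\cdot y$. (The notation refers to the fact that $\mathcal P^{\mathcal K}(n)$ can be identified with the cochains of the Stasheff polytope $\mathcal K^{n-1}$.) For a finite-dimensional space $E$ of binary operations and a space $R$ of relations in arity $3$ of the free operad on $E$, let $\mathcal P(E,R)$ be the quotient of the free operad by the operadic ideal generated by $R$. The Koszul dual of $\mathcal P=\mathcal P(E,R)$ is $\mathcal P^!=\mathcal P(E^*,R^\perp)$, where $R^\perp$ is the orthogonal of $R$ for the pairing of the arity-$3$ parts of the free operads on $E^*$ and $E$ which is $+$ the evaluation on the monomials $(a\,p\,b)\,q\,c$, $-$ the evaluation on the monomials $a\,p\,(b\,q\,c)$, and zero between the two types. The Koszul complex of $\mathcal P$, summed over all arities, has terms $$C_k=\mathcal P^!(k)^*\otimes A^{\otimes k}\quad (k\ge 1),\qquad A=\mathcal P(K)=\bigoplus_{n\ge1}\mathcal P(n),$$ and differential $$d\big(f\otimes(a_1,\dots,a_k)\big)=\sum_{i=1}^{k-1}(-1)^{i-1}\sum_{x}f(-\circ_i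 x^*)\otimes(a_1,\dots,x(a_i,a_{i+1}),\dots,a_k),$$ where $x$ runs over a basis of $E$ and $x^*$ over the dual basis. An operad is (binary) Koszul if it is isomorphic to some $\mathcal P(E,R)$ as above whose Koszul complex is acyclic: the sequence is exact at $C_k$ for every $k\ge2$, and $C_1$ is the direct sum of $d(C_2)$ and of its part of arity one, $\mathcal P^!(1)^*\otimes\mathcal P(1)$. **Theorem.** For every field $K$, the operads $\mathcal P_\Delta$ and $\mathcal P^{\mathcal K}$ are both Koszul operads. -/

import Mathlib

open scoped TensorProduct DirectSum

universe u

/-! ### Non-symmetric operads -/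

/-- A non-symmetric operad over `K` concentrated in arities `≥ 1`, presented by its partial
compositions.  `Op n` is the space of operations with `n + 1` inputs, and `comp h i a b` is
`a ∘ᵢ b`: the output of `b` is plugged into the `i`-th input of `a` (inputs are numbered from `0`).
The proof `h` records that the composite has `n + m + 1` inputs. -/
structure NSOperad (K : Type u) [Field K] where
  Op : ℕ → Type u
  [addCommGroup : ∀ n, AddCommGroup (Op n)]
  [module : ∀ n, Module K (Op n)]
  one : Op 0
  comp : ∀ {n m k : ℕ}, n + m = k → Fin (n + 1) → (Op n →ₗ[K] Op m →ₗ[K] Op k)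
  one_comp : ∀ {m : ℕ} (b : Op m), comp (Nat.zero_add m) 0 one b = b
  comp_one : ∀ {n : ℕ} (i : Fin (n + 1)) (a : Op n), comp (Nat.add_zero n) i a one = a
  /-- Sequential composition: `(a ∘ᵢ b) ∘ᵢ₊ⱼ c = a ∘ᵢ (b ∘ⱼ c)`. -/
  assoc : ∀ {n m l nm ml k : ℕ} (h₁ : n + m = nm) (h₂ : nm + l = k) (h₃ : m + l = ml)
    (h₄ : n + ml = k) (i : Fin (n + 1)) (j : Fin (m + 1)) (p : Fin (nm + 1)),
    (p : ℕ) = i + j → ∀ (a : Op n) (b : Op m) (c : Op l),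
    comp h₂ p (comp h₁ i a b) c = comp h₄ i a (comp h₃ j b c)
  /-- Parallel composition: `(a ∘ᵢ b) ∘ⱼ₊ₘ c = (a ∘ⱼ c) ∘ᵢ b` for `i < j`. -/
  parallel : ∀ {n m l nm nl k : ℕ} (h₁ : n + m = nm) (h₂ : nm + l = k) (h₃ : n + l = nl)
    (h₄ : nl + m = k) (i j : Fin (n + 1)) (p : Fin (nm + 1)) (q : Fin (nl + 1)),
    i < j → (p : ℕ) = j + m → (q : ℕ) = i → ∀ (a : Op n) (b : Op m) (c : Op l),
    comp h₂ p (comp h₁ i a b) c = comp h₄ q (comp h₃ j a c) b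

attribute [instance] NSOperad.addCommGroup NSOperad.module

/-- An isomorphism of non-symmetric operads. -/
structure NSOperad.Iso {K : Type u} [Field K] (P Q : NSOperad K) where
  equiv : ∀ n, P.Op n ≃ₗ[K] Q.Op n
  map_one : equiv 0 P.one = Q.one
  map_comp : ∀ {n m k : ℕ} (h : n + m = k) (i : Fin (n + 1)) (a : P.Op n) (b : P.Op m),
    equiv k (P.comp h i a b) = Q.comp h i (equiv n a) (equiv m b)

/-! ### Linearization of set operads -/

/-- A non-symmetric operad in sets, with the same conventions as `NSOperad`. -/
structure NSSetOperad where
  Op : ℕ → Type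
  one : Op 0
  comp : ∀ {n m k : ℕ}, n + m = k → Fin (n + 1) → Op n → Op m → Op k
  one_comp : ∀ {m : ℕ} (b : Op m), comp (Nat.zero_add m) 0 one b = b
  comp_one : ∀ {n : ℕ} (i : Fin (n + 1)) (a : Op n), comp (Nat.add_zero n) i a one = a
  assoc : ∀ {n m l nm ml k : ℕ} (h₁ : n + m = nm) (h₂ : nm + l = k) (h₃ : m + l = ml)
    (h₄ : n + ml = k) (i : Fin (n + 1)) (j : Fin (m + 1)) (p : Fin (nm + 1)),
    (p : ℕ) = i + j → ∀ (a : Op n) (b : Op m) (c : Op l),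
    comp h₂ p (comp h₁ i a b) c = comp h₄ i a (comp h₃ j b c)
  parallel : ∀ {n m l nm nl k : ℕ} (h₁ : n + m = nm) (h₂ : nm + l = k) (h₃ : n + l = nl)
    (h₄ : nl + m = k) (i j : Fin (n + 1)) (p : Fin (nm + 1)) (q : Fin (nl + 1)),
    i < j → (p : ℕ) = j + m → (q : ℕ) = i → ∀ (a : Op n) (b : Op m) (c : Op l),
    comp h₂ p (comp h₁ i a b) c = comp h₄ q (comp h₃ j a c) b

/-- The bilinear extension of a map `α → β → γ` to the free modules. -/
noncomputable def bilinExt (K : Type u) [Field K] {α β γ : Type} (f : α → β → γ) :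
    (α →₀ K) →ₗ[K] (β →₀ K) →ₗ[K] (γ →₀ K) :=
  Finsupp.linearCombination K (fun a => Finsupp.lmapDomain K K (f a))

theorem bilinExt_single (K : Type u) [Field K] {α β γ : Type} (f : α → β → γ) (a : α) (b : β)
    (r s : K) :
    bilinExt K f (Finsupp.single a r) (Finsupp.single b s) = Finsupp.single (f a b) (r * s) := by
  simp [bilinExt]

/-- The operad of free `K`-modules on the sets of operations of a set operad. -/
noncomputable def NSSetOperad.linearize (K : Type u) [Field K] (S : NSSetOperad) :
    NSOperad K where
  Op n := S.Op n →₀ K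
  one := Finsupp.single S.one 1
  comp h i := bilinExt K (S.comp h i)
  one_comp b := by
    induction b using Finsupp.induction_linear with
    | zero => simp
    | add f g hf hg => rw [map_add, hf, hg]
    | single t r => rw [bilinExt_single, S.one_comp, one_mul]
  comp_one i a := by
    induction a using Finsupp.induction_linear with
    | zero => simp
    | add f g hf hg => rw [map_add, LinearMap.add_apply, hf, hg]
    | single t r => rw [bilinExt_single, S.comp_one, mul_one]
  assoc h₁ h₂ h₃ h₄ i j p hp a b c := by
    induction a using Finsupp.induction_linear with
    | zero => simp
    | add f g hf hg => simp only [map_add, LinearMap.add_apply, hf, hg]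
    | single t r =>
    induction b using Finsupp.induction_linear with
    | zero => simp
    | add f g hf hg => simp only [map_add, LinearMap.add_apply, hf, hg]
    | single t' r' =>
    induction c using Finsupp.induction_linear with
    | zero => simp
    | add f g hf hg => simp only [map_add, hf, hg]
    | single t'' r'' =>
      simp only [bilinExt_single]
      rw [S.assoc h₁ h₂ h₃ h₄ i j p hp, mul_assoc]
  parallel h₁ h₂ h₃ h₄ i j p q hij hp hq a b c := by
    induction a using Finsupp.induction_linear with
    | zero => simp
    | add f g hf hg => simp only [map_add, LinearMap.add_apply, hf, hg]
    | single t r =>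
    induction b using Finsupp.induction_linear with
    | zero => simp
    | add f g hf hg => simp only [map_add, LinearMap.add_apply, hf, hg]
    | single t' r' =>
    induction c using Finsupp.induction_linear with
    | zero => simp
    | add f g hf hg => simp only [map_add, LinearMap.add_apply, hf, hg]
    | single t'' r'' =>
      simp only [bilinExt_single]
      rw [S.parallel h₁ h₂ h₃ h₄ i j p q hij hp hq, mul_right_comm]

/-! ### The operad of the standard simplices -/

/-- The cells of the standard simplex `Δⁿ`: the nonempty subsets of its set `{0, …, n}` of
vertices. -/
abbrev SimplexCell (n : ℕ) : Type :=
  {S : Finset ℕ // S.Nonempty ∧ S ⊆ Finset.range (n + 1)}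

/-- The composition `γ(S; {0}, …, T, …, {0})` with `T ⊆ {0, …, m}` in position `i`: the union of
the blocks selected by `S`, after the concatenation of all the blocks. -/
def simplexComp (m i : ℕ) (S T : Finset ℕ) : Finset ℕ :=
  S.filter (· < i) ∪ (if i ∈ S then T.image (i + ·) else ∅) ∪ (S.filter (i < ·)).image (· + m)

theorem mem_simplexComp (m i : ℕ) (S T : Finset ℕ) (hT : T ⊆ Finset.range (m + 1)) (p : ℕ) :
    p ∈ simplexComp m i S T ↔ (p < i ∧ p ∈ S) ∨ (i ≤ p ∧ p ≤ i + m ∧ i ∈ S ∧ p - i ∈ T) ∨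
      (i + m < p ∧ p - m ∈ S) := by
  have hT' : ∀ x ∈ T, x ≤ m := fun x hx => by
    have := Finset.mem_range.1 (hT hx)
    omega
  unfold simplexComp
  by_cases hi : i ∈ S
  · simp only [hi, if_true, Finset.mem_union, Finset.mem_filter, Finset.mem_image]
    constructor
    · rintro ((h | ⟨a, ha, rfl⟩) | ⟨a, ⟨ha, hia⟩, rfl⟩)
      · exact Or.inl ⟨h.2, h.1⟩
      · have := hT' a ha
        refine Or.inr (Or.inl ⟨by omega, by omega, trivial, by simpa using ha⟩)
      · exact Or.inr (Or.inr ⟨by omega, by simpa using ha⟩)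
    · rintro (h | ⟨h1, h2, -, h3⟩ | ⟨h1, h2⟩)
      · exact Or.inl (Or.inl ⟨h.2, h.1⟩)
      · exact Or.inl (Or.inr ⟨p - i, h3, by omega⟩)
      · exact Or.inr ⟨p - m, ⟨h2, by omega⟩, by omega⟩
  · simp only [hi, if_false, Finset.mem_union, Finset.mem_filter, Finset.mem_image,
      Finset.notMem_empty, or_false]
    constructor
    · rintro (h | ⟨a, ⟨ha, hia⟩, rfl⟩)
      · exact Or.inl ⟨h.2, h.1⟩
      · exact Or.inr (Or.inr ⟨by omega, by simpa using ha⟩)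
    · rintro (h | ⟨h1, h2, h3, h4⟩ | ⟨h1, h2⟩)
      · exact Or.inl ⟨h.2, h.1⟩
      · exact absurd h3 (by simp)
      · exact Or.inr ⟨p - m, ⟨h2, by omega⟩, by omega⟩

theorem simplexComp_nonempty (m i : ℕ) (S T : Finset ℕ) (hS : S.Nonempty) (hT : T.Nonempty) :
    (simplexComp m i S T).Nonempty := by
  obtain ⟨a, ha⟩ := hS
  obtain ⟨b, hb⟩ := hT
  unfold simplexComp
  rcases lt_trichotomy a i with h | h | h
  · exact ⟨a, by simp [ha, h]⟩
  · subst h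
    exact ⟨a + b, by simp [ha, hb]⟩
  · exact ⟨a + m, Finset.mem_union_right _ (Finset.mem_image_of_mem _ (by simp [ha, h]))⟩

theorem simplexComp_subset {n m k : ℕ} (h : n + m = k) (i : Fin (n + 1)) (S T : Finset ℕ)
    (hS : S ⊆ Finset.range (n + 1)) (hT : T ⊆ Finset.range (m + 1)) :
    simplexComp m i S T ⊆ Finset.range (k + 1) := by
  intro p hp
  have hi := i.2
  rw [mem_simplexComp _ _ _ _ hT] at hp
  rw [Finset.mem_range]
  rcases hp with hp | hp | hp
  · omega
  · omega
  · have := Finset.mem_range.1 (hS hp.2)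
    omega

/-- The set operad of the cells of the standard simplices. -/
def simplexSetOperad : NSSetOperad where
  Op := SimplexCell
  one := ⟨{0}, by simp⟩
  comp {n m k} h i S T := ⟨simplexComp m i S.1 T.1,
    simplexComp_nonempty m i S.1 T.1 S.2.1 T.2.1, simplexComp_subset h i S.1 T.1 S.2.2 T.2.2⟩
  one_comp {m} b := by
    apply Subtype.ext
    ext p
    have hb : p ∈ b.1 → p ≤ m := fun hp => by
      have := Finset.mem_range.1 (b.2.2 hp)
      omega
    simp only [mem_simplexComp _ _ _ _ b.2.2, Finset.mem_singleton, Fin.val_zero]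
    grind
  comp_one {n} i a := by
    apply Subtype.ext
    ext p
    simp only [mem_simplexComp 0 i a.1 {0} (by simp), Finset.mem_singleton]
    grind
  assoc {n m l nm ml k} h₁ h₂ h₃ h₄ i j p hp a b c := by
    apply Subtype.ext
    ext x
    have hj := j.2
    simp only [mem_simplexComp l _ _ c.1 c.2.2, mem_simplexComp m i a.1 b.1 b.2.2,
      mem_simplexComp ml i a.1 _ (simplexComp_subset h₃ j b.1 c.1 b.2.2 c.2.2), hp]
    generalize hA : a.1 = A
    generalize hB : b.1 = B
    generalize hC : c.1 = C
    generalize (i : ℕ) = i' at *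
    generalize (j : ℕ) = j' at *
    clear hA hB hC hp h₁ h₂ h₄ a b c p
    subst h₃
    simp only [Nat.add_sub_cancel_left]
    grind (splits := 30)
  parallel {n m l nm nl k} h₁ h₂ h₃ h₄ i j p q hij hp hq a b c := by
    apply Subtype.ext
    ext x
    have hij' : (i : ℕ) < j := hij
    simp only [mem_simplexComp l _ _ c.1 c.2.2, mem_simplexComp m _ _ b.1 b.2.2, hp, hq]
    generalize hA : a.1 = A
    generalize hB : b.1 = B
    generalize hC : c.1 = C
    generalize (i : ℕ) = i' at *
    generalize (j : ℕ) = j' at *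
    clear hA hB hC hp hq h₁ h₂ h₃ h₄ a b c p q
    simp only [Nat.add_sub_cancel]
    grind (splits := 30)

/-- The operad `P_Δ` of the standard simplices: its space of operations with `n + 1` inputs is the
module of chains of `Δⁿ`, with the cells of `Δⁿ` as basis. -/
noncomputable def simplexOperad (K : Type u) [Field K] : NSOperad K :=
  simplexSetOperad.linearize K

/-! ### Free operads on binary generators -/

/-- Planar binary trees with internal nodes decorated by `X`, that is, monomials in binary
operations `x : X`. -/
inductive DTree (X : Type) : Type
  | leaf : DTree X
  | node : X → DTree X → DTree X → DTree X

/-- The number of internal nodes; the number of leaves is one more. -/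
def DTree.nodes {X : Type} : DTree X → ℕ
  | .leaf => 0
  | .node _ l r => l.nodes + r.nodes + 1

/-- Grafting of `s` on the `i`-th leaf of a tree, leaves being numbered from left to right,
from `0`. -/
def DTree.graft {X : Type} : DTree X → ℕ → DTree X → DTree X
  | .leaf, _, s => s
  | .node x l r, i, s =>
    if i ≤ l.nodes then .node x (l.graft i s) r else .node x l (r.graft (i - (l.nodes + 1)) s)

theorem DTree.nodes_graft {X : Type} (t : DTree X) (i : ℕ) (s : DTree X) :
    (t.graft i s).nodes = t.nodes + s.nodes := by
  induction t generalizing i with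
  | leaf => simp [graft, nodes]
  | node x l r hl hr =>
    unfold graft
    split_ifs <;> simp only [nodes, hl, hr] <;> omega

theorem DTree.graft_leaf {X : Type} (t : DTree X) (i : ℕ) : t.graft i .leaf = t := by
  induction t generalizing i with
  | leaf => rfl
  | node x l r hl hr => simp [graft, hl, hr]

theorem DTree.graft_graft {X : Type} (t s r : DTree X) (i j : ℕ) (hi : i ≤ t.nodes)
    (hj : j ≤ s.nodes) : (t.graft i s).graft (i + j) r = t.graft i (s.graft j r) := by
  induction t generalizing i with
  | leaf =>
    have : i = 0 := by simpa [nodes] using hi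
    subst this
    simp [graft]
  | node x l r' hl hr =>
    by_cases h : i ≤ l.nodes
    · have h' : i + j ≤ (l.graft i s).nodes := by
        rw [nodes_graft]
        omega
      simp only [graft, h, if_true, h', hl i h]
    · have h' : ¬ i + j ≤ l.nodes := by omega
      have hi' : i - (l.nodes + 1) ≤ r'.nodes := by
        simp only [nodes] at hi
        omega
      have e : i + j - (l.nodes + 1) = i - (l.nodes + 1) + j := by omega
      simp only [graft, h, if_false, h', e, hr _ hi']

theorem DTree.graft_comm {X : Type} (t s r : DTree X) (i j : ℕ) (hij : i < j)
    (hj : j ≤ t.nodes) :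
    (t.graft i s).graft (j + s.nodes) r = (t.graft j r).graft i s := by
  induction t generalizing i j with
  | leaf =>
    simp only [nodes] at hj
    omega
  | node x l r' hl hr =>
    simp only [nodes] at hj
    by_cases h : i ≤ l.nodes
    · by_cases h2 : j ≤ l.nodes
      · have h3 : j + s.nodes ≤ (l.graft i s).nodes := by
          rw [nodes_graft]
          omega
        have h4 : i ≤ (l.graft j r).nodes := by
          rw [nodes_graft]
          omega
        simp only [graft, h, h2, h3, h4, if_true, hl i j hij h2]
      · have h3 : ¬ j + s.nodes ≤ (l.graft i s).nodes := by
          rw [nodes_graft]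
          omega
        have e : j + s.nodes - ((l.graft i s).nodes + 1) = j - (l.nodes + 1) := by
          rw [nodes_graft]
          omega
        simp only [graft, h, h2, h3, if_true, if_false, e]
    · have h2 : ¬ j ≤ l.nodes := by omega
      have h3 : ¬ j + s.nodes ≤ l.nodes := by omega
      have e : j + s.nodes - (l.nodes + 1) = j - (l.nodes + 1) + s.nodes := by omega
      simp only [graft, h, h2, h3, if_false, e]
      rw [hr _ _ (by omega) (by omega)]

/-- The free set operad on a set `X` of binary operations. -/
def treeSetOperad (X : Type) : NSSetOperad where
  Op n := {t : DTree X // t.nodes = n}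
  one := ⟨.leaf, rfl⟩
  comp h i t s := ⟨t.1.graft i s.1, by rw [DTree.nodes_graft, t.2, s.2, h]⟩
  one_comp b := rfl
  comp_one i a := Subtype.ext (DTree.graft_leaf a.1 i)
  assoc h₁ h₂ h₃ h₄ i j p hp a b c := by
    apply Subtype.ext
    have hi := i.2
    have hj := j.2
    have ha := a.2
    have hb := b.2
    simp only [hp]
    exact DTree.graft_graft _ _ _ _ _ (by omega) (by omega)
  parallel {n m l nm nl k} h₁ h₂ h₃ h₄ i j p q hij hp hq a b c := by
    apply Subtype.ext
    have hj := j.2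
    have ha := a.2
    have hb := b.2
    have := DTree.graft_comm a.1 b.1 c.1 i j hij (by omega)
    rw [hb] at this
    simpa only [hp, hq] using this

/-- The free non-symmetric operad on the space `K^X` of binary operations with basis `X`. -/
noncomputable def freeOperad (K : Type u) [Field K] (X : Type) : NSOperad K :=
  (treeSetOperad X).linearize K

/-- The monomial `(a p b) q c` in the free operad. -/
noncomputable def leftMonomial (K : Type u) [Field K] {X : Type} (p q : X) :
    (freeOperad K X).Op 2 :=
  Finsupp.single (⟨.node q (.node p .leaf .leaf) .leaf, rfl⟩ : {t : DTree X // t.nodes = 2}) (1 : K)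

/-- The monomial `a p (b q c)` in the free operad. -/
noncomputable def rightMonomial (K : Type u) [Field K] {X : Type} (p q : X) :
    (freeOperad K X).Op 2 :=
  Finsupp.single (⟨.node p .leaf (.node q .leaf .leaf), rfl⟩ : {t : DTree X // t.nodes = 2}) (1 : K)

/-! ### Ideals, quotients, quadratic operads -/

/-- An operadic ideal. -/
structure NSOperad.Ideal {K : Type u} [Field K] (P : NSOperad K) where
  sub : ∀ n, Submodule K (P.Op n)
  comp_left_mem : ∀ {n m k : ℕ} (h : n + m = k) (i : Fin (n + 1)) (a : P.Op n) (b : P.Op m),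
    a ∈ sub n → P.comp h i a b ∈ sub k
  comp_right_mem : ∀ {n m k : ℕ} (h : n + m = k) (i : Fin (n + 1)) (a : P.Op n) (b : P.Op m),
    b ∈ sub m → P.comp h i a b ∈ sub k

/-- The operadic ideal generated by a space `R` of ternary operations. -/
def NSOperad.idealSpan {K : Type u} [Field K] (P : NSOperad K) (R : Submodule K (P.Op 2)) :
    P.Ideal where
  sub n := ⨅ (I : P.Ideal) (_ : R ≤ I.sub 2), I.sub n
  comp_left_mem h i a b ha := by
    simp only [Submodule.mem_iInf] at ha ⊢
    exact fun I hI => I.comp_left_mem h i a b (ha I hI)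
  comp_right_mem h i a b hb := by
    simp only [Submodule.mem_iInf] at hb ⊢
    exact fun I hI => I.comp_right_mem h i a b (hb I hI)

/-- The composition of a quotient operad. -/
def NSOperad.quotientComp {K : Type u} [Field K] (P : NSOperad K) (I : P.Ideal) {n m k : ℕ}
    (h : n + m = k) (i : Fin (n + 1)) :
    (P.Op n ⧸ I.sub n) →ₗ[K] (P.Op m ⧸ I.sub m) →ₗ[K] (P.Op k ⧸ I.sub k) :=
  (I.sub n).liftQ
    { toFun := fun a => (I.sub m).mapQ (I.sub k) (P.comp h i a)
        (fun b hb => I.comp_right_mem h i a b hb)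
      map_add' := fun a a' => by
        apply Submodule.linearMap_qext
        ext b
        simp
      map_smul' := fun r a => by
        apply Submodule.linearMap_qext
        ext b
        simp }
    (fun a ha => by
      rw [LinearMap.mem_ker]
      apply Submodule.linearMap_qext
      ext b
      simpa using I.comp_left_mem h i a b ha)

/-- The quotient of an operad by an operadic ideal. -/
def NSOperad.quotient {K : Type u} [Field K] (P : NSOperad K) (I : P.Ideal) : NSOperad K where
  Op n := P.Op n ⧸ I.sub n
  one := Submodule.Quotient.mk P.one
  comp h i := P.quotientComp I h i
  one_comp b := by
    obtain ⟨b, rfl⟩ := Submodule.Quotient.mk_surjective _ b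
    exact congrArg Submodule.Quotient.mk (P.one_comp b)
  comp_one i a := by
    obtain ⟨a, rfl⟩ := Submodule.Quotient.mk_surjective _ a
    exact congrArg Submodule.Quotient.mk (P.comp_one i a)
  assoc h₁ h₂ h₃ h₄ i j p hp a b c := by
    obtain ⟨a, rfl⟩ := Submodule.Quotient.mk_surjective _ a
    obtain ⟨b, rfl⟩ := Submodule.Quotient.mk_surjective _ b
    obtain ⟨c, rfl⟩ := Submodule.Quotient.mk_surjective _ c
    exact congrArg Submodule.Quotient.mk (P.assoc h₁ h₂ h₃ h₄ i j p hp a b c)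
  parallel h₁ h₂ h₃ h₄ i j p q hij hp hq a b c := by
    obtain ⟨a, rfl⟩ := Submodule.Quotient.mk_surjective _ a
    obtain ⟨b, rfl⟩ := Submodule.Quotient.mk_surjective _ b
    obtain ⟨c, rfl⟩ := Submodule.Quotient.mk_surjective _ c
    exact congrArg Submodule.Quotient.mk (P.parallel h₁ h₂ h₃ h₄ i j p q hij hp hq a b c)

/-- The binary quadratic operad `P(E, R)`, with `E = K^X` the space of generating operations and
`R` the space of relations between the ternary monomials. -/
noncomputable def quadraticOperad (K : Type u) [Field K] (X : Type)
    (R : Submodule K ((freeOperad K X).Op 2)) : NSOperad K :=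
  (freeOperad K X).quotient ((freeOperad K X).idealSpan R)

/-- The generating operation `x : X` of a quadratic operad. -/
noncomputable def quadraticOperad.gen {K : Type u} [Field K] {X : Type}
    (R : Submodule K ((freeOperad K X).Op 2)) (x : X) : (quadraticOperad K X R).Op 1 :=
  Submodule.Quotient.mk (p := ((freeOperad K X).idealSpan R).sub 1)
    (Finsupp.single (⟨.node x .leaf .leaf, rfl⟩ : {t : DTree X // t.nodes = 1}) (1 : K))

/-! ### Koszul duality -/

/-- The sign of a ternary monomial: `+1` for `(a p b) q c` and `-1` for `a p (b q c)`. -/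
def monomialSign (K : Type u) [Field K] {X : Type} : DTree X → K
  | .node _ (.node _ _ _) .leaf => 1
  | .node _ .leaf (.node _ _ _) => -1
  | _ => 0

/-- The pairing between the ternary operations of the free operads on `E^*` and on `E`, where the
set `X` stands for a basis of `E` and for the dual basis of `E^*`: distinct monomials are orthogonal,
and a monomial paired with its dual gives its sign. -/
noncomputable def monomialPairing (K : Type u) [Field K] (X : Type) :
    (freeOperad K X).Op 2 →ₗ[K] (freeOperad K X).Op 2 →ₗ[K] K :=
  Finsupp.linearCombination K (fun t : {t : DTree X // t.nodes = 2} =>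
    monomialSign K t.1 • (Finsupp.lapply t : ({t : DTree X // t.nodes = 2} →₀ K) →ₗ[K] K))

/-- The space `R^⊥` of relations of the Koszul dual operad `P^! = P(E^*, R^⊥)`. -/
noncomputable def dualRelations {K : Type u} [Field K] {X : Type}
    (R : Submodule K ((freeOperad K X).Op 2)) : Submodule K ((freeOperad K X).Op 2) :=
  ⨅ r ∈ R, LinearMap.ker ((monomialPairing K X).flip r)

/-- The Koszul dual operad `P^!` of `P(E, R)`. -/
noncomputable def koszulDual {K : Type u} [Field K] {X : Type}
    (R : Submodule K ((freeOperad K X).Op 2)) : NSOperad K :=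
  quadraticOperad K X (dualRelations R)

/-- The free algebra on one generator, `P(K) = ⊕ₙ P(n)`. -/
abbrev NSOperad.FreeAlgebra {K : Type u} [Field K] (P : NSOperad K) : Type u :=
  ⨁ n, P.Op n

/-- The action of a binary operation `x` on the free algebra: for `a ∈ P(n)` and `b ∈ P(m)` it is
`x(a, b) ∈ P(n + m)`. -/
noncomputable def NSOperad.act {K : Type u} [Field K] (P : NSOperad K) (x : P.Op 1) :
    P.FreeAlgebra →ₗ[K] P.FreeAlgebra →ₗ[K] P.FreeAlgebra :=
  DirectSum.toModule K ℕ _ fun n => LinearMap.flip <|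
    DirectSum.toModule K ℕ (P.Op n →ₗ[K] P.FreeAlgebra) fun m =>
      ((P.comp (n := 1 + m) (m := n) rfl 0).compr₂
        (DirectSum.lof K ℕ P.Op (1 + m + n))) ∘ₗ P.comp (n := 1) (m := m) rfl 1 x

/-- Multiplication of the entries `i` and `i + 1` of a tuple. -/
def mergeFun {A : Type u} (μ : A → A → A) {k : ℕ} (i : Fin (k + 1)) (a : Fin (k + 2) → A) :
    Fin (k + 1) → A := fun j =>
  if j < i then a j.castSucc else if j = i then μ (a i.castSucc) (a i.succ) else a j.succ

theorem mergeFun_update {K A : Type u} [Field K] [AddCommGroup A] [Module K A]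
    (μ : A →ₗ[K] A →ₗ[K] A) {k : ℕ} (i : Fin (k + 1)) [DecidableEq (Fin (k + 2))]
    (a : Fin (k + 2) → A) (p : Fin (k + 2)) :
    ∃ (j : Fin (k + 1)) (g : A →ₗ[K] A), ∀ v,
      mergeFun (fun x y => μ x y) i (Function.update a p v) =
        Function.update (mergeFun (fun x y => μ x y) i a) j (g v) := by
  rcases lt_trichotomy (p : ℕ) i with h | h | h
  · refine ⟨⟨p, by omega⟩, LinearMap.id, fun v => ?_⟩
    ext j
    simp only [mergeFun, Function.update_apply, Fin.ext_iff, Fin.lt_def, Fin.val_castSucc,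
      Fin.val_succ, LinearMap.id_apply]
    split_ifs <;> first | rfl | omega
  · refine ⟨i, μ.flip (a i.succ), fun v => ?_⟩
    ext j
    simp only [mergeFun, Function.update_apply, Fin.ext_iff, Fin.lt_def, Fin.val_castSucc,
      Fin.val_succ, LinearMap.flip_apply]
    split_ifs <;> first | rfl | omega
  · by_cases h' : (p : ℕ) = i + 1
    · refine ⟨i, μ (a i.castSucc), fun v => ?_⟩
      ext j
      simp only [mergeFun, Function.update_apply, Fin.ext_iff, Fin.lt_def, Fin.val_castSucc,
        Fin.val_succ]
      split_ifs <;> first | rfl | omega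
    · refine ⟨⟨p - 1, by omega⟩, LinearMap.id, fun v => ?_⟩
      ext j
      simp only [mergeFun, Function.update_apply, Fin.ext_iff, Fin.lt_def, Fin.val_castSucc,
        Fin.val_succ, LinearMap.id_apply]
      split_ifs <;> first | rfl | omega

/-- The map `a₀ ⊗ ⋯ ⊗ aₖ₊₁ ↦ a₀ ⊗ ⋯ ⊗ μ(aᵢ, aᵢ₊₁) ⊗ ⋯ ⊗ aₖ₊₁`. -/
noncomputable def merge {K A : Type u} [Field K] [AddCommGroup A] [Module K A]
    (μ : A →ₗ[K] A →ₗ[K] A) {k : ℕ} (i : Fin (k + 1)) :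
    (⨂[K] _ : Fin (k + 2), A) →ₗ[K] (⨂[K] _ : Fin (k + 1), A) :=
  PiTensorProduct.lift
    { toFun := fun a => PiTensorProduct.tprod K (mergeFun (fun x y => μ x y) i a)
      map_update_add' := fun a p v w => by
        obtain ⟨j, g, hg⟩ := mergeFun_update μ i a p
        simp only [hg, map_add, MultilinearMap.map_update_add]
      map_update_smul' := fun a p c v => by
        obtain ⟨j, g, hg⟩ := mergeFun_update μ i a p
        simp only [hg, map_smul, MultilinearMap.map_update_smul] }

/-- The Koszul complex of `P = P(E, R)`, summed over all arities.  The term with index `k` is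
`P^!(k + 1)^* ⊗ P(K)^{⊗ (k + 1)}`. -/
abbrev KoszulChain {K : Type u} [Field K] {X : Type}
    (R : Submodule K ((freeOperad K X).Op 2)) (k : ℕ) : Type u :=
  Module.Dual K ((koszulDual R).Op k) ⊗[K]
    (⨂[K] _ : Fin (k + 1), (quadraticOperad K X R).FreeAlgebra)

/-- The differential of the Koszul complex: the alternating sum over `i` of the maps
`f ⊗ (a₀, …, aₖ₊₁) ↦ ∑ₓ f(- ∘ᵢ x^*) ⊗ (a₀, …, x(aᵢ, aᵢ₊₁), …, aₖ₊₁)`, the sum being over the basis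
`X` of `E` and its dual basis. -/
noncomputable def koszulDifferential {K : Type u} [Field K] {X : Type} [Fintype X]
    (R : Submodule K ((freeOperad K X).Op 2)) (k : ℕ) :
    KoszulChain R (k + 1) →ₗ[K] KoszulChain R k :=
  ∑ i : Fin (k + 1), (-1 : K) ^ (i : ℕ) • ∑ x : X,
    TensorProduct.map
      ((((koszulDual R).comp (m := 1) rfl i).flip
        (quadraticOperad.gen (dualRelations R) x)).dualMap)
      (merge ((quadraticOperad K X R).act (quadraticOperad.gen R x)) i)

/-- The part of arity one of the Koszul complex: `P^!(1)^* ⊗ P(1)`, in the term with index `0`. -/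
noncomputable def koszulArityOne {K : Type u} [Field K] {X : Type}
    (R : Submodule K ((freeOperad K X).Op 2)) :
    Module.Dual K ((koszulDual R).Op 0) →ₗ[K] KoszulChain R 0 :=
  (TensorProduct.mk K _ _).flip (PiTensorProduct.tprod K fun _ =>
    DirectSum.lof K ℕ (quadraticOperad K X R).Op 0 (quadraticOperad K X R).one)

/-- The Koszul complex is acyclic: its homology is concentrated in index `0`, where it is reduced
to the part of arity one. -/
def KoszulAcyclic {K : Type u} [Field K] {X : Type} [Fintype X]
    (R : Submodule K ((freeOperad K X).Op 2)) : Prop :=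
  (∀ k, Function.Exact (koszulDifferential R (k + 1)) (koszulDifferential R k)) ∧
    IsCompl (LinearMap.range (koszulDifferential R 0)) (LinearMap.range (koszulArityOne R))

/-- A (binary) Koszul operad: a binary quadratic operad, with finitely many generating operations,
whose Koszul complex is acyclic. -/
def NSOperad.IsKoszul {K : Type u} [Field K] (P : NSOperad K) : Prop :=
  ∃ (X : Type) (_ : Fintype X) (R : Submodule K ((freeOperad K X).Op 2)),
    Nonempty (P.Iso (quadraticOperad K X R)) ∧ KoszulAcyclic R

/-! ### The operad of dendriform trialgebras -/

/-- The three generating operations: left `≺`, right `≻`, middle `·`. -/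
inductive TriOp : Type
  | left : TriOp
  | right : TriOp
  | mid : TriOp

open TriOp in
/-- The seven relations of dendriform trialgebras. -/
noncomputable def dendriformRelations (K : Type u) [Field K] :
    Submodule K ((freeOperad K TriOp).Op 2) :=
  Submodule.span K
    { leftMonomial K left left -
        (rightMonomial K left left + rightMonomial K left right + rightMonomial K left mid),
      leftMonomial K right left - rightMonomial K right left,
      leftMonomial K left right + leftMonomial K right right + leftMonomial K mid right -
        rightMonomial K right right,
      leftMonomial K right mid - rightMonomial K right mid,
      leftMonomial K left mid - rightMonomial K mid right,
      leftMonomial K mid left - rightMonomial K mid left,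
      leftMonomial K mid mid - rightMonomial K mid mid }

/-- The operad `P^𝒦` of dendriform trialgebras. -/
noncomputable def dendriformOperad (K : Type u) [Field K] : NSOperad K :=
  quadraticOperad K TriOp (dendriformRelations K)

/-! ### The free operad: linear extension from decorated trees -/

/-! The Koszul complex of a quadratic operad with free algebra `A = P(K)` is a quotient of a bar
complex as soon as the forms on the dual operad are given by lists of colours. Suppose that
composing such a form with a generator at two adjacent places either gives zero or merges the two
colours `c`, `c'` into `max c c'`. Elements of `A` tagged by a colour then multiply by `(c, a)(c',
a') = (max c c', ∑ x(a, a'))`, the sum being over the generators `x` admitted by `c` and `c'`. When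
this product is associative, words in the resulting nonunital algebra `B` map onto the Koszul
complex, compatibly with the differentials (`Coloring`, `koszulDifferential_toChain`). A word maps
to zero or to a basis vector, so a homotopy defined on words descends once it respects null words
and equal images (`Homotopy.acyclic`).

The two operads are dual to each other. Let `≺`, `≻`, `·` keep the left leaves, the right leaves, or
both. The orthogonal of the dendriform relations identifies the ternary monomials which keep the
same leaves. Every monomial of the dual operad is then determined by its nonempty set of kept
leaves, and this operad is `P_Δ` (`simplexIso`). On the dendriform side, give heights to the leaves
and read the operation at each node by comparing the greatest heights on its two sides. The
indicator function of the compatible trees vanishes on the dendriform ideal, and a nonempty list of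
heights is compatible with exactly one Schröder tree, whence a basis (`dendBasis`).

For dendriform trialgebras the colours are marks in `Bool`. The algebra `B` is the free product of
its unmarked subalgebra and of the free algebra on one marked generator `x`, and the Koszul complex
is the bar complex of `B` modulo the words without marks; hence only `x` survives. The homotopy cuts
a head letter `x z` into `x | z`, and otherwise cuts the first marked letter just before its `x`
(`dend_homotopy`).

For trialgebras the colours are heights in `ℕ`, and two lists of heights give the same form exactly
when the maxima over adjacent intervals compare in the same way. A letter is a block of leaves, some
of them marked, at some height; the product concatenates two blocks and keeps the marks of the
higher one, or of both at equal heights. Replacing every height `i` by `2 * i + 1` changes nothing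
in the Koszul complex and frees the height `2 * i`, which is used to split the first leaf off a
longer block. Continued past blocks of one leaf, with the correction `subRaise`, this splitting is a
homotopy from zero to the doubling of heights, up to differences in which only a leaf lower than its
neighbours has changed height. These differences vanish in the Koszul complex (`defect_mem`). -/

namespace freeOperad

variable {K : Type u} [Field K] {X : Type} {M : Type*} [AddCommMonoid M] [Module K M]

/-- A decorated tree as an element of the free operad. -/
noncomputable def tree (K : Type u) [Field K] {X : Type} {n : ℕ} (t : DTree X)
    (h : t.nodes = n) : (freeOperad K X).Op n :=
  Finsupp.single (⟨t, h⟩ : {t : DTree X // t.nodes = n}) (1 : K)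

/-- The linear extension of a map defined on decorated trees. -/
noncomputable def lift (K : Type u) [Field K] {X : Type} {M : Type*} [AddCommMonoid M] [Module K M]
    (n : ℕ) (φ : DTree X → M) : (freeOperad K X).Op n →ₗ[K] M :=
  Finsupp.linearCombination K (fun t : {t : DTree X // t.nodes = n} => φ t.1)

@[simp] theorem lift_tree (φ : DTree X → M) {n : ℕ} (t : DTree X) (h : t.nodes = n) :
    lift K n φ (tree K t h) = φ t :=
  (Finsupp.linearCombination_single K (1 : K) (⟨t, h⟩ : {t : DTree X // t.nodes = n})).trans
    (one_smul K _)

theorem span_tree (n : ℕ) :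
    Submodule.span K (Set.range fun t : {t : DTree X // t.nodes = n} => tree K t.1 t.2) = ⊤ :=
  (Finsupp.basisSingleOne (R := K) (ι := {t : DTree X // t.nodes = n})).span_eq ▸ by
    congr 1

theorem hom_ext {n : ℕ} {f g : (freeOperad K X).Op n →ₗ[K] M}
    (h : ∀ (t : DTree X) (ht : t.nodes = n), f (tree K t ht) = g (tree K t ht)) : f = g :=
  LinearMap.ext_on_range (span_tree n) fun t => h t.1 t.2

theorem comp_tree {n m k : ℕ} (h : n + m = k) (i : Fin (n + 1)) (t s : DTree X)
    (ht : t.nodes = n) (hs : s.nodes = m) :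
    (freeOperad K X).comp h i (tree K t ht) (tree K s hs) =
      tree K (t.graft i s) (by rw [DTree.nodes_graft, ht, hs, h]) :=
  (bilinExt_single K _ _ _ 1 1).trans (by rw [one_mul]; rfl)

theorem leftMonomial_eq (p q : X) :
    leftMonomial K p q = tree K (.node q (.node p .leaf .leaf) .leaf)
      (by simp [DTree.nodes]) := rfl

theorem rightMonomial_eq (p q : X) :
    rightMonomial K p q = tree K (.node p .leaf (.node q .leaf .leaf))
      (by simp [DTree.nodes]) := rfl

end freeOperad

/-! ### Quadratic operads and their free algebras -/

namespace quadraticOperad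

variable {K : Type u} [Field K] {X : Type} (R : Submodule K ((freeOperad K X).Op 2))

/-- The projection of the free operad onto a quadratic operad. -/
noncomputable def proj (n : ℕ) : (freeOperad K X).Op n →ₗ[K] (quadraticOperad K X R).Op n :=
  (((freeOperad K X).idealSpan R).sub n).mkQ

theorem proj_surjective (n : ℕ) : Function.Surjective (proj R n) :=
  Submodule.mkQ_surjective _

theorem proj_comp {n m k : ℕ} (h : n + m = k) (i : Fin (n + 1)) (a : (freeOperad K X).Op n)
    (b : (freeOperad K X).Op m) : (quadraticOperad K X R).comp h i (proj R n a) (proj R m b) =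
      proj R k ((freeOperad K X).comp h i a b) := rfl

theorem proj_eq_zero {f : (freeOperad K X).Op 2} (hf : f ∈ R) : proj R 2 f = 0 := by
  refine (Submodule.Quotient.mk_eq_zero _).2 ?_
  simp only [NSOperad.idealSpan, Submodule.mem_iInf]
  exact fun I hI => hI hf

/-- The class of a decorated tree in a quadratic operad. -/
noncomputable def tree {n : ℕ} (t : DTree X) (h : t.nodes = n) : (quadraticOperad K X R).Op n :=
  proj R n (freeOperad.tree K t h)

theorem span_tree (n : ℕ) :
    Submodule.span K (Set.range fun t : {t : DTree X // t.nodes = n} => tree R t.1 t.2) = ⊤ := by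
  have := congrArg (Submodule.map (proj R n)) (freeOperad.span_tree (K := K) (X := X) n)
  rw [Submodule.map_span, ← Set.range_comp, Submodule.map_top,
    LinearMap.range_eq_top.2 (proj_surjective R n)] at this
  exact this

theorem hom_ext {M : Type*} [AddCommMonoid M] [Module K M] {n : ℕ}
    {f g : (quadraticOperad K X R).Op n →ₗ[K] M}
    (h : ∀ (t : DTree X) (ht : t.nodes = n), f (tree R t ht) = g (tree R t ht)) : f = g :=
  LinearMap.ext_on_range (span_tree R n) fun t => h t.1 t.2

theorem comp_tree {n m k : ℕ} (h : n + m = k) (i : Fin (n + 1)) (t s : DTree X)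
    (ht : t.nodes = n) (hs : s.nodes = m) :
    (quadraticOperad K X R).comp h i (tree R t ht) (tree R s hs) =
      tree R (t.graft i s) (by rw [DTree.nodes_graft, ht, hs, h]) := by
  rw [tree, tree, proj_comp, freeOperad.comp_tree]
  rfl

theorem gen_eq (x : X) : gen R x = tree R (.node x .leaf .leaf) (by simp [DTree.nodes]) := rfl

/-- The monomial in the free algebra on one generator given by a decorated tree. -/
noncomputable def mon (t : DTree X) : (quadraticOperad K X R).FreeAlgebra :=
  DirectSum.lof K ℕ (quadraticOperad K X R).Op t.nodes (tree R t rfl)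

theorem lof_tree {n : ℕ} (t : DTree X) (h : t.nodes = n) :
    DirectSum.lof K ℕ (quadraticOperad K X R).Op n (tree R t h) = mon R t := by
  subst h
  rfl

theorem span_mon : Submodule.span K (Set.range (mon R)) = ⊤ := by
  rw [eq_top_iff]
  rintro x -
  induction x using DirectSum.induction_on with
  | zero => exact zero_mem _
  | add x y hx hy => exact add_mem hx hy
  | of n x =>
    have hx : x ∈ Submodule.span K
        (Set.range fun t : {t : DTree X // t.nodes = n} => tree R t.1 t.2) := by
      rw [span_tree]
      trivial
    have := Submodule.mem_map_of_mem
      (f := DirectSum.lof K ℕ (quadraticOperad K X R).Op n) hx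
    rw [Submodule.map_span, ← Set.range_comp] at this
    refine Submodule.span_mono ?_ this
    rintro _ ⟨t, rfl⟩
    exact ⟨t.1, (lof_tree R t.1 t.2).symm⟩

/-- The bilinear operation on the free algebra given by a generating operation. -/
noncomputable abbrev op (x : X) : (quadraticOperad K X R).FreeAlgebra →ₗ[K]
    (quadraticOperad K X R).FreeAlgebra →ₗ[K] (quadraticOperad K X R).FreeAlgebra :=
  (quadraticOperad K X R).act (gen R x)

theorem op_mon (x : X) (t s : DTree X) : op R x (mon R t) (mon R s) = mon R (.node x t s) := by
  have h : (((DTree.node x .leaf .leaf).graft 1 s).graft 0 t) = .node x t s := by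
    simp [DTree.graft, DTree.nodes]
  rw [← h, op, NSOperad.act, mon, mon, DirectSum.toModule_lof, LinearMap.flip_apply,
    DirectSum.toModule_lof, LinearMap.comp_apply, LinearMap.compr₂_apply, gen_eq, comp_tree,
    comp_tree, lof_tree]
  rfl

/-! ### Evaluation of ternary operations on the free algebra -/

section Relations

/-- The value of the ternary monomials on elements of the free algebra. -/
noncomputable def act3 : DTree X → (quadraticOperad K X R).FreeAlgebra →ₗ[K]
    (quadraticOperad K X R).FreeAlgebra →ₗ[K] (quadraticOperad K X R).FreeAlgebra →ₗ[K]
    (quadraticOperad K X R).FreeAlgebra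
  | .node q (.node p _ _) _ => (op R p).compr₂ (op R q)
  | .node p .leaf (.node q _ _) => LinearMap.compl₂ ((LinearMap.llcomp K _ _ _) ∘ₗ op R p) (op R q)
  | _ => 0

/-- The leaves are filled from right to left, so that no graft shifts the positions still to be
filled. -/
theorem act3_mon (t a b c : DTree X) (h : t.nodes = 2) :
    act3 R t (mon R a) (mon R b) (mon R c) = mon R (((t.graft 2 c).graft 1 b).graft 0 a) := by
  match t, h with
  | .node q (.node p .leaf .leaf) .leaf, _ =>
    simp [act3, op_mon, DTree.graft, DTree.nodes]
  | .node p .leaf (.node q .leaf .leaf), _ =>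
    simp [act3, op_mon, DTree.graft, DTree.nodes]
  | .leaf, h => simp [DTree.nodes] at h
  | .node q .leaf .leaf, h => simp [DTree.nodes] at h
  | .node q (.node p (.node _ _ _) _) _, h => simp [DTree.nodes] at h; omega
  | .node q (.node p _ (.node _ _ _)) _, h => simp [DTree.nodes] at h; omega
  | .node q (.node p _ _) (.node _ _ _), h => simp [DTree.nodes] at h; omega
  | .node q .leaf (.node p (.node _ _ _) _), h => simp [DTree.nodes] at h
  | .node q .leaf (.node p _ (.node _ _ _)), h => simp [DTree.nodes] at h

/-- On monomials the evaluation is the projection to the quadratic operad followed by operadic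
compositions, and the projection kills `R`. This turns each relation into an identity between
operations on the free algebra. -/
theorem act3_relation {f : (freeOperad K X).Op 2} (hf : f ∈ R) :
    freeOperad.lift K 2 (act3 R) f = 0 := by
  refine LinearMap.ext_on_range (v := mon R) (span_mon R) fun a => ?_
  refine LinearMap.ext_on_range (v := mon R) (span_mon R) fun b => ?_
  refine LinearMap.ext_on_range (v := mon R) (span_mon R) fun c => ?_
  have key : (LinearMap.applyₗ (mon R c)) ∘ₗ (LinearMap.applyₗ (mon R b)) ∘ₗ
      (LinearMap.applyₗ (mon R a)) ∘ₗ (freeOperad.lift K 2 (act3 R)) =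
      DirectSum.lof K ℕ (quadraticOperad K X R).Op _ ∘ₗ
        ((quadraticOperad K X R).comp rfl 0).flip (tree R a rfl) ∘ₗ
        ((quadraticOperad K X R).comp rfl ⟨1, by omega⟩).flip (tree R b rfl) ∘ₗ
        ((quadraticOperad K X R).comp (k := 2 + c.nodes) rfl 2).flip (tree R c rfl) ∘ₗ
        proj R 2 := by
    refine freeOperad.hom_ext fun t ht => ?_
    simp only [LinearMap.comp_apply, LinearMap.applyₗ_apply_apply, LinearMap.flip_apply,
      freeOperad.lift_tree, act3_mon R t a b c ht]
    change _ = DirectSum.lof K ℕ (quadraticOperad K X R).Op _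
        ((quadraticOperad K X R).comp rfl 0 ((quadraticOperad K X R).comp rfl
        ⟨1, by omega⟩ ((quadraticOperad K X R).comp (k := 2 + c.nodes) rfl 2
        (tree R t ht) (tree R c rfl)) (tree R b rfl)) (tree R a rfl))
    rw [comp_tree, comp_tree, comp_tree, lof_tree]
    rfl
  have := LinearMap.congr_fun key f
  simp only [LinearMap.comp_apply, LinearMap.applyₗ_apply_apply, proj_eq_zero R hf,
    map_zero] at this
  simpa using this

@[simp] theorem act3_leftMonomial (p q : X) (a b c : (quadraticOperad K X R).FreeAlgebra) :
    freeOperad.lift K 2 (act3 R) (leftMonomial K p q) a b c = op R q (op R p a b) c := by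
  rw [freeOperad.leftMonomial_eq, freeOperad.lift_tree]
  rfl

@[simp] theorem act3_rightMonomial (p q : X) (a b c : (quadraticOperad K X R).FreeAlgebra) :
    freeOperad.lift K 2 (act3 R) (rightMonomial K p q) a b c = op R p a (op R q b c) := by
  rw [freeOperad.rightMonomial_eq, freeOperad.lift_tree]
  rfl

end Relations

/-! ### Linear forms defined on trees -/

/-- A function on decorated trees which vanishes on the ideal generated by `R`. -/
def IsWeight (χ : DTree X → K) : Prop :=
  ∀ n, ∀ f ∈ ((freeOperad K X).idealSpan R).sub n, freeOperad.lift K n χ f = 0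

/-- The common kernel of a family of forms is an operadic ideal when each of them, evaluated on a
composite, is a multiple of a product of two forms of the family. If it contains `R`, it contains
the ideal generated by `R`. The factors may depend on the arities and on the place of composition.
-/
theorem isWeight_of_family {W : Type*} (χ : W → DTree X → K)
    (hR : ∀ w, ∀ f ∈ R, freeOperad.lift K 2 (χ w) f = 0)
    (hχ : ∀ w n m i, i ≤ n → ∃ (c : K) (w₁ w₂ : W), ∀ t s : DTree X, t.nodes = n → s.nodes = m →
      χ w (t.graft i s) = c * (χ w₁ t * χ w₂ s)) (w : W) : IsWeight R (χ w) := by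
  have key : ∀ w {n m k : ℕ} (h : n + m = k) (i : Fin (n + 1)), ∃ (c : K) (w₁ w₂ : W),
      ∀ (a : (freeOperad K X).Op n) (b : (freeOperad K X).Op m),
      freeOperad.lift K k (χ w) ((freeOperad K X).comp h i a b) =
      c * (freeOperad.lift K n (χ w₁) a * freeOperad.lift K m (χ w₂) b) := by
    intro w n m k h i
    obtain ⟨c, w₁, w₂, H⟩ := hχ w n m i (by omega)
    refine ⟨c, w₁, w₂, fun a b => ?_⟩
    have e : ((freeOperad K X).comp h i).compr₂ (freeOperad.lift K k (χ w)) =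
        c • ((LinearMap.mul K K).compl₁₂ (freeOperad.lift K n (χ w₁))
          (freeOperad.lift K m (χ w₂))) := by
      refine freeOperad.hom_ext fun t ht => freeOperad.hom_ext fun s hs => ?_
      simp [freeOperad.comp_tree, H t s ht hs]
    simpa using LinearMap.congr_fun (LinearMap.congr_fun e a) b
  let I : (freeOperad K X).Ideal :=
    { sub := fun n => ⨅ w, LinearMap.ker (freeOperad.lift K n (χ w))
      comp_left_mem := fun {n m k} h i a b ha => by
        simp only [Submodule.mem_iInf, LinearMap.mem_ker] at ha ⊢
        intro w
        obtain ⟨c, w₁, w₂, H⟩ := key w h i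
        rw [H, ha, zero_mul, mul_zero]
      comp_right_mem := fun {n m k} h i a b hb => by
        simp only [Submodule.mem_iInf, LinearMap.mem_ker] at hb ⊢
        intro w
        obtain ⟨c, w₁, w₂, H⟩ := key w h i
        rw [H, hb, mul_zero, mul_zero] }
  have hI : R ≤ I.sub 2 := by
    intro f hf
    simp only [I, Submodule.mem_iInf, LinearMap.mem_ker]
    exact fun w => hR w f hf
  intro n f hf
  simp only [NSOperad.idealSpan, Submodule.mem_iInf] at hf
  have := hf I hI
  simp only [I, Submodule.mem_iInf, LinearMap.mem_ker] at this
  exact this w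

variable {R}

/-- The linear form on the operations of a given arity defined by a weight. -/
noncomputable def IsWeight.form {χ : DTree X → K} (h : IsWeight R χ) (n : ℕ) :
    Module.Dual K ((quadraticOperad K X R).Op n) :=
  (((freeOperad K X).idealSpan R).sub n).liftQ (freeOperad.lift K n χ) (h n)

theorem IsWeight.form_tree {χ : DTree X → K} (h : IsWeight R χ) {n : ℕ} (t : DTree X)
    (ht : t.nodes = n) : h.form n (tree R t ht) = χ t :=
  (Submodule.liftQ_apply _ _ _).trans (freeOperad.lift_tree _ _ _)

/-- The linear form on the free algebra defined by a weight. -/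
noncomputable def IsWeight.algForm {χ : DTree X → K} (h : IsWeight R χ) :
    Module.Dual K (quadraticOperad K X R).FreeAlgebra :=
  DirectSum.toModule K ℕ K h.form

theorem IsWeight.algForm_mon {χ : DTree X → K} (h : IsWeight R χ) (t : DTree X) :
    h.algForm (mon R t) = χ t := by
  simp [algForm, mon, form_tree]

end quadraticOperad

theorem DTree.finite_nodes {X : Type} [Finite X] (n : ℕ) : {t : DTree X | t.nodes = n}.Finite := by
  induction n using Nat.strong_induction_on with
  | _ n ih =>
  have : {t : DTree X | t.nodes = n} ⊆ {.leaf} ∪ ⋃ (x : X) (i : Fin n),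
      Set.image2 (DTree.node x) {t | t.nodes = i} {t | t.nodes = n - 1 - i} := by
    rintro (_ | ⟨x, l, r⟩) h
    · simp
    · simp only [DTree.nodes, Set.mem_ofPred_eq] at h
      refine Or.inr (Set.mem_iUnion.2 ⟨x, Set.mem_iUnion.2 ⟨⟨l.nodes, by omega⟩, l, rfl, r, ?_, rfl⟩⟩)
      simp only [Set.mem_ofPred_eq]
      omega
  refine Set.Finite.subset ((Set.finite_singleton _).union ?_) this
  exact Set.finite_iUnion fun x => Set.finite_iUnion fun i =>
    (ih _ i.2).image2 _ (ih _ (by omega))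

/-! ### The relations of associative and of dendriform trialgebras -/

namespace freeOperad

variable {K : Type u} [Field K] {X : Type}

open Classical in
theorem monomialPairing_tree (t s : DTree X) (ht : t.nodes = 2) (hs : s.nodes = 2) :
    monomialPairing K X (tree K t ht) (tree K s hs) = if t = s then monomialSign K t else 0 := by
  have h1 : monomialPairing K X (tree K t ht) = monomialSign K t •
      (Finsupp.lapply ⟨t, ht⟩ : ({t : DTree X // t.nodes = 2} →₀ K) →ₗ[K] K) :=
    (Finsupp.linearCombination_single K (1 : K) (⟨t, ht⟩ : {t : DTree X // t.nodes = 2})).trans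
      (one_smul K _)
  rw [h1]
  change monomialSign K t • (Finsupp.single (⟨s, hs⟩ : {t : DTree X // t.nodes = 2}) (1 : K))
    ⟨t, ht⟩ = _
  rw [Finsupp.single_apply]
  simp only [Subtype.mk.injEq, smul_eq_mul, mul_ite, mul_one, mul_zero, eq_comm]

theorem mem_dualRelations {R : Submodule K ((freeOperad K X).Op 2)} {f : (freeOperad K X).Op 2} :
    f ∈ dualRelations R ↔ ∀ r ∈ R, monomialPairing K X f r = 0 := by
  simp [dualRelations, Submodule.mem_iInf]

open Classical in
theorem monomialPairing_eq_lift (s : DTree X) (hs : s.nodes = 2) :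
    (monomialPairing K X).flip (tree K s hs) =
      lift K 2 fun t => if t = s then monomialSign K t else 0 :=
  hom_ext fun t ht => by rw [LinearMap.flip_apply, monomialPairing_tree, lift_tree]

end freeOperad

theorem DTree.nodes_eq_two {X : Type} {t : DTree X} (h : t.nodes = 2) :
    ∃ p q, t = .node q (.node p .leaf .leaf) .leaf ∨ t = .node p .leaf (.node q .leaf .leaf) := by
  match t, h with
  | .node q (.node p .leaf .leaf) .leaf, _ => exact ⟨p, q, Or.inl rfl⟩
  | .node p .leaf (.node q .leaf .leaf), _ => exact ⟨p, q, Or.inr rfl⟩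
  | .leaf, h => simp [DTree.nodes] at h
  | .node q .leaf .leaf, h => simp [DTree.nodes] at h
  | .node q (.node p (.node _ _ _) _) _, h => simp [DTree.nodes] at h; omega
  | .node q (.node p _ (.node _ _ _)) _, h => simp [DTree.nodes] at h; omega
  | .node q (.node p _ _) (.node _ _ _), h => simp [DTree.nodes] at h; omega
  | .node q .leaf (.node p (.node _ _ _) _), h => simp [DTree.nodes] at h
  | .node q .leaf (.node p _ (.node _ _ _)), h => simp [DTree.nodes] at h

/-- The list of marks on the leaves of a tree whose nodes keep the marks of their left subtree, of
their right subtree, or of both. -/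
def DTree.dots : DTree TriOp → List Bool
  | .leaf => [true]
  | .node .left l r => l.dots ++ r.dots.map fun _ => false
  | .node .right l r => (l.dots.map fun _ => false) ++ r.dots
  | .node .mid l r => l.dots ++ r.dots

theorem DTree.length_dots (t : DTree TriOp) : t.dots.length = t.nodes + 1 := by
  induction t with
  | leaf => rfl
  | node x l r hl hr => cases x <;> simp [dots, nodes, hl, hr] <;> omega

theorem DTree.true_mem_dots (t : DTree TriOp) : true ∈ t.dots := by
  induction t with
  | leaf => simp [dots]
  | node x l r hl hr => cases x <;> simp [dots, hl, hr]

/-- This is the composition of `P_Δ` read on characteristic functions: the marks of the inserted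
block survive only if the leaf which it replaces is marked. -/
theorem DTree.dots_graft (t s : DTree TriOp) (i : ℕ) (hi : i ≤ t.nodes) :
    (t.graft i s).dots = t.dots.take i ++
      ((if t.dots.getD i false then s.dots else s.dots.map fun _ => false) ++
        t.dots.drop (i + 1)) := by
  induction t generalizing i with
  | leaf =>
    obtain rfl : i = 0 := by simpa [nodes] using hi
    simp [graft, dots]
  | node x l r hl hr =>
    by_cases h : i ≤ l.nodes
    · have h' : i < l.dots.length := by rw [length_dots]; omega
      have h1 : i - l.dots.length = 0 := by omega
      have h2 : i + 1 - l.dots.length = 0 := by omega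
    
      cases x <;>
        simp [graft, h, dots, hl i h, List.take_append, List.drop_append, h1, h2, h',
          List.getD_eq_getElem?_getD, List.getElem?_append, List.map_append] <;>
        split_ifs <;> simp only [List.length_replicate, List.replicate_add, List.append_assoc]
    · have h' : l.dots.length ≤ i := by rw [length_dots]; omega
      have h1 : i - (l.nodes + 1) = i - l.dots.length := by rw [length_dots]
      have h2 : i + 1 - l.dots.length = i - l.dots.length + 1 := by omega
      have h3 : i - l.dots.length ≤ r.nodes := by
        rw [length_dots]; simp only [nodes] at hi; omega
      have h4 : ¬ i < l.dots.length := by omega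
      have h5 : l.dots.length ≤ i + 1 := by omega
      have h6 : i - l.dots.length < r.dots.length := by rw [length_dots r]; omega
      cases x <;>
        simp [graft, h, dots, h1, hr _ h3, List.take_append, List.drop_append, h2, h', h4, h5,
          List.getD_eq_getElem?_getD, List.getElem?_append, List.map_append,
          List.take_of_length_le, List.drop_of_length_le] <;>
        split_ifs <;> first | rfl | simp

open TriOp

/-- The condition under which the marks of two adjacent leaves may be `c` and `c'` after the
operation `x` is grafted there. -/
def dotRel : Bool → Bool → TriOp → Bool
  | false, false, _ => true
  | true, false, .left => true
  | false, true, .right => true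
  | true, true, .mid => true
  | _, _, _ => false

/-- The operator `f ↦ f(- ∘ᵢ x^*)` of the Koszul differential thus sends the indicator of a list of
marks to zero or to the indicator of the list in which two adjacent marks are merged by `||`. This
is the rule `weight_graft` of a `Coloring`. -/
theorem DTree.dots_graft_corolla (t : DTree TriOp) (x : TriOp) (p r : List Bool) (c c' : Bool)
    (h : t.nodes = p.length + r.length) :
    (t.graft p.length (.node x .leaf .leaf)).dots = p ++ c :: c' :: r ↔
      dotRel c c' x = true ∧ t.dots = p ++ (c || c') :: r := by
  have hl : p.length < t.dots.length := by rw [length_dots]; omega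
  obtain ⟨p', y, r', e, hp⟩ : ∃ p' y r', t.dots = p' ++ y :: r' ∧ p'.length = p.length := by
    refine ⟨t.dots.take p.length, t.dots[p.length], t.dots.drop (p.length + 1), ?_, ?_⟩
    · rw [← List.drop_eq_getElem_cons hl, List.take_append_drop]
    · rw [List.length_take]; omega
  have hr : r'.length = r.length := by
    have := t.length_dots
    rw [e] at this
    simp at this
    omega
  rw [dots_graft _ _ _ (by omega), e, ← hp]
  have e1 : (p' ++ y :: r').take p'.length = p' := by simp
  have e2 : (p' ++ y :: r').drop (p'.length + 1) = r' := by simp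
  have e3 : (p' ++ y :: r').getD p'.length false = y := by simp [List.getD_eq_getElem?_getD]
  rw [e1, e2, e3]
  constructor
  · intro H
    obtain ⟨rfl, H⟩ := List.append_inj H hp
    cases x <;> cases y <;> cases c <;> cases c' <;> simp_all [dotRel, dots]
  · rintro ⟨H1, H⟩
    obtain ⟨rfl, H⟩ := List.append_inj H hp
    cases x <;> cases y <;> cases c <;> cases c' <;> simp_all [dotRel, dots]

variable {K : Type u} [Field K]

theorem dendriformRelations_mem :
    (leftMonomial K left left - (rightMonomial K left left + rightMonomial K left right +
      rightMonomial K left mid) ∈ dendriformRelations K) ∧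
    (leftMonomial K right left - rightMonomial K right left ∈ dendriformRelations K) ∧
    (leftMonomial K left right + leftMonomial K right right + leftMonomial K mid right -
      rightMonomial K right right ∈ dendriformRelations K) ∧
    (leftMonomial K right mid - rightMonomial K right mid ∈ dendriformRelations K) ∧
    (leftMonomial K left mid - rightMonomial K mid right ∈ dendriformRelations K) ∧
    (leftMonomial K mid left - rightMonomial K mid left ∈ dendriformRelations K) ∧
    (leftMonomial K mid mid - rightMonomial K mid mid ∈ dendriformRelations K) := by
  refine ⟨?_, ?_, ?_, ?_, ?_, ?_, ?_⟩ <;> exact Submodule.subset_span (by simp)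

/-- The defining relations of dendriform trialgebras represent the linear forms on ternary monomials
defined by the lists of marks. -/
theorem flip_dendriformRelations :
    (∀ a : List Bool, a = [true, false, false] → (monomialPairing K TriOp).flip
      (leftMonomial K left left - (rightMonomial K left left + rightMonomial K left right +
      rightMonomial K left mid)) = freeOperad.lift K 2 fun s => if s.dots = a then 1 else 0) ∧
    (∀ a : List Bool, a = [false, true, false] → (monomialPairing K TriOp).flip
      (leftMonomial K right left - rightMonomial K right left) =
      freeOperad.lift K 2 fun s => if s.dots = a then 1 else 0) ∧
    (∀ a : List Bool, a = [false, false, true] → (monomialPairing K TriOp).flip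
      (leftMonomial K left right + leftMonomial K right right + leftMonomial K mid right -
      rightMonomial K right right) = freeOperad.lift K 2 fun s => if s.dots = a then 1 else 0) ∧
    (∀ a : List Bool, a = [false, true, true] → (monomialPairing K TriOp).flip
      (leftMonomial K right mid - rightMonomial K right mid) =
      freeOperad.lift K 2 fun s => if s.dots = a then 1 else 0) ∧
    (∀ a : List Bool, a = [true, false, true] → (monomialPairing K TriOp).flip
      (leftMonomial K left mid - rightMonomial K mid right) =
      freeOperad.lift K 2 fun s => if s.dots = a then 1 else 0) ∧
    (∀ a : List Bool, a = [true, true, false] → (monomialPairing K TriOp).flip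
      (leftMonomial K mid left - rightMonomial K mid left) =
      freeOperad.lift K 2 fun s => if s.dots = a then 1 else 0) ∧
    (∀ a : List Bool, a = [true, true, true] → (monomialPairing K TriOp).flip
      (leftMonomial K mid mid - rightMonomial K mid mid) =
      freeOperad.lift K 2 fun s => if s.dots = a then 1 else 0) := by
  have key : ∀ (r : (freeOperad K TriOp).Op 2) (a₀ : List Bool),
      (∀ p q, (monomialPairing K TriOp).flip r (leftMonomial K p q) =
        if (DTree.node q (.node p .leaf .leaf) .leaf).dots = a₀ then 1 else 0) →
      (∀ p q, (monomialPairing K TriOp).flip r (rightMonomial K p q) =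
        if (DTree.node p .leaf (.node q .leaf .leaf)).dots = a₀ then 1 else 0) →
      ∀ a : List Bool, a = a₀ → (monomialPairing K TriOp).flip r =
      freeOperad.lift K 2 fun s => if s.dots = a then 1 else 0 := by
    rintro r a₀ hL hR a rfl
    refine freeOperad.hom_ext fun s hs => ?_
    rw [freeOperad.lift_tree]
    obtain ⟨p, q, rfl | rfl⟩ := DTree.nodes_eq_two hs
    · exact hL p q
    · exact hR p q
  refine ⟨key _ _ ?_ ?_, key _ _ ?_ ?_, key _ _ ?_ ?_, key _ _ ?_ ?_, key _ _ ?_ ?_,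
    key _ _ ?_ ?_, key _ _ ?_ ?_⟩
  all_goals
    simp only [map_add, map_sub, LinearMap.add_apply, LinearMap.sub_apply, LinearMap.flip_apply,
      freeOperad.leftMonomial_eq, freeOperad.rightMonomial_eq, freeOperad.monomialPairing_tree,
      DTree.node.injEq, monomialSign]
    rintro (_ | _ | _) (_ | _ | _) <;> simp [DTree.dots]

/-- Three leaves have seven nonempty sets of marks, one for each defining relation: the monomials of
a relation are those with a given set of marks, and its signs are those of the pairing. -/
theorem exists_dendriformRelation (t : DTree TriOp) (ht : t.nodes = 2) :
    ∃ r ∈ dendriformRelations K, (monomialPairing K TriOp).flip r =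
      freeOperad.lift K 2 fun s => if s.dots = t.dots then 1 else 0 := by
  obtain ⟨h1, h2, h3, h4, h5, h6, h7⟩ := dendriformRelations_mem (K := K)
  obtain ⟨e1, e2, e3, e4, e5, e6, e7⟩ := flip_dendriformRelations (K := K)
  obtain ⟨p, q, rfl | rfl⟩ := DTree.nodes_eq_two ht <;> cases p <;> cases q
  all_goals first
    | exact ⟨_, h1, e1 _ rfl⟩ | exact ⟨_, h2, e2 _ rfl⟩ | exact ⟨_, h3, e3 _ rfl⟩
    | exact ⟨_, h4, e4 _ rfl⟩ | exact ⟨_, h5, e5 _ rfl⟩ | exact ⟨_, h6, e6 _ rfl⟩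
    | exact ⟨_, h7, e7 _ rfl⟩

/-- The dual relations of dendriform trialgebras identify the ternary monomials with the same
marks. -/
theorem tree_sub_tree_mem (t s : DTree TriOp) (ht : t.nodes = 2) (hs : s.nodes = 2)
    (h : t.dots = s.dots) :
    freeOperad.tree K t ht - freeOperad.tree K s hs ∈ dualRelations (dendriformRelations K) := by
  rw [freeOperad.mem_dualRelations]
  suffices dendriformRelations K ≤ LinearMap.ker (monomialPairing K TriOp
      (freeOperad.tree K t ht - freeOperad.tree K s hs)) from fun r hr => this hr
  have key : ∀ (r : (freeOperad K TriOp).Op 2) (a : List Bool),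
      ((monomialPairing K TriOp).flip r =
        freeOperad.lift K 2 fun s => if s.dots = a then 1 else 0) →
      r ∈ LinearMap.ker (monomialPairing K TriOp
        (freeOperad.tree K t ht - freeOperad.tree K s hs)) := by
    intro r a hr
    rw [LinearMap.mem_ker, ← LinearMap.flip_apply, hr, map_sub, freeOperad.lift_tree,
      freeOperad.lift_tree, h, sub_self]
  obtain ⟨e1, e2, e3, e4, e5, e6, e7⟩ := flip_dendriformRelations (K := K)
  refine Submodule.span_le.2 ?_
  rintro r (rfl | rfl | rfl | rfl | rfl | rfl | rfl)
  exacts [key _ _ (e1 _ rfl), key _ _ (e2 _ rfl), key _ _ (e3 _ rfl), key _ _ (e4 _ rfl),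
    key _ _ (e5 _ rfl), key _ _ (e6 _ rfl), key _ _ (e7 _ rfl)]

/-- Such a form is a combination of indicators of sets of marks, each of which is the pairing with a
defining relation. Together with `tree_sub_tree_mem`, this describes the orthogonal completely. -/
theorem lift_dots_eq_zero {f : (freeOperad K TriOp).Op 2}
    (hf : f ∈ dualRelations (dendriformRelations K)) (φ : List Bool → K) :
    freeOperad.lift K 2 (fun s => φ s.dots) f = 0 := by
  have h : (freeOperad.lift K 2 fun s => φ s.dots) = ∑ a ∈ ({[true, false, false],
      [false, true, false], [false, false, true], [false, true, true], [true, false, true],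
      [true, true, false], [true, true, true]} : Finset (List Bool)),
      φ a • freeOperad.lift K 2 fun s => if s.dots = a then (1 : K) else 0 := by
    refine freeOperad.hom_ext fun t ht => ?_
    simp only [LinearMap.sum_apply, LinearMap.smul_apply, freeOperad.lift_tree, smul_eq_mul,
      mul_ite, mul_one, mul_zero, Finset.sum_ite_eq]
    rw [if_pos]
    obtain ⟨p, q, rfl | rfl⟩ := DTree.nodes_eq_two ht <;> cases p <;> cases q <;>
      simp [DTree.dots]
  have key : ∀ a (t : DTree TriOp), t.nodes = 2 → t.dots = a →
      freeOperad.lift K 2 (fun s => if s.dots = a then (1 : K) else 0) f = 0 := by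
    rintro _ t ht rfl
    obtain ⟨r, hr, e⟩ := exists_dendriformRelation (K := K) t ht
    rw [← e, LinearMap.flip_apply]
    exact freeOperad.mem_dualRelations.1 hf r hr
  rw [h, LinearMap.sum_apply]
  refine Finset.sum_eq_zero fun a ha => ?_
  rw [LinearMap.smul_apply, smul_eq_zero]
  right
  simp only [Finset.mem_insert, Finset.mem_singleton] at ha
  obtain rfl | rfl | rfl | rfl | rfl | rfl | rfl := ha
  · exact key _ (.node left (.node left .leaf .leaf) .leaf) rfl rfl
  · exact key _ (.node left (.node right .leaf .leaf) .leaf) rfl rfl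
  · exact key _ (.node right .leaf (.node right .leaf .leaf)) rfl rfl
  · exact key _ (.node mid (.node right .leaf .leaf) .leaf) rfl rfl
  · exact key _ (.node mid (.node left .leaf .leaf) .leaf) rfl rfl
  · exact key _ (.node left (.node mid .leaf .leaf) .leaf) rfl rfl
  · exact key _ (.node mid (.node mid .leaf .leaf) .leaf) rfl rfl

/-- The coefficient of a tree in a ternary operation of the free operad. -/
noncomputable def coeffForm (K : Type u) [Field K] (t : DTree TriOp) :
    (freeOperad K TriOp).Op 2 →ₗ[K] K :=
  open Classical in freeOperad.lift K 2 fun s => if s = t then 1 else 0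

theorem coeffForm_tree (t s : DTree TriOp) (hs : s.nodes = 2) [Decidable (s = t)] :
    coeffForm K t (freeOperad.tree K s hs) = if s = t then 1 else 0 := by
  rw [coeffForm, freeOperad.lift_tree]
  congr

theorem flip_pairing_tree (t : DTree TriOp) (ht : t.nodes = 2) :
    (monomialPairing K TriOp).flip (freeOperad.tree K t ht) =
      monomialSign K t • coeffForm K t := by
  classical
  refine freeOperad.hom_ext fun s hs => ?_
  rw [freeOperad.monomialPairing_eq_lift, freeOperad.lift_tree, LinearMap.smul_apply,
    coeffForm_tree]
  by_cases h : s = t <;> simp [h]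

theorem eq_sum_coeffForm (f : (freeOperad K TriOp).Op 2) :
    let L := fun p q => coeffForm K (.node q (.node p .leaf .leaf) .leaf) f • leftMonomial K p q
    let R := fun p q => coeffForm K (.node p .leaf (.node q .leaf .leaf)) f • rightMonomial K p q
    f = L left left + L left right + L left mid + L right left + L right right + L right mid +
      L mid left + L mid right + L mid mid + R left left + R left right + R left mid +
      R right left + R right right + R right mid + R mid left + R mid right + R mid mid := by
  classical
  let L := fun p q => (coeffForm K (.node q (.node p .leaf .leaf) .leaf)).smulRight
    (leftMonomial K p q)
  let R := fun p q => (coeffForm K (.node p .leaf (.node q .leaf .leaf))).smulRight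
    (rightMonomial K p q)
  have h : LinearMap.id = L left left + L left right + L left mid + L right left + L right right +
      L right mid + L mid left + L mid right + L mid mid + R left left + R left right +
      R left mid + R right left + R right right + R right mid + R mid left + R mid right +
      R mid mid := by
    refine freeOperad.hom_ext fun t ht => ?_
    simp only [L, R, LinearMap.add_apply, LinearMap.smulRight_apply, coeffForm_tree]
    obtain ⟨p, q, rfl | rfl⟩ := DTree.nodes_eq_two ht <;> cases p <;> cases q <;>
      simp only [DTree.node.injEq, reduceCtorEq, and_false, and_true, if_false, if_true,
        one_smul, zero_smul, add_zero, zero_add] <;> rfl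
  exact LinearMap.congr_fun h f

/-- Orthogonality to the differences of `tree_sub_tree_mem` forces the signed coefficients to be
constant on each class of marks; the element is then a combination of the seven relations, with
coefficients read on one monomial of each class. This makes the dendriform basis available for the
Koszul dual of trialgebras. -/
theorem dualRelations_dualRelations :
    dualRelations (dualRelations (dendriformRelations K)) = dendriformRelations K := by
  apply le_antisymm
  · intro f hf
    rw [freeOperad.mem_dualRelations] at hf
    have key : ∀ (t s : DTree TriOp), t.nodes = 2 → s.nodes = 2 → t.dots = s.dots →
        monomialSign K t * coeffForm K t f = monomialSign K s * coeffForm K s f := by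
      intro t s ht hs h
      have := hf _ (tree_sub_tree_mem t s ht hs h)
      rw [← LinearMap.flip_apply, map_sub, flip_pairing_tree, flip_pairing_tree,
        LinearMap.sub_apply, sub_eq_zero] at this
      exact this
    -- The 18 ternary monomials fall into seven classes, hence 11 equalities.
    have k1 := key (.node left (.node left .leaf .leaf) .leaf)
      (.node left .leaf (.node left .leaf .leaf)) rfl rfl rfl
    have k2 := key (.node left (.node left .leaf .leaf) .leaf)
      (.node left .leaf (.node right .leaf .leaf)) rfl rfl rfl
    have k3 := key (.node left (.node left .leaf .leaf) .leaf)
      (.node left .leaf (.node mid .leaf .leaf)) rfl rfl rfl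
    have k4 := key (.node left (.node right .leaf .leaf) .leaf)
      (.node right .leaf (.node left .leaf .leaf)) rfl rfl rfl
    have k5 := key (.node right (.node left .leaf .leaf) .leaf)
      (.node right .leaf (.node right .leaf .leaf)) rfl rfl rfl
    have k6 := key (.node right (.node right .leaf .leaf) .leaf)
      (.node right .leaf (.node right .leaf .leaf)) rfl rfl rfl
    have k7 := key (.node right (.node mid .leaf .leaf) .leaf)
      (.node right .leaf (.node right .leaf .leaf)) rfl rfl rfl
    have k8 := key (.node mid (.node right .leaf .leaf) .leaf)
      (.node right .leaf (.node mid .leaf .leaf)) rfl rfl rfl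
    have k9 := key (.node mid (.node left .leaf .leaf) .leaf)
      (.node mid .leaf (.node right .leaf .leaf)) rfl rfl rfl
    have k10 := key (.node left (.node mid .leaf .leaf) .leaf)
      (.node mid .leaf (.node left .leaf .leaf)) rfl rfl rfl
    have k11 := key (.node mid (.node mid .leaf .leaf) .leaf)
      (.node mid .leaf (.node mid .leaf .leaf)) rfl rfl rfl
    simp only [monomialSign, one_mul, neg_mul] at k1 k2 k3 k4 k5 k6 k7 k8 k9 k10 k11
    have e := eq_sum_coeffForm f
    simp only at e
    obtain ⟨h1, h2, h3, h4, h5, h6, h7⟩ := dendriformRelations_mem (K := K)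
    have e' := add_mem (add_mem (add_mem (add_mem (add_mem (add_mem
      (Submodule.smul_mem _ (coeffForm K (.node left (.node left .leaf .leaf) .leaf) f) h1)
      (Submodule.smul_mem _ (coeffForm K (.node left (.node right .leaf .leaf) .leaf) f) h2))
      (Submodule.smul_mem _ (coeffForm K (.node right (.node left .leaf .leaf) .leaf) f) h3))
      (Submodule.smul_mem _ (coeffForm K (.node mid (.node right .leaf .leaf) .leaf) f) h4))
      (Submodule.smul_mem _ (coeffForm K (.node mid (.node left .leaf .leaf) .leaf) f) h5))
      (Submodule.smul_mem _ (coeffForm K (.node left (.node mid .leaf .leaf) .leaf) f) h6))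
      (Submodule.smul_mem _ (coeffForm K (.node mid (.node mid .leaf .leaf) .leaf) f) h7)
    rw [eq_neg_iff_add_eq_zero, add_comm, ← eq_neg_iff_add_eq_zero] at k1 k2 k3 k4 k5 k8 k9 k10 k11
    have k6' := k6.trans (neg_eq_iff_eq_neg.2 k5)
    have k7' := k7.trans (neg_eq_iff_eq_neg.2 k5)
    rw [e, k1, k2, k3, k4, k5, k6', k7', k8, k9, k10, k11]
    refine (congrArg (· ∈ dendriformRelations K) ?_).mp e'
    module
  · intro f hf
    rw [freeOperad.mem_dualRelations]
    intro g hg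
    -- The pairing is symmetric because distinct monomials are orthogonal.
    have hs : (monomialPairing K TriOp).flip = monomialPairing K TriOp := by
      classical
      refine freeOperad.hom_ext fun t ht => freeOperad.hom_ext fun s hs => ?_
      rw [LinearMap.flip_apply, freeOperad.monomialPairing_tree, freeOperad.monomialPairing_tree]
      by_cases h : t = s
      · subst h; rfl
      · rw [if_neg h, if_neg (Ne.symm h)]
    rw [← hs, LinearMap.flip_apply]
    exact freeOperad.mem_dualRelations.1 hg f hf

/-! ### Bases of quadratic operads -/

namespace quadraticOperad

variable {K : Type u} [Field K] {X : Type} {R : Submodule K ((freeOperad K X).Op 2)}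

theorem finite_op [Finite X] (n : ℕ) : Module.Finite K ((quadraticOperad K X R).Op n) := by
  have : Finite {t : DTree X // t.nodes = n} := (DTree.finite_nodes (X := X) n).to_subtype
  refine ⟨⟨(Set.finite_range fun t : {t : DTree X // t.nodes = n} =>
    tree R t.1 t.2).toFinset, ?_⟩⟩
  rw [Set.Finite.coe_toFinset]
  exact span_tree R n

theorem act3_eq_of_sub_mem (R : Submodule K ((freeOperad K X).Op 2)) {f g : (freeOperad K X).Op 2}
    (h : f - g ∈ R) : freeOperad.lift K 2 (act3 R) f = freeOperad.lift K 2 (act3 R) g := by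
  rw [← sub_add_cancel f g, map_add, act3_relation R h, zero_add]

/-- A family of trees which represents a basis of a quadratic operad, with the dual basis. -/
structure TreeBasis (R : Submodule K ((freeOperad K X).Op 2)) (ι : Type) where
  tree : ι → DTree X
  weight : ι → DTree X → K
  isWeight : ∀ i, IsWeight R (weight i)
  weight_self : ∀ i, weight i (tree i) = 1
  weight_of_ne : ∀ i j, i ≠ j → weight i (tree j) = 0
  mem_span : ∀ t, mon R t ∈ Submodule.span K (Set.range fun i => mon R (tree i))

namespace TreeBasis

variable {ι : Type} (B : TreeBasis R ι)

theorem linearIndependent_mon : LinearIndependent K fun i => mon R (B.tree i) := by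
  classical
  rw [linearIndependent_iff]
  intro l hl
  ext i
  have := congrArg (B.isWeight i).algForm hl
  rw [Finsupp.apply_linearCombination, map_zero, Finsupp.linearCombination_apply,
    Finsupp.sum, Finset.sum_eq_single i] at this
  · simpa [IsWeight.algForm_mon, B.weight_self] using this
  · intro j _ hj
    simp [IsWeight.algForm_mon, B.weight_of_ne i j hj.symm]
  · intro hi
    simp [Finsupp.notMem_support_iff.1 hi]

theorem span_mon_eq_top : ⊤ ≤ Submodule.span K (Set.range fun i => mon R (B.tree i)) := by
  rw [← span_mon R, Submodule.span_le]
  rintro _ ⟨t, rfl⟩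
  exact B.mem_span t

/-- The basis of the free algebra on one generator. -/
noncomputable def algBasis : Module.Basis ι K (quadraticOperad K X R).FreeAlgebra :=
  Module.Basis.mk B.linearIndependent_mon B.span_mon_eq_top

theorem algBasis_apply (i : ι) : B.algBasis i = mon R (B.tree i) := by
  simp [algBasis]

theorem linearIndependent_tree (n : ℕ) : LinearIndependent K
    fun i : {i // (B.tree i).nodes = n} => quadraticOperad.tree R (B.tree i.1) i.2 := by
  refine LinearIndependent.of_comp (DirectSum.lof K ℕ (quadraticOperad K X R).Op n) ?_
  have := B.linearIndependent_mon.comp (Subtype.val : {i // (B.tree i).nodes = n} → ι)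
    Subtype.val_injective
  convert this using 2
  funext i
  exact lof_tree R _ _

theorem span_tree_eq_top (n : ℕ) : ⊤ ≤ Submodule.span K (Set.range
    fun i : {i // (B.tree i).nodes = n} => quadraticOperad.tree R (B.tree i.1) i.2) := by
  intro x _
  have hx : DirectSum.lof K ℕ (quadraticOperad K X R).Op n x ∈
      Submodule.span K (Set.range fun i => mon R (B.tree i)) := B.span_mon_eq_top trivial
  have := Submodule.mem_map_of_mem (f := DirectSum.component K ℕ (quadraticOperad K X R).Op n) hx
  rw [DirectSum.component.lof_self, Submodule.map_span] at this
  refine Submodule.span_le.2 ?_ this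
  rintro _ ⟨_, ⟨i, rfl⟩, rfl⟩
  by_cases h : (B.tree i).nodes = n
  · simp only [← lof_tree R (B.tree i) h, DirectSum.component.lof_self]
    exact Submodule.subset_span ⟨⟨i, h⟩, rfl⟩
  · have : DirectSum.component K ℕ (quadraticOperad K X R).Op n (mon R (B.tree i)) = 0 := by
      rw [mon, DirectSum.component.of, dif_neg h]
    simp only [this]
    exact zero_mem _

/-- The basis of the operations of a given arity. -/
noncomputable def opBasis (n : ℕ) :
    Module.Basis {i // (B.tree i).nodes = n} K ((quadraticOperad K X R).Op n) :=
  Module.Basis.mk (B.linearIndependent_tree n) (B.span_tree_eq_top n)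

theorem opBasis_apply (n : ℕ) (i : {i // (B.tree i).nodes = n}) :
    B.opBasis n i = quadraticOperad.tree R (B.tree i.1) i.2 := by
  simp [opBasis]

theorem finite_index [Finite X] (n : ℕ) : Finite {i // (B.tree i).nodes = n} :=
  have := finite_op (R := R) n
  Module.Finite.finite_basis (B.opBasis n)

open Classical in
/-- The basis of the linear forms on the operations of a given arity. -/
noncomputable def formBasis [Finite X] (n : ℕ) :
    Module.Basis {i // (B.tree i).nodes = n} K (Module.Dual K ((quadraticOperad K X R).Op n)) :=
  have := B.finite_index n
  (B.opBasis n).dualBasis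

theorem formBasis_apply [Finite X] (n : ℕ) (i : {i // (B.tree i).nodes = n}) :
    B.formBasis n i = (B.isWeight i.1).form n := by
  classical
  have := B.finite_index n
  refine (B.opBasis n).ext fun j => ?_
  rw [formBasis, Module.Basis.dualBasis_apply_self, opBasis_apply, IsWeight.form_tree]
  split_ifs with h
  · rw [h, B.weight_self]
  · rw [B.weight_of_ne]
    exact fun h' => h (Subtype.ext h'.symm)

end TreeBasis

end quadraticOperad

/-! ### The operad of associative trialgebras -/

theorem DTree.exists_dots_eq (t : DTree TriOp) (i : ℕ) (hi : i ≤ t.nodes) :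
    ∃ p y r, t.dots = p ++ y :: r ∧ p.length = i ∧ p.length + r.length = t.nodes := by
  have hl : i < t.dots.length := by rw [length_dots]; omega
  refine ⟨t.dots.take i, t.dots[i], t.dots.drop (i + 1), ?_, ?_, ?_⟩
  · rw [← List.drop_eq_getElem_cons hl, List.take_append_drop]
  · rw [List.length_take]; omega
  · rw [List.length_take, List.length_drop, length_dots]; omega

theorem DTree.dots_graft_of_eq {t : DTree TriOp} (s : DTree TriOp) {p r : List Bool} {y : Bool}
    (h : t.dots = p ++ y :: r) : (t.graft p.length s).dots =
      p ++ ((if y then s.dots else s.dots.map fun _ => false) ++ r) := by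
  have hl := t.length_dots
  rw [h] at hl
  simp only [List.length_append, List.length_cons] at hl
  rw [dots_graft _ _ _ (by omega), h]
  simp [List.getD_eq_getElem?_getD]

namespace quadraticOperad

variable {K : Type u} [Field K]

/-- The relations of associative trialgebras. -/
noncomputable abbrev triasRelations (K : Type u) [Field K] :
    Submodule K ((freeOperad K TriOp).Op 2) := dualRelations (dendriformRelations K)

/-- The linear form given by a list of marks. -/
noncomputable def dotWeight (K : Type u) [Field K] (a : List Bool) (t : DTree TriOp) : K :=
  if t.dots = a then 1 else 0

/-- The condition that a graft has marks `p ++ (q ++ r)` splits into a condition on each tree. The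
index `none`, with the constant function `1`, is added to the family for the case in which the
inserted tree is unconstrained. -/
theorem isWeight_dotWeight (a : List Bool) : IsWeight (triasRelations K) (dotWeight K a) := by
  refine isWeight_of_family (triasRelations K) (W := Option (List Bool))
    (fun w => w.elim (fun _ => 1) (dotWeight K)) ?_ ?_ (some a)
  · rintro (_ | a) f hf
    · exact lift_dots_eq_zero hf fun _ => 1
    · exact lift_dots_eq_zero hf fun b => if b = a then 1 else 0
  · rintro (_ | a) n m i hi
    · exact ⟨1, none, none, by simp⟩
    obtain ⟨p, q, r, rfl, hp, hq⟩ : ∃ p q r, a = p ++ (q ++ r) ∧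
        (a.length = n + m + 1 → p.length = i) ∧ (a.length = n + m + 1 → q.length = m + 1) := by
      refine ⟨a.take i, (a.drop i).take (m + 1), (a.drop i).drop (m + 1), by simp, ?_, ?_⟩
      · intro h
        simp
        omega
      · intro h
        simp
        omega
    by_cases hl : (p ++ (q ++ r)).length = n + m + 1
    · specialize hp hl
      specialize hq hl
      have key : ∀ t s : DTree TriOp, t.nodes = n → s.nodes = m →
          ((t.graft i s).dots = p ++ (q ++ r) ↔ (t.dots = p ++ true :: r ∧ s.dots = q) ∨
            (t.dots = p ++ false :: r ∧ q = List.replicate (m + 1) false)) := by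
        intro t s ht hs
        obtain ⟨p', y, r', e, hp', hr'⟩ := t.exists_dots_eq i (by omega)
        rw [← hp', DTree.dots_graft_of_eq s e, e]
        have hsl := s.length_dots
        constructor
        · intro H
          obtain ⟨hp₂, H₂⟩ := List.append_inj H (by omega)
          obtain ⟨H₃, hr₂⟩ := List.append_inj H₂ (by cases y <;> simp <;> omega)
          subst hp₂ hr₂
          cases y
          · right
            simpa [hsl, hs, eq_comm] using H₃
          · left
            simpa using H₃
        · rintro (⟨H, rfl⟩ | ⟨H, rfl⟩)
          · obtain ⟨hp₂, H₂⟩ := List.append_inj H (by omega)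
            simp only [List.cons.injEq] at H₂
            simp [H₂, hp₂]
          · obtain ⟨hp₂, H₂⟩ := List.append_inj H (by omega)
            simp only [List.cons.injEq] at H₂
            simp [H₂, hp₂, hsl, hs]
      -- If `q` has no mark, the leaf of `t` must be unmarked, since `s` always has a mark, and
      -- nothing more is asked of `s`. Otherwise the leaf of `t` is marked and `q` is the list of
      -- marks of `s`.
      by_cases h : q = List.replicate (m + 1) false
      · refine ⟨1, some (p ++ false :: r), none, fun t s ht hs => ?_⟩
        have hne : s.dots ≠ List.replicate (m + 1) false := by
          intro hs'
          have := s.true_mem_dots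
          rw [hs'] at this
          simp at this
        have := key t s ht hs
        simp only [h, hne, and_false, false_or, and_true] at this
        simp [dotWeight, h, this]
      · refine ⟨1, some (p ++ true :: r), some q, fun t s ht hs => ?_⟩
        simp only [Option.elim, dotWeight, key t s ht hs, h, and_false, or_false]
        split_ifs <;> simp_all
    · refine ⟨0, none, none, fun t s ht hs => ?_⟩
      simp only [Option.elim, dotWeight, zero_mul, ite_eq_right_iff]
      intro h
      exfalso
      apply hl
      rw [← h, DTree.length_dots, DTree.nodes_graft, ht, hs]

end quadraticOperad

/-- A tree with a given list of marks. -/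
def dotTree : List Bool → DTree TriOp
  | [] => .leaf
  | [_] => .leaf
  | false :: b :: c => .node right .leaf (dotTree (b :: c))
  | true :: b :: c => if true ∈ b :: c then .node mid .leaf (dotTree (b :: c))
      else .node left .leaf (dotTree (true :: c))
termination_by a => a.length

theorem dots_dotTree (a : List Bool) (ha : true ∈ a) : (dotTree a).dots = a := by
  fun_induction dotTree a with
  | case1 => simp at ha
  | case2 b => simpa [DTree.dots] using ha
  | case3 b c ih => simp [DTree.dots, ih (by simpa using ha)]
  | case4 b c h ih => simp [DTree.dots, ih h]
  | case5 b c h ih =>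
    have hb : b = false := by
      by_contra hb
      simp_all
    have hc : ∀ x ∈ c, x = false := by
      intro x hx
      by_contra hx'
      simp_all
    simp [DTree.dots, ih (by simp), hb]
    exact List.eq_replicate_iff.2 ⟨rfl, hc⟩ ▸ by simp

/-! ### Normal forms of trialgebra monomials -/

namespace quadraticOperad

variable {K : Type u} [Field K]

/-- The associativity relations between the operations of associative trialgebras. -/
theorem op_op_eq_of_dots {p q p' q' : TriOp} (h : (DTree.node q (.node p .leaf .leaf) .leaf).dots =
    (DTree.node p' .leaf (.node q' .leaf .leaf)).dots)
    (a b c : (quadraticOperad K TriOp (triasRelations K)).FreeAlgebra) :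
    op (triasRelations K) q (op _ p a b) c = op _ p' a (op _ q' b c) := by
  have := act3_eq_of_sub_mem _ (tree_sub_tree_mem (K := K) (.node q (.node p .leaf .leaf) .leaf)
    (.node p' .leaf (.node q' .leaf .leaf)) (by simp [DTree.nodes]) (by simp [DTree.nodes]) h)
  rw [← freeOperad.leftMonomial_eq, ← freeOperad.rightMonomial_eq] at this
  have := LinearMap.congr_fun (LinearMap.congr_fun (LinearMap.congr_fun this a) b) c
  rwa [act3_leftMonomial, act3_rightMonomial] at this

/-- The operation `≺` of associative trialgebras only depends on the size of its right argument. -/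
theorem op_left_mon_eq (a : (quadraticOperad K TriOp (triasRelations K)).FreeAlgebra)
    (s : DTree TriOp) : op (triasRelations K) left a (mon _ s) =
      (fun b => op (triasRelations K) left b (mon _ .leaf))^[s.nodes + 1] a := by
  induction s generalizing a with
  | leaf => rfl
  | node x l r hl hr =>
    rw [← op_mon, ← op_op_eq_of_dots (p := left) (q := left) (by cases x <;> rfl), hr, hl,
      ← Function.iterate_add_apply]
    congr 1
    simp only [DTree.nodes]
    omega

theorem exists_dots_left_eq (p q : TriOp) :
    ∃ p' q', (DTree.node q (.node p .leaf .leaf) .leaf).dots =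
      (DTree.node p' .leaf (.node q' .leaf .leaf)).dots := by
  cases p <;> cases q
  exacts [⟨left, left, rfl⟩, ⟨right, right, rfl⟩, ⟨mid, right, rfl⟩, ⟨right, left, rfl⟩,
    ⟨right, right, rfl⟩, ⟨right, mid, rfl⟩, ⟨mid, left, rfl⟩, ⟨right, right, rfl⟩,
    ⟨mid, mid, rfl⟩]

theorem dots_node_assoc {p q p' q' : TriOp} (h : (DTree.node q (.node p .leaf .leaf) .leaf).dots =
    (DTree.node p' .leaf (.node q' .leaf .leaf)).dots) (a b c : DTree TriOp) :
    (DTree.node q (.node p a b) c).dots = (DTree.node p' a (.node q' b c)).dots := by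
  cases p <;> cases q <;> cases p' <;> cases q' <;> simp [DTree.dots] at h <;>
    simp [DTree.dots] <;> rw [List.replicate_add, List.append_assoc]

theorem nodes_dotTree (a : List Bool) : (dotTree a).nodes = a.length - 1 := by
  fun_induction dotTree a with
  | case1 => rfl
  | case2 b => rfl
  | case3 b c ih => simp [DTree.nodes, ih]
  | case4 b c h ih => simp [DTree.nodes, ih]
  | case5 b c h ih => simp [DTree.nodes, ih]

/-- The relations move every bracketing to the right, which replaces the left subtree by a proper
subtree of it; the inner induction runs on this left subtree. Once it is a leaf, the outer induction
on the number of nodes normalizes the right subtree. Marks are preserved throughout. -/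
theorem mon_eq_mon_dotTree (t : DTree TriOp) :
    mon (triasRelations K) t = mon _ (dotTree t.dots) := by
  induction h : t.nodes using Nat.strong_induction_on generalizing t with
  | _ n ih =>
  have ih' : ∀ s : DTree TriOp, s.nodes < n → mon (triasRelations K) s = mon _ (dotTree s.dots) :=
    fun s hs => ih _ hs s rfl
  clear ih
  obtain _ | ⟨x, l, r⟩ := t
  · simp [DTree.dots, dotTree]
  · induction l generalizing x r with
    | leaf =>
      have hr := ih' r (by simp only [DTree.nodes] at h; omega)
      have hne := r.true_mem_dots
      obtain ⟨b, c, e⟩ : ∃ b c, r.dots = b :: c := by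
        cases hd : r.dots with
        | nil => simp [hd] at hne
        | cons b c => exact ⟨b, c, rfl⟩
      rw [e] at hr hne
      cases x
      -- The normal form discards the marks of `r`; this is legitimate because `≺` sees only the
      -- size of its right argument.
      · rw [← op_mon, op_left_mon_eq]
        have : dotTree (DTree.node left .leaf r).dots =
            .node left .leaf (dotTree (true :: List.replicate c.length false)) := by
          simp [DTree.dots, e, dotTree]
        rw [this, ← op_mon, op_left_mon_eq, nodes_dotTree]
        have := r.length_dots
        rw [e] at this
        simp at this
        simp [this]
      · have : dotTree (DTree.node right .leaf r).dots = .node right .leaf (dotTree (b :: c)) := by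
          simp [DTree.dots, e, dotTree]
        rw [this, ← op_mon, ← op_mon, hr]
      · have : dotTree (DTree.node mid .leaf r).dots = .node mid .leaf (dotTree (b :: c)) := by
          simp only [DTree.dots, e, List.cons_append, List.nil_append, dotTree, hne, if_true]
        rw [this, ← op_mon, ← op_mon, hr]
    | node p l₁ l₂ h₁ h₂ =>
      obtain ⟨p', q', e⟩ := exists_dots_left_eq p x
      rw [← op_mon, ← op_mon, op_op_eq_of_dots e, op_mon, op_mon, dots_node_assoc e]
      refine h₁ _ _ ?_
      simp only [DTree.nodes] at h ⊢
      omega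

/-- The basis of the operad of associative trialgebras. -/
noncomputable def triasBasis (K : Type u) [Field K] :
    TreeBasis (triasRelations K) {a : List Bool // true ∈ a} where
  tree a := dotTree a.1
  weight a := dotWeight K a.1
  isWeight a := isWeight_dotWeight a.1
  weight_self a := by simp [dotWeight, dots_dotTree a.1 a.2]
  weight_of_ne a b h := by
    rw [dotWeight, dots_dotTree b.1 b.2, if_neg]
    exact fun h' => h (Subtype.ext h'.symm)
  mem_span t := by
    rw [mon_eq_mon_dotTree]
    exact Submodule.subset_span ⟨⟨t.dots, t.true_mem_dots⟩, rfl⟩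

theorem mon_eq_of_dots {t s : DTree TriOp} (h : t.dots = s.dots) :
    mon (triasRelations K) t = mon _ s := by
  rw [mon_eq_mon_dotTree t, h, ← mon_eq_mon_dotTree]

theorem tree_eq_of_dots {t s : DTree TriOp} (h : t.dots = s.dots) {n : ℕ} (ht : t.nodes = n)
    (hs : s.nodes = n) : tree (triasRelations K) t ht = tree _ s hs :=
  DirectSum.of_injective (β := (quadraticOperad K TriOp (triasRelations K)).Op) n <|
    (lof_tree _ t ht).trans <| (mon_eq_of_dots h).trans (lof_tree _ s hs).symm

end quadraticOperad

/-- The set of the positions of the marks in a list. -/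
def dotCell (a : List Bool) : Finset ℕ := (Finset.range a.length).filter fun p => a[p]? = some true

theorem mem_dotCell {a : List Bool} {p : ℕ} : p ∈ dotCell a ↔ a[p]? = some true := by
  simp only [dotCell, Finset.mem_filter, Finset.mem_range, and_iff_right_iff_imp]
  intro h
  by_contra h'
  simp [List.getElem?_eq_none (not_lt.1 h')] at h

/-- Lists of marks are cells of simplices. -/
def dotCellEquiv (n : ℕ) :
    {a : {a : List Bool // true ∈ a} // (dotTree a.1).nodes = n} ≃ SimplexCell n where
  toFun a := ⟨dotCell a.1.1, by
      obtain ⟨p, hp⟩ := List.mem_iff_getElem?.1 a.1.2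
      exact ⟨p, mem_dotCell.2 hp⟩, by
      have := a.2
      rw [quadraticOperad.nodes_dotTree] at this
      refine (Finset.filter_subset _ _).trans (Finset.range_mono ?_)
      omega⟩
  invFun S := ⟨⟨(List.range (n + 1)).map fun p => decide (p ∈ S.1), by
      obtain ⟨p, hp⟩ := S.2.1
      rw [List.mem_map]
      exact ⟨p, List.mem_range.2 (Finset.mem_range.1 (S.2.2 hp)), by simpa using hp⟩⟩, by
      simp [quadraticOperad.nodes_dotTree]⟩
  left_inv a := by
    apply Subtype.ext
    apply Subtype.ext
    have h := a.2
    rw [quadraticOperad.nodes_dotTree] at h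
    have hl : a.1.1.length = n + 1 := by
      have := List.length_pos_of_mem a.1.2
      omega
    refine List.ext_getElem? fun p => ?_
    by_cases hp : p < n + 1
    · have hp' : p < a.1.1.length := by omega
      simp [hp, mem_dotCell, List.getElem?_eq_getElem hp']
    · have hp' : a.1.1.length ≤ p := by omega
      simp [hp, hp']
  right_inv S := by
    apply Subtype.ext
    ext p
    simp only [mem_dotCell, List.getElem?_map, Option.map_eq_some_iff, decide_eq_true_eq]
    constructor
    · rintro ⟨q, hq, hS⟩
      obtain ⟨_, rfl⟩ := List.getElem?_eq_some_iff.1 hq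
      simpa using hS
    · intro hp
      exact ⟨p, List.getElem?_range (Finset.mem_range.1 (S.2.2 hp)), hp⟩

theorem dotCell_subset (t : DTree TriOp) : dotCell t.dots ⊆ Finset.range (t.nodes + 1) :=
  (Finset.filter_subset _ _).trans (Finset.range_mono t.length_dots.le)

theorem dotCell_nonempty (t : DTree TriOp) : (dotCell t.dots).Nonempty := by
  obtain ⟨p, hp⟩ := List.mem_iff_getElem?.1 t.true_mem_dots
  exact ⟨p, mem_dotCell.2 hp⟩

theorem dotCell_graft (t s : DTree TriOp) (i : ℕ) (hi : i ≤ t.nodes) :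
    dotCell (t.graft i s).dots = simplexComp s.nodes i (dotCell t.dots) (dotCell s.dots) := by
  obtain ⟨p, y, r, e, rfl, hr⟩ := t.exists_dots_eq i hi
  have hs := s.length_dots
  ext q
  rw [mem_simplexComp _ _ _ _ (dotCell_subset s), mem_dotCell, mem_dotCell, mem_dotCell,
    mem_dotCell, mem_dotCell, DTree.dots_graft_of_eq s e, e]
  have hl : (if y = true then s.dots else s.dots.map fun _ => false).length = s.nodes + 1 := by
    cases y <;> simp [hs]
  rcases lt_or_ge q p.length with h | h
  · have h1 : ¬ p.length ≤ q := by omega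
    have h2 : ¬ p.length + s.nodes < q := by omega
    simp [List.getElem?_append, h, h1, h2]
  rcases lt_or_ge (p.length + s.nodes) q with h' | h'
  · have h1 : ¬ q < p.length := by omega
    have h2 : ¬ q ≤ p.length + s.nodes := by omega
    have h3 : ¬ q - p.length < s.nodes + 1 := by omega
    have h4 : ¬ q - s.nodes < p.length := by omega
    have h5 : q - s.nodes - p.length = q - p.length - (s.nodes + 1) + 1 := by omega
    simp only [List.getElem?_append, hl, h1, h2, h3, h4, h5, h', if_false, false_and, and_false,
      false_or, true_and, List.getElem?_cons_succ]
  · have h1 : ¬ q < p.length := by omega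
    have h2 : ¬ p.length + s.nodes < q := by omega
    have h3 : q - p.length < s.nodes + 1 := by omega
    have h4 : q - p.length < s.dots.length := by omega
    simp only [List.getElem?_append, hl, h1, h2, h3, h, h', if_false, if_true, false_and,
      false_or, or_false, true_and, lt_irrefl, Nat.sub_self, List.getElem?_cons_zero]
    cases y <;> simp [h4]

/-! ### Identification with the chains of simplices -/

namespace quadraticOperad

variable {K : Type u} [Field K]

/-- The operations of the operad of associative trialgebras are chains of simplices. -/
noncomputable def simplexEquiv (K : Type u) [Field K] (n : ℕ) :
    (quadraticOperad K TriOp (triasRelations K)).Op n ≃ₗ[K] (simplexOperad K).Op n :=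
  ((triasBasis K).opBasis n).repr ≪≫ₗ Finsupp.domLCongr (dotCellEquiv n)

theorem simplexEquiv_tree {n : ℕ} (t : DTree TriOp) (h : t.nodes = n) :
    simplexEquiv K n (tree _ t h) = (Finsupp.single
      ⟨dotCell t.dots, dotCell_nonempty t, h ▸ dotCell_subset t⟩ 1 : SimplexCell n →₀ K) := by
  have hd := dots_dotTree t.dots t.true_mem_dots
  have hn : (dotTree t.dots).nodes = n := by
    rw [nodes_dotTree, t.length_dots, h, Nat.add_sub_cancel]
  have : tree (triasRelations K) t h =
      (triasBasis K).opBasis n ⟨⟨t.dots, t.true_mem_dots⟩, hn⟩ := by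
    rw [TreeBasis.opBasis_apply]
    exact tree_eq_of_dots hd.symm _ _
  rw [this]
  refine (congrArg (Finsupp.domLCongr (R := K) (M := K) (dotCellEquiv n))
    (Module.Basis.repr_self _ _)).trans ?_
  exact Finsupp.domLCongr_single _ _ _

/-- The operad of the standard simplices is the operad of associative trialgebras. -/
noncomputable def simplexIso (K : Type u) [Field K] :
    (simplexOperad K).Iso (quadraticOperad K TriOp (triasRelations K)) where
  equiv n := (simplexEquiv K n).symm
  map_one := by
    refine (LinearEquiv.symm_apply_eq _).2 (Eq.trans ?_ (simplexEquiv_tree .leaf rfl).symm)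
    change Finsupp.single _ _ = Finsupp.single _ _
    congr 1
  map_comp {n m k} h i a b := by
    refine (LinearEquiv.symm_apply_eq _).2 ?_
    obtain ⟨a, rfl⟩ := (simplexEquiv K n).surjective a
    obtain ⟨b, rfl⟩ := (simplexEquiv K m).surjective b
    rw [LinearEquiv.symm_apply_apply, LinearEquiv.symm_apply_apply]
    have key : ((simplexOperad K).comp h i).compl₁₂ (simplexEquiv K n).toLinearMap
        (simplexEquiv K m).toLinearMap =
        ((quadraticOperad K TriOp (triasRelations K)).comp h i).compr₂
          (simplexEquiv K k).toLinearMap := by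
      refine hom_ext _ fun t ht => hom_ext _ fun s hs => ?_
      simp only [LinearMap.compl₁₂_apply, LinearMap.compr₂_apply, LinearEquiv.coe_coe, comp_tree,
        simplexEquiv_tree]
      refine (bilinExt_single K _ _ _ _ _).trans ?_
      rw [one_mul]
      congr 1
      apply Subtype.ext
      exact (congrArg (simplexComp · i _ _) hs.symm).trans
        (dotCell_graft t s i (by omega)).symm
    exact LinearMap.congr_fun (LinearMap.congr_fun key a) b

end quadraticOperad

/-! ### Comparison of the heights of the leaves of a tree -/

/-- The largest element of a list of natural numbers. -/
def maxHeight (w : List ℕ) : ℕ := w.foldr max 0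

@[simp] theorem maxHeight_nil : maxHeight [] = 0 := rfl

@[simp] theorem maxHeight_cons (a : ℕ) (w : List ℕ) :
    maxHeight (a :: w) = max a (maxHeight w) := rfl

@[simp] theorem maxHeight_append (v w : List ℕ) :
    maxHeight (v ++ w) = max (maxHeight v) (maxHeight w) := by
  induction v with
  | nil => simp
  | cons a v ih => simp [ih, max_assoc]

theorem le_maxHeight {w : List ℕ} {a : ℕ} (h : a ∈ w) : a ≤ maxHeight w := by
  induction w with
  | nil => simp at h
  | cons b w ih =>
    rcases List.mem_cons.1 h with rfl | h
    · simp
    · simp [ih h]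

theorem maxHeight_mem {w : List ℕ} (h : w ≠ []) : maxHeight w ∈ w := by
  induction w with
  | nil => exact absurd rfl h
  | cons b w ih =>
    by_cases hw : w = []
    · simp [hw]
    · rw [maxHeight_cons]
      rcases max_cases b (maxHeight w) with ⟨e, _⟩ | ⟨e, _⟩ <;> rw [e] <;> simp [ih hw]

/-- The operation associated with the comparison of two heights. -/
def heightRel (a b : ℕ) : TriOp → Bool
  | .left => decide (b < a)
  | .right => decide (a < b)
  | .mid => decide (a = b)

/-- The operations of a tree are given by the comparisons of the heights of the subtrees. -/
def DTree.Compat : DTree TriOp → List ℕ → Prop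
  | .leaf, w => ∃ a, w = [a]
  | .node x l r, w => ∃ v v', w = v ++ v' ∧ l.Compat v ∧ r.Compat v' ∧
      heightRel (maxHeight v) (maxHeight v') x = true

theorem DTree.Compat.length {t : DTree TriOp} {w : List ℕ} (h : t.Compat w) :
    w.length = t.nodes + 1 := by
  induction t generalizing w with
  | leaf =>
    obtain ⟨a, rfl⟩ := h
    rfl
  | node x l r hl hr =>
    obtain ⟨v, v', rfl, h1, h2, -⟩ := h
    rw [List.length_append, hl h1, hr h2, nodes]
    omega

/-- The nodes outside the grafted tree see its leaves only through their greatest height.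
Compatibility of a graft is therefore a condition on the inserted segment and one on the list in
which this segment is replaced by its maximum. -/
theorem DTree.compat_graft (t s : DTree TriOp) (p q r : List ℕ) (hp : p.length ≤ t.nodes)
    (hq : q.length = s.nodes + 1) :
    (t.graft p.length s).Compat (p ++ (q ++ r)) ↔ s.Compat q ∧ t.Compat (p ++ maxHeight q :: r) := by
  induction t generalizing p r with
  | leaf =>
    obtain rfl : p = [] := by simpa [nodes] using hp
    simp only [graft, List.nil_append]
    constructor
    · intro h
      have := h.length
      simp only [List.length_append] at this
      obtain rfl : r = [] := List.eq_nil_of_length_eq_zero (by omega)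
      rw [List.append_nil] at h
      exact ⟨h, _, rfl⟩
    · rintro ⟨h, a, ha⟩
      obtain rfl : r = [] := by simp_all
      rwa [List.append_nil]
  | node x l r' hl hr =>
    by_cases h : p.length ≤ l.nodes
    · simp only [graft, h, if_true, Compat]
      constructor
      · rintro ⟨v, v', e, h1, h2, h3⟩
        have hv := h1.length
        rw [nodes_graft] at hv
        obtain ⟨r₁, rfl, rfl⟩ : ∃ r₁, v = p ++ (q ++ r₁) ∧ r = r₁ ++ v' := by
          rw [← List.append_assoc] at e
          obtain ⟨c, hc, hc'⟩ | ⟨c, hc, hc'⟩ := List.append_eq_append_iff.1 e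
          · exact ⟨c, by rw [hc, List.append_assoc], hc'⟩
          · have := congrArg List.length hc
            simp only [List.length_append] at this
            obtain rfl : c = [] := List.eq_nil_of_length_eq_zero (by omega)
            exact ⟨[], by simpa using hc.symm, by simpa using hc'.symm⟩
        obtain ⟨h4, h5⟩ := (hl p r₁ h).1 h1
        exact ⟨h4, _, v', by simp, h5, h2, by simpa using h3⟩
      · rintro ⟨h4, v, v', e, h1, h2, h3⟩
        have hv := h1.length
        obtain ⟨r₁, rfl, rfl⟩ : ∃ r₁, v = p ++ (maxHeight q :: r₁) ∧ r = r₁ ++ v' := by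
          obtain ⟨c, hc, hc'⟩ | ⟨c, hc, hc'⟩ := List.append_eq_append_iff.1 e
          · obtain _ | ⟨b, c⟩ := c
            · simp at hc
              rw [hc] at hv
              omega
            · simp at hc'
              obtain ⟨rfl, rfl⟩ := hc'
              exact ⟨c, hc, rfl⟩
          · have := congrArg List.length hc
            simp only [List.length_append] at this
            omega
        exact ⟨_, v', by simp, (hl p r₁ h).2 ⟨h4, h1⟩, h2, by simpa using h3⟩
    · have hp' : l.nodes + 1 ≤ p.length := by omega
      simp only [nodes] at hp
      simp only [graft, h, if_false, Compat]
      have key : ∀ (v v' z : List ℕ), v.length = l.nodes + 1 → p ++ z = v ++ v' →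
          ∃ p₂, p = v ++ p₂ ∧ v' = p₂ ++ z := by
        intro v v' z hv e
        obtain ⟨c, hc, hc'⟩ | ⟨c, hc, hc'⟩ := List.append_eq_append_iff.1 e
        · have := congrArg List.length hc
          simp only [List.length_append] at this
          obtain rfl : c = [] := List.eq_nil_of_length_eq_zero (by omega)
          exact ⟨[], by simpa using hc.symm, by simpa using hc'.symm⟩
        · exact ⟨c, hc, hc'⟩
      constructor
      · rintro ⟨v, v', e, h1, h2, h3⟩
        obtain ⟨p₂, rfl, rfl⟩ := key v v' _ h1.length e
        have e' : (v ++ p₂).length - (l.nodes + 1) = p₂.length := by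
          rw [List.length_append, h1.length]
          omega
        rw [e'] at h2
        simp only [List.length_append, h1.length] at hp
        obtain ⟨h4, h5⟩ := (hr p₂ r (by omega)).1 h2
        exact ⟨h4, v, _, by simp, h1, h5, by simpa using h3⟩
      · rintro ⟨h4, v, v', e, h1, h2, h3⟩
        obtain ⟨p₂, rfl, rfl⟩ := key v v' _ h1.length e
        have e' : (v ++ p₂).length - (l.nodes + 1) = p₂.length := by
          rw [List.length_append, h1.length]
          omega
        simp only [List.length_append, h1.length] at hp
        rw [e']
        exact ⟨v, _, by simp, h1, (hr p₂ r (by omega)).2 ⟨h4, h2⟩, by simpa using h3⟩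

theorem DTree.compat_corolla (x : TriOp) (a b : ℕ) :
    (DTree.node x .leaf .leaf).Compat [a, b] ↔ heightRel a b x = true := by
  constructor
  · rintro ⟨v, v', e, ⟨c, rfl⟩, ⟨d, rfl⟩, h⟩
    simp at e
    simpa [e] using h
  · intro h
    exact ⟨[a], [b], rfl, ⟨a, rfl⟩, ⟨b, rfl⟩, by simpa using h⟩

theorem DTree.compat_graft_corolla (t : DTree TriOp) (x : TriOp) (p r : List ℕ) (c c' : ℕ)
    (h : t.nodes = p.length + r.length) :
    (t.graft p.length (.node x .leaf .leaf)).Compat (p ++ c :: c' :: r) ↔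
      heightRel c c' x = true ∧ t.Compat (p ++ max c c' :: r) := by
  have := compat_graft t (.node x .leaf .leaf) p [c, c'] r (by omega) (by simp [nodes])
  rw [compat_corolla] at this
  simpa using this

theorem DTree.compat_left (p q : TriOp) (a b c : ℕ) :
    (DTree.node q (.node p .leaf .leaf) .leaf).Compat [a, b, c] ↔
      heightRel a b p = true ∧ heightRel (max a b) c q = true := by
  have := compat_graft_corolla (.node q .leaf .leaf) p [] [c] a b (by simp [nodes])
  rw [List.nil_append, List.nil_append, compat_corolla] at this
  simpa [graft] using this

theorem DTree.compat_right (p q : TriOp) (a b c : ℕ) :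
    (DTree.node p .leaf (.node q .leaf .leaf)).Compat [a, b, c] ↔
      heightRel b c q = true ∧ heightRel a (max b c) p = true := by
  have := compat_graft_corolla (.node p .leaf .leaf) q [a] [] b c (by simp [nodes])
  rw [List.singleton_append, List.singleton_append, compat_corolla] at this
  simpa [graft, nodes] using this

namespace quadraticOperad

variable {K : Type u} [Field K]

open Classical in
/-- The linear form given by a list of heights. -/
noncomputable def heightWeight (K : Type u) [Field K] (w : List ℕ) (t : DTree TriOp) : K :=
  if t.Compat w then 1 else 0

/-- Given two heights, exactly one of `≺`, `≻`, `·` is compatible with them, so a factor `*` imposes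
no condition. The two sides of each relation then ask for the same order pattern of three heights;
the patterns are checked one by one, and other lengths are compatible with no ternary monomial. -/
theorem lift_heightWeight_eq_zero (w : List ℕ) {f : (freeOperad K TriOp).Op 2}
    (hf : f ∈ dendriformRelations K) : freeOperad.lift K 2 (heightWeight K w) f = 0 := by
  have key : freeOperad.lift K 2 (heightWeight K w) = 0 ∨ ∃ a b c, w = [a, b, c] := by
    by_cases h : w.length = 3
    · right
      obtain ⟨a, b, c, rfl⟩ := List.length_eq_three.1 h
      exact ⟨a, b, c, rfl⟩
    · left
      refine freeOperad.hom_ext fun t ht => ?_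
      rw [freeOperad.lift_tree, heightWeight, if_neg, LinearMap.zero_apply]
      intro h'
      rw [h'.length, ht] at h
      exact h rfl
  obtain h | ⟨a, b, c, rfl⟩ := key
  · rw [h, LinearMap.zero_apply]
  suffices dendriformRelations K ≤ LinearMap.ker
    (freeOperad.lift K 2 (heightWeight K [a, b, c])) from this hf
  refine Submodule.span_le.2 ?_
  have hm : max a b = if a ≤ b then b else a := rfl
  have hm' : max b c = if b ≤ c then c else b := rfl
  rintro r (rfl | rfl | rfl | rfl | rfl | rfl | rfl) <;>
  · simp only [SetLike.mem_coe, LinearMap.mem_ker, map_add, map_sub, freeOperad.leftMonomial_eq,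
      freeOperad.rightMonomial_eq, freeOperad.lift_tree, heightWeight, DTree.compat_left,
      DTree.compat_right, heightRel, decide_eq_true_eq]
    rcases lt_trichotomy a b with h | h | h <;> rcases lt_trichotomy b c with h' | h' | h' <;>
    rcases lt_trichotomy a c with h'' | h'' | h'' <;>
    first
    | (exfalso; omega)
    | simp [h, h', h'', h.le, h'.le, h.not_gt, h'.not_gt,
        h''.not_gt, h.ne, h'.ne, h''.ne, h.ne', h'.ne', h''.ne']
    | (subst_vars; simp_all [le_of_lt, not_lt_of_gt, ne_of_gt, ne_of_lt])

theorem isWeight_heightWeight (w : List ℕ) : IsWeight (dendriformRelations K) (heightWeight K w) := by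
  refine isWeight_of_family (dendriformRelations K) (heightWeight K)
    (fun w f hf => lift_heightWeight_eq_zero w hf) ?_ w
  intro w n m i hi
  by_cases hl : w.length = n + m + 1
  · obtain ⟨p, q, r, rfl, hp, hq⟩ : ∃ p q r, w = p ++ (q ++ r) ∧ p.length = i ∧
        q.length = m + 1 := by
      refine ⟨w.take i, (w.drop i).take (m + 1), (w.drop i).drop (m + 1), by simp, ?_, ?_⟩ <;>
      · simp
        omega
    refine ⟨1, p ++ maxHeight q :: r, q, fun t s ht hs => ?_⟩
    have := t.compat_graft s p q r (by omega) (by omega)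
    rw [hp] at this
    simp only [heightWeight, this]
    split_ifs <;> simp_all
  · refine ⟨0, [], [], fun t s ht hs => ?_⟩
    rw [heightWeight, if_neg, zero_mul]
    intro h
    rw [h.length, DTree.nodes_graft, ht, hs] at hl
    exact hl rfl

end quadraticOperad

/-! ### The operad of dendriform trialgebras -/

instance : Fintype TriOp := ⟨⟨[left, right, mid], by simp⟩, by rintro (_ | _ | _) <;> simp⟩

theorem TriOp.sum_eq {M : Type*} [AddCommMonoid M] (f : TriOp → M) :
    ∑ x, f x = f left + f right + f mid := by
  change (Multiset.map f [left, right, mid]).sum = _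
  simp [add_assoc]

/-- Schröder trees. The tree `node u w` represents the monomial `u ≻ (x ≺ v)` if `w = (false, v)`
and `u ≻ (x · v)` if `w = (true, v)`. -/
inductive Sch : Type
  | node : Option Sch → Option (Bool × Sch) → Sch

namespace Sch

/-- The monomial represented by a Schröder tree. -/
def tree : Sch → DTree TriOp
  | node none none => .leaf
  | node none (some (false, v)) => .node left .leaf v.tree
  | node none (some (true, v)) => .node mid .leaf v.tree
  | node (some u) none => .node right u.tree .leaf
  | node (some u) (some (false, v)) => .node right u.tree (.node left .leaf v.tree)
  | node (some u) (some (true, v)) => .node right u.tree (.node mid .leaf v.tree)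

theorem tree_some (u : Sch) (w : Option (Bool × Sch)) :
    (node (some u) w).tree = .node right u.tree (node none w).tree := by
  obtain _ | ⟨_ | _, v⟩ := w <;> simp [tree]

/-- The condition on the heights on the left of the first highest leaf. -/
def LeftCompat (m : ℕ) (p : List ℕ) : Option Sch → Prop
  | none => p = []
  | some u => u.tree.Compat p ∧ maxHeight p < m

/-- The condition on the heights on the right of the first highest leaf. -/
def RightCompat (m : ℕ) (q : List ℕ) : Option (Bool × Sch) → Prop
  | none => q = []
  | some (false, v) => v.tree.Compat q ∧ maxHeight q < m
  | some (true, v) => v.tree.Compat q ∧ maxHeight q = m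

theorem RightCompat.le {m : ℕ} {q : List ℕ} {w : Option (Bool × Sch)} (h : RightCompat m q w) :
    maxHeight q ≤ m := by
  obtain _ | ⟨_ | _, v⟩ := w
  · simp [show q = [] from h]
  · exact h.2.le
  · exact h.2.le

theorem compat_node_none (w : Option (Bool × Sch)) (z : List ℕ) :
    (node none w).tree.Compat z ↔ ∃ m q, z = m :: q ∧ RightCompat m q w := by
  obtain _ | ⟨_ | _, v⟩ := w
  · simp [tree, DTree.Compat, RightCompat]
  · simp only [tree, DTree.Compat, RightCompat, heightRel, decide_eq_true_eq]
    constructor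
    · rintro ⟨_, q, rfl, ⟨m, rfl⟩, h, h'⟩
      exact ⟨m, q, rfl, h, by simpa using h'⟩
    · rintro ⟨m, q, rfl, h, h'⟩
      exact ⟨[m], q, rfl, ⟨m, rfl⟩, h, by simpa using h'⟩
  · simp only [tree, DTree.Compat, RightCompat, heightRel, decide_eq_true_eq]
    constructor
    · rintro ⟨_, q, rfl, ⟨m, rfl⟩, h, h'⟩
      exact ⟨m, q, rfl, h, by simpa using h'.symm⟩
    · rintro ⟨m, q, rfl, h, h'⟩
      exact ⟨[m], q, rfl, ⟨m, rfl⟩, h, by simpa using h'.symm⟩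

/-- The shape `u ≻ (x ≺ v)` or `u ≻ (x · v)` singles out the first highest leaf `x`: heights are
strictly lower on its left, and on its right their maximum is strictly lower for `≺` and equal for
`·`. -/
theorem compat_node (u : Option Sch) (w : Option (Bool × Sch)) (z : List ℕ) :
    (node u w).tree.Compat z ↔
      ∃ p m q, z = p ++ m :: q ∧ LeftCompat m p u ∧ RightCompat m q w := by
  obtain _ | u := u
  · rw [compat_node_none]
    constructor
    · rintro ⟨m, q, rfl, h⟩
      exact ⟨[], m, q, rfl, rfl, h⟩
    · rintro ⟨_, m, q, rfl, rfl, h⟩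
      exact ⟨m, q, rfl, h⟩
  · rw [tree_some]
    simp only [DTree.Compat, compat_node_none, heightRel, decide_eq_true_eq, LeftCompat]
    constructor
    · rintro ⟨p, _, rfl, h, ⟨m, q, rfl, h'⟩, h''⟩
      exact ⟨p, m, q, rfl, ⟨h, by simpa [h'.le] using h''⟩, h'⟩
    · rintro ⟨p, m, q, rfl, ⟨h, h''⟩, h'⟩
      exact ⟨p, _, rfl, h, ⟨m, q, rfl, h'⟩, by simpa [h'.le] using h''⟩

end Sch

/-! ### Schröder trees and lists of heights, by cutting at the first maximum -/

theorem exists_first_max (z : List ℕ) (hz : z ≠ []) :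
    ∃ p m q, z = p ++ m :: q ∧ (∀ a ∈ p, a < m) ∧ maxHeight q ≤ m := by
  induction z with
  | nil => exact absurd rfl hz
  | cons a z ih =>
    by_cases h : maxHeight z ≤ a
    · exact ⟨[], a, z, rfl, by simp, h⟩
    · obtain ⟨p, m, q, rfl, hp, hq⟩ := ih (by rintro rfl; simp at h)
      refine ⟨a :: p, m, q, rfl, ?_, hq⟩
      have hm : maxHeight (p ++ m :: q) = m := by
        have : maxHeight p ≤ m := by
          by_cases hp' : p = []
          · simp [hp']
          · exact (hp _ (maxHeight_mem hp')).le
        simp [this, hq]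
      rw [hm] at h
      intro b hb
      rcases List.mem_cons.1 hb with rfl | hb
      · omega
      · exact hp b hb

theorem first_max_unique {p p' q q' : List ℕ} {m m' : ℕ} (h : p ++ m :: q = p' ++ m' :: q')
    (hp : ∀ a ∈ p, a < m) (hq : maxHeight q ≤ m) (hp' : ∀ a ∈ p', a < m')
    (hq' : maxHeight q' ≤ m') : p = p' ∧ m = m' ∧ q = q' := by
  obtain ⟨c, rfl, hc⟩ | ⟨c, rfl, hc⟩ := List.append_eq_append_iff.1 h
  · obtain _ | ⟨b, c⟩ := c
    · simpa using hc
    · simp only [List.cons_append, List.cons.injEq] at hc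
      obtain ⟨rfl, rfl⟩ := hc
      have h1 := hp' m (by simp)
      have h2 := le_maxHeight (w := c ++ m' :: q') (a := m') (by simp)
      omega
  · obtain _ | ⟨b, c⟩ := c
    · simpa [eq_comm] using hc
    · simp only [List.cons_append, List.cons.injEq] at hc
      obtain ⟨rfl, rfl⟩ := hc
      have h1 := hp m' (by simp)
      have h2 := le_maxHeight (w := c ++ m :: q) (a := m) (by simp)
      omega

namespace Sch

theorem LeftCompat.lt {m : ℕ} {p : List ℕ} {u : Option Sch} (h : LeftCompat m p u) :
    ∀ a ∈ p, a < m := by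
  obtain _ | u := u
  · simp [show p = [] from h]
  · exact fun a ha => (le_maxHeight ha).trans_lt h.2

/-- Cut at the first maximum and recurse on both sides; the Boolean on the right records whether the
maximum is attained there again. -/
theorem exists_compat (z : List ℕ) (hz : z ≠ []) : ∃ s : Sch, s.tree.Compat z := by
  induction h : z.length using Nat.strong_induction_on generalizing z with
  | _ n ih =>
  obtain ⟨p, m, q, rfl, hp, hq⟩ := exists_first_max z hz
  simp only [List.length_append, List.length_cons] at h
  have hu : ∃ u, LeftCompat m p u := by
    by_cases hp' : p = []
    · exact ⟨none, hp'⟩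
    · obtain ⟨u, hu⟩ := ih p.length (by omega) p hp' rfl
      exact ⟨some u, hu, hp _ (maxHeight_mem hp')⟩
  have hw : ∃ w, RightCompat m q w := by
    by_cases hq' : q = []
    · exact ⟨none, hq'⟩
    · obtain ⟨v, hv⟩ := ih q.length (by omega) q hq' rfl
      rcases hq.lt_or_eq with hq | hq
      · exact ⟨some (false, v), hv, hq⟩
      · exact ⟨some (true, v), hv, hq⟩
  obtain ⟨u, hu⟩ := hu
  obtain ⟨w, hw⟩ := hw
  exact ⟨node u w, (compat_node u w _).2 ⟨p, m, q, rfl, hu, hw⟩⟩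

/-- The cut at the first maximum is unique, and it determines the root of the Schröder tree. -/
theorem compat_unique {z : List ℕ} {s s' : Sch} (h : s.tree.Compat z) (h' : s'.tree.Compat z) :
    s = s' := by
  induction hz : z.length using Nat.strong_induction_on generalizing z s s' with
  | _ n ih =>
  obtain ⟨u, w⟩ := s
  obtain ⟨u', w'⟩ := s'
  obtain ⟨p, m, q, rfl, hu, hw⟩ := (compat_node _ _ _).1 h
  obtain ⟨p', m', q', e, hu', hw'⟩ := (compat_node _ _ _).1 h'
  obtain ⟨rfl, rfl, rfl⟩ := first_max_unique e hu.lt hw.le hu'.lt hw'.le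
  simp only [List.length_append, List.length_cons] at hz
  congr 1
  · obtain _ | u := u <;> obtain _ | u' := u'
    · rfl
    · have := hu'.1.length
      simp [show p = [] from hu] at this
    · have := hu.1.length
      simp [show p = [] from hu'] at this
    · exact congrArg some (ih p.length (by omega) hu.1 hu'.1 rfl)
  · obtain _ | ⟨_ | _, v⟩ := w <;> obtain _ | ⟨_ | _, v'⟩ := w'
    · rfl
    · have := hw'.1.length
      simp [show q = [] from hw] at this
    · have := hw'.1.length
      simp [show q = [] from hw] at this
    · have := hw.1.length
      simp [show q = [] from hw'] at this
    · rw [ih q.length (by omega) hw.1 hw'.1 rfl]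
    · exact absurd hw'.2 hw.2.ne
    · have := hw.1.length
      simp [show q = [] from hw'] at this
    · exact absurd hw.2 hw'.2.ne
    · rw [ih q.length (by omega) hw.1 hw'.1 rfl]

/-- The maximum must be allowed to be any large number so that the subtrees can be adjusted to a
common root height `M`: a strict comparison takes the maximum `M - 1` in the subtree, an equality
takes `M`. -/
theorem exists_word_aux (n : ℕ) (s : Sch) (hs : s.tree.nodes = n) :
    ∃ N, ∀ M ≥ N, ∃ z, s.tree.Compat z ∧ maxHeight z = M := by
  induction n using Nat.strong_induction_on generalizing s with
  | _ n ih =>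
  obtain ⟨u, w⟩ := s
  have hu : ∃ N, ∀ M ≥ N, ∃ p, LeftCompat M p u := by
    obtain _ | u := u
    · exact ⟨0, fun M _ => ⟨[], rfl⟩⟩
    · rw [tree_some] at hs
      simp only [DTree.nodes] at hs
      obtain ⟨N, hN⟩ := ih _ (by omega) u rfl
      refine ⟨N + 1, fun M hM => ?_⟩
      obtain ⟨z, hz, hz'⟩ := hN (M - 1) (by omega)
      exact ⟨z, hz, by omega⟩
  have hw : ∃ N, ∀ M ≥ N, ∃ q, RightCompat M q w := by
    obtain _ | ⟨b, v⟩ := w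
    · exact ⟨0, fun M _ => ⟨[], rfl⟩⟩
    · have hv : v.tree.nodes < n := by
        subst hs
        cases b <;> cases u <;> simp [tree, DTree.nodes] <;> omega
      obtain ⟨N, hN⟩ := ih _ hv v rfl
      refine ⟨N + 1, fun M hM => ?_⟩
      cases b
      · obtain ⟨z, hz, hz'⟩ := hN (M - 1) (by omega)
        exact ⟨z, hz, by omega⟩
      · obtain ⟨z, hz, hz'⟩ := hN M (by omega)
        exact ⟨z, hz, hz'⟩
  obtain ⟨N₁, h₁⟩ := hu
  obtain ⟨N₂, h₂⟩ := hw
  refine ⟨max N₁ N₂, fun M hM => ?_⟩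
  obtain ⟨p, hp⟩ := h₁ M (by omega)
  obtain ⟨q, hq⟩ := h₂ M (by omega)
  refine ⟨p ++ M :: q, (compat_node _ _ _).2 ⟨p, M, q, rfl, hp, hq⟩, ?_⟩
  have : maxHeight p ≤ M := by
    by_cases hp' : p = []
    · simp [hp']
    · exact (hp.lt _ (maxHeight_mem hp')).le
  simp [this, hq.le]

theorem exists_word (s : Sch) : ∃ z, s.tree.Compat z := by
  obtain ⟨N, h⟩ := exists_word_aux _ s rfl
  obtain ⟨z, hz, -⟩ := h N le_rfl
  exact ⟨z, hz⟩

/-- A list of heights of the leaves of a Schröder tree. -/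
noncomputable def word (s : Sch) : List ℕ := s.exists_word.choose

theorem compat_word (s : Sch) : s.tree.Compat s.word := s.exists_word.choose_spec

end Sch

namespace quadraticOperad

variable {K : Type u} [Field K] {X : Type} [Fintype X]

/-- The product of elements of the free algebra with given colours. -/
noncomputable def colOp {Γ : Type} (rel : Γ → Γ → X → Bool)
    (R : Submodule K ((freeOperad K X).Op 2)) (c c' : Γ) : (quadraticOperad K X R).FreeAlgebra →ₗ[K]
    (quadraticOperad K X R).FreeAlgebra →ₗ[K] (quadraticOperad K X R).FreeAlgebra :=
  ∑ x, if rel c c' x then op R x else 0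

/-! ### Coloured products and Schröder monomials -/

section Dendriform

-- The relations are a variable equal to `dendriformRelations K`, and not this space itself, so that
-- the basis also serves for the double orthogonal, which is the space of relations of the dual of
-- trialgebras.
variable {R : Submodule K ((freeOperad K TriOp).Op 2)}

theorem colOp_dotRel_false_false : colOp dotRel R false false = op R left + op R right + op R mid := by
  simp [colOp, TriOp.sum_eq, dotRel]

theorem colOp_dotRel_true_false : colOp dotRel R true false = op R left := by
  simp [colOp, TriOp.sum_eq, dotRel]

theorem colOp_dotRel_false_true : colOp dotRel R false true = op R right := by
  simp [colOp, TriOp.sum_eq, dotRel]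

theorem colOp_dotRel_true_true : colOp dotRel R true true = op R mid := by
  simp [colOp, TriOp.sum_eq, dotRel]

/-- Of the eight choices of marks, seven give the defining relations. With no mark at all, the
identity is the associativity of `*`, the sum of these seven relations. -/
theorem dendriform_assoc (hR : R = dendriformRelations K) (c₁ c₂ c₃ : Bool)
    (x y z : (quadraticOperad K TriOp R).FreeAlgebra) :
    colOp dotRel R (max c₁ c₂) c₃ (colOp dotRel R c₁ c₂ x y) z =
      colOp dotRel R c₁ (max c₂ c₃) x (colOp dotRel R c₂ c₃ y z) := by
  subst hR
  obtain ⟨h1, h2, h3, h4, h5, h6, h7⟩ := dendriformRelations_mem (K := K)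
  have key : ∀ {f g : (freeOperad K TriOp).Op 2}, f - g ∈ dendriformRelations K →
      freeOperad.lift K 2 (act3 (dendriformRelations K)) f x y z =
        freeOperad.lift K 2 (act3 (dendriformRelations K)) g x y z := fun h => by
    rw [act3_eq_of_sub_mem _ h]
  have e1 := key h1
  have e2 := key h2
  have e3 := key h3
  have e4 := key h4
  have e5 := key h5
  have e6 := key h6
  have e7 := key h7
  simp only [map_add, LinearMap.add_apply, act3_leftMonomial, act3_rightMonomial] at e1 e2 e3 e4 e5 e6 e7
  cases c₁ <;> cases c₂ <;> cases c₃ <;>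
    simp only [max_self, Bool.max_eq_or, Bool.or_false, Bool.or_true, colOp_dotRel_false_false,
      colOp_dotRel_false_true, colOp_dotRel_true_false, colOp_dotRel_true_true, map_add,
      LinearMap.add_apply]
  · rw [e1, e2, e4, e5, e6, e7, ← e3]
    abel
  · exact e3
  · exact e2
  · exact e4
  · exact e1
  · exact e5
  · exact e6
  · exact e7

theorem colOp_dotRel_false_false_eq (a b : (quadraticOperad K TriOp R).FreeAlgebra) :
    colOp dotRel R false false a b = colOp dotRel R true false a b + colOp dotRel R false true a b +
      colOp dotRel R true true a b := by
  simp [colOp_dotRel_false_false, colOp_dotRel_true_false, colOp_dotRel_false_true,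
    colOp_dotRel_true_true]

variable (R) in
/-- The monomial given by a Schröder tree. -/
noncomputable abbrev schMon (s : Sch) : (quadraticOperad K TriOp R).FreeAlgebra := mon R s.tree

theorem schMon_some (u : Sch) (w : Option (Bool × Sch)) : schMon R (.node (some u) w) =
    colOp dotRel R false true (schMon R u) (schMon R (.node none w)) := by
  rw [colOp_dotRel_false_true, op_mon, schMon, Sch.tree_some]

theorem schMon_none_some (b : Bool) (v : Sch) : schMon R (.node none (some (b, v))) =
    colOp dotRel R true b (schMon R (.node none none)) (schMon R v) := by
  cases b
  · rw [colOp_dotRel_true_false, op_mon]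
    simp [schMon, Sch.tree]
  · rw [colOp_dotRel_true_true, op_mon]
    simp [schMon, Sch.tree]

/-- Induction on the total number of nodes. If the left factor is marked, associativity pushes `t`
into the right branch of `s` (`h1`, `h2`); if only the right factor is marked, it pushes `s` into
the left branch of `t` (`h3`). The product `*` is the sum of the marked ones. -/
theorem colOp_schMon_mem (hR : R = dendriformRelations K) (n : ℕ) (s t : Sch)
    (hn : s.tree.nodes + t.tree.nodes = n) (c c' : Bool) :
    colOp dotRel R c c' (schMon R s) (schMon R t) ∈ Submodule.span K (Set.range (schMon R)) := by
  induction n using Nat.strong_induction_on generalizing s t c c' with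
  | _ n ih =>
  -- The conclusion remembers that no left branch is created; `h2` then attaches the branch `u` of
  -- `s`.
  have h1 : ∀ c' w, (Sch.node none w).tree.nodes ≤ s.tree.nodes →
      colOp dotRel R true c' (schMon R (.node none w)) (schMon R t) ∈
        Submodule.span K (Set.range fun w => schMon R (.node none w)) := by
    rintro c' (_ | ⟨b, v⟩) hw
    · rw [← schMon_none_some]
      exact Submodule.subset_span ⟨_, rfl⟩
    · have hv : v.tree.nodes < s.tree.nodes := by
        cases b <;> simp [Sch.tree, DTree.nodes] at hw <;> omega
      have := ih _ (by omega) v t rfl b c'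
      have h := Submodule.mem_map_of_mem (f := colOp dotRel R true (max b c')
        (schMon R (.node none none))) this
      have e := dendriform_assoc hR true b c' (schMon R (.node none none)) (schMon R v) (schMon R t)
      rw [← schMon_none_some, max_eq_left (Bool.le_true b)] at e
      rw [e]
      rw [Submodule.map_span] at h
      refine Submodule.span_le.2 ?_ h
      rintro _ ⟨_, ⟨t', rfl⟩, rfl⟩
      rw [← schMon_none_some]
      exact Submodule.subset_span ⟨_, rfl⟩
  have h2 : ∀ c', colOp dotRel R true c' (schMon R s) (schMon R t) ∈
      Submodule.span K (Set.range (schMon R)) := by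
    intro c'
    obtain ⟨_ | u, w⟩ := s
    · refine Submodule.span_mono ?_ (h1 c' w le_rfl)
      rintro _ ⟨w, rfl⟩
      exact ⟨_, rfl⟩
    · have := h1 c' w (by rw [Sch.tree_some, DTree.nodes]; omega)
      have h := Submodule.mem_map_of_mem (f := colOp dotRel R false true (schMon R u)) this
      have e := dendriform_assoc hR false true c' (schMon R u) (schMon R (.node none w))
        (schMon R t)
      rw [← schMon_some, max_eq_right (Bool.false_le true), max_eq_left (Bool.le_true c')] at e
      rw [e]
      rw [Submodule.map_span] at h
      refine Submodule.span_le.2 ?_ h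
      rintro _ ⟨_, ⟨w', rfl⟩, rfl⟩
      rw [← schMon_some]
      exact Submodule.subset_span ⟨_, rfl⟩
  have h3 : colOp dotRel R false true (schMon R s) (schMon R t) ∈
      Submodule.span K (Set.range (schMon R)) := by
    obtain ⟨_ | u, w⟩ := t
    · rw [← schMon_some]
      exact Submodule.subset_span ⟨_, rfl⟩
    · rw [Sch.tree_some] at hn
      simp only [DTree.nodes] at hn
      have := ih _ (by omega) s u rfl false false
      have h := Submodule.mem_map_of_mem (f := (colOp dotRel R false true).flip
        (schMon R (.node none w))) this
      have e := dendriform_assoc hR false false true (schMon R s) (schMon R u)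
        (schMon R (.node none w))
      rw [max_self, max_eq_right (Bool.false_le true), ← schMon_some] at e
      rw [← e]
      rw [Submodule.map_span] at h
      refine Submodule.span_le.2 ?_ h
      rintro _ ⟨_, ⟨t', rfl⟩, rfl⟩
      rw [LinearMap.flip_apply, ← schMon_some]
      exact Submodule.subset_span ⟨_, rfl⟩
  cases c
  · cases c'
    · rw [colOp_dotRel_false_false_eq]
      exact add_mem (add_mem (h2 _) h3) (h2 _)
    · exact h3
  · exact h2 c'

theorem mon_mem_span_schMon (hR : R = dendriformRelations K) (t : DTree TriOp) :
    mon R t ∈ Submodule.span K (Set.range (schMon R)) := by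
  induction t with
  | leaf => exact Submodule.subset_span ⟨.node none none, by simp [schMon, Sch.tree]⟩
  | node x l r hl hr =>
    have key : ∀ c c', colOp dotRel R c c' (mon R l) (mon R r) ∈
        Submodule.span K (Set.range (schMon R)) := by
      intro c c'
      have := Submodule.apply_mem_map₂ (colOp dotRel R c c') hl hr
      rw [Submodule.map₂_span_span] at this
      refine Submodule.span_le.2 ?_ this
      rintro _ ⟨_, ⟨s, rfl⟩, _, ⟨t, rfl⟩, rfl⟩
      exact colOp_schMon_mem hR _ s t rfl c c'
    rw [← op_mon]
    cases x
    · rw [← colOp_dotRel_true_false]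
      exact key _ _
    · rw [← colOp_dotRel_false_true]
      exact key _ _
    · rw [← colOp_dotRel_true_true]
      exact key _ _

theorem heightWeight_tree {w : List ℕ} {s : Sch} (h : s.tree.Compat w) (t : Sch) [Decidable (t = s)] :
    heightWeight K w t.tree = if t = s then 1 else 0 := by
  rw [heightWeight]
  congr 1
  exact propext ⟨fun h' => Sch.compat_unique h' h, fun h' => h' ▸ h⟩

/-- The basis of the operad of dendriform trialgebras. -/
noncomputable def dendBasis (hR : R = dendriformRelations K) : TreeBasis R Sch where
  tree := Sch.tree
  weight s := heightWeight K s.word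
  isWeight s := hR ▸ isWeight_heightWeight s.word
  weight_self s := by
    classical
    rw [heightWeight_tree s.compat_word, if_pos rfl]
  weight_of_ne s t h := by
    classical
    rw [heightWeight_tree s.compat_word, if_neg h.symm]
  mem_span := mon_mem_span_schMon hR

end Dendriform

end quadraticOperad

/-! ### The bar complex of an algebra with a basis -/

namespace BarComplex

variable {K : Type u} [Field K] {α β L : Type} {V : Type*} [AddCommGroup V] [Module K V]

/-- The bilinear extension of a map with values in a vector space. -/
noncomputable def biLift (K : Type u) [Field K] {α β : Type} {V : Type*} [AddCommGroup V]
    [Module K V] (f : α → β → V) : (α →₀ K) →ₗ[K] (β →₀ K) →ₗ[K] V :=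
  Finsupp.linearCombination K fun a => Finsupp.linearCombination K (f a)

@[simp] theorem biLift_single (f : α → β → V) (a : α) (b : β) :
    biLift K f (Finsupp.single a 1) (Finsupp.single b 1) = f a b := by
  simp [biLift]

theorem hom_ext₂ {f g : (α →₀ K) →ₗ[K] (β →₀ K) →ₗ[K] V}
    (h : ∀ a b, f (Finsupp.single a 1) (Finsupp.single b 1) =
      g (Finsupp.single a 1) (Finsupp.single b 1)) : f = g :=
  Finsupp.lhom_ext' fun a => LinearMap.ext_ring <| Finsupp.lhom_ext' fun b =>
    LinearMap.ext_ring (h a b)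

/-- The basis vector given by a list of letters. -/
noncomputable abbrev word (K : Type u) [Field K] {α : Type} (l : α) : α →₀ K := Finsupp.single l 1

/-- Insertion of a linear combination of letters in front of lists. -/
noncomputable def cons : (L →₀ K) →ₗ[K] (List L →₀ K) →ₗ[K] (List L →₀ K) :=
  biLift K fun y l => word K (y :: l)

@[simp] theorem cons_single (y : L) (l : List L) :
    cons (Finsupp.single y 1) (Finsupp.single l 1) = word K (y :: l) :=
  biLift_single _ _ _

theorem word_cons (y : L) (l : List L) : word K (y :: l) = cons (word K y) (word K l) :=
  (cons_single y l).symm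

variable (M : L → L → L →₀ K)

/-- The product with values on letters given by `M`. -/
noncomputable def mul : (L →₀ K) →ₗ[K] (L →₀ K) →ₗ[K] (L →₀ K) := biLift K M

@[simp] theorem mul_single (y z : L) : mul M (Finsupp.single y 1) (Finsupp.single z 1) = M y z :=
  biLift_single _ _ _

/-- Multiplication of the first letter of a list. -/
noncomputable def headMul : (L →₀ K) →ₗ[K] (List L →₀ K) →ₗ[K] (List L →₀ K) :=
  biLift K fun y l => match l with
    | [] => 0
    | z :: l => cons (M y z) (word K l)

@[simp] theorem headMul_nil (a : L →₀ K) : headMul M a (Finsupp.single [] 1) = 0 := by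
  suffices (headMul M).flip (word K []) = 0 from LinearMap.congr_fun this a
  exact Finsupp.lhom_ext' fun y => LinearMap.ext_ring (biLift_single _ _ _)

theorem headMul_cons (a b : L →₀ K) (v : List L →₀ K) :
    headMul M a (cons b v) = cons (mul M a b) v := by
  suffices ∀ y, (cons (K := K)).compr₂ (headMul M (word K y)) = (cons).comp (mul M (word K y)) by
    suffices h : (LinearMap.applyₗ (cons b v)).comp (headMul M) =
        (LinearMap.applyₗ v).comp (cons.comp ((mul M).flip b)) from LinearMap.congr_fun h a
    exact Finsupp.lhom_ext' fun y => LinearMap.ext_ring <|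
      LinearMap.congr_fun (LinearMap.congr_fun (this y) b) v
  refine fun y => hom_ext₂ fun z l => ?_
  simp [headMul]

/-- The differential of a list of letters. -/
noncomputable def barList : List L → (List L →₀ K)
  | [] => 0
  | y :: l => headMul M (word K y) (word K l) - cons (word K y) (barList l)

/-- The differential of the bar complex. -/
noncomputable def bar : (List L →₀ K) →ₗ[K] (List L →₀ K) :=
  Finsupp.linearCombination K (barList M)

@[simp] theorem bar_single (l : List L) : bar M (Finsupp.single l 1) = barList M l := by
  simp [bar]

@[simp] theorem barList_nil : barList M [] = 0 := rfl

theorem barList_cons_cons (y z : L) (l : List L) : barList M (y :: z :: l) =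
    cons (M y z) (word K l) - cons (word K y) (barList M (z :: l)) := by
  rw [barList, ← cons_single, headMul_cons, mul_single]

theorem barList_singleton (y : L) : barList M [y] = 0 := by
  simp [barList]

theorem bar_cons (a : L →₀ K) (v : List L →₀ K) :
    bar M (cons a v) = headMul M a v - cons a (bar M v) := by
  rw [eq_sub_iff_add_eq]
  suffices cons.compr₂ (bar M) + (cons (K := K)).compl₂ (bar M) = headMul M from
    LinearMap.congr_fun (LinearMap.congr_fun this a) v
  exact hom_ext₂ fun y l => by simp [barList]

/-- Linear combinations of lists of a given length. -/
noncomputable abbrev degree (K : Type u) [Field K] (L : Type) (n : ℕ) :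
    Submodule K (List L →₀ K) := Submodule.span K {v | ∃ l, l.length = n ∧ v = word K l}

theorem cons_mem_degree {n : ℕ} (a : L →₀ K) {v : List L →₀ K} (hv : v ∈ degree K L n) :
    cons a v ∈ degree K L (n + 1) := by
  induction a using Finsupp.induction_linear with
  | zero => simp
  | add a b ha hb => simpa using add_mem ha hb
  | single y r =>
    rw [← mul_one r, ← smul_eq_mul, ← Finsupp.smul_single, map_smul, LinearMap.smul_apply]
    refine Submodule.smul_mem _ _ ?_
    have := Submodule.mem_map_of_mem (f := cons (word K y)) hv
    rw [Submodule.map_span] at this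
    refine Submodule.span_mono ?_ this
    rintro _ ⟨_, ⟨l, hl, rfl⟩, rfl⟩
    exact ⟨y :: l, by simp [hl], cons_single _ _⟩

theorem barList_mem_degree (l : List L) : barList M l ∈ degree K L (l.length - 1) := by
  induction l with
  | nil => simp
  | cons y l ih =>
    cases l with
    | nil => simp [barList_singleton]
    | cons z l =>
      rw [barList_cons_cons]
      exact sub_mem (cons_mem_degree _ (Submodule.subset_span ⟨l, by simp, rfl⟩))
        (cons_mem_degree _ ih)

/-- The product `mul M` is associative. -/
def Assoc : Prop := ∀ x y z : L, mul M (M x y) (word K z) = mul M (word K x) (M y z)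

variable {M}

theorem Assoc.mul_assoc (h : Assoc M) (a b c : L →₀ K) :
    mul M (mul M a b) c = mul M a (mul M b c) := by
  suffices ∀ z, (mul M).compr₂ ((mul M).flip (word K z)) =
      (mul M).compl₂ ((mul M).flip (word K z)) by
    suffices h : mul M (mul M a b) = (mul M a).comp (mul M b) from LinearMap.congr_fun h c
    exact Finsupp.lhom_ext' fun z => LinearMap.ext_ring <|
      LinearMap.congr_fun (LinearMap.congr_fun (this z) a) b
  refine fun z => hom_ext₂ fun x y => ?_
  simpa using h x y z

theorem Assoc.headMul_mul (h : Assoc M) (a b : L →₀ K) (v : List L →₀ K) :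
    headMul M (mul M a b) v = headMul M a (headMul M b v) := by
  suffices headMul M (mul M a b) = (headMul M a).comp (headMul M b) from LinearMap.congr_fun this v
  refine Finsupp.lhom_ext' fun l => LinearMap.ext_ring ?_
  cases l with
  | nil => simp
  | cons z l => simp [← cons_single, headMul_cons, h.mul_assoc]

/-- Multiplying a letter into the head of a word commutes with the differential by associativity at
the first place. The other faces do not meet the head. -/
theorem Assoc.bar_headMul (h : Assoc M) (a : L →₀ K) (v : List L →₀ K) :
    bar M (headMul M a v) = headMul M a (bar M v) := by
  suffices (bar M).comp (headMul M a) = (headMul M a).comp (bar M) from LinearMap.congr_fun this v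
  refine Finsupp.lhom_ext' fun l => LinearMap.ext_ring ?_
  cases l with
  | nil => simp
  | cons z l => simp [← cons_single, headMul_cons, bar_cons, h.headMul_mul, -bar_single]

/-- With the recursion `bar_cons`, the two terms which multiply `z` into the differential of the
tail cancel by `Assoc.bar_headMul`, and what remains is the square of the differential on the tail.
-/
theorem Assoc.bar_bar (h : Assoc M) (v : List L →₀ K) : bar M (bar M v) = 0 := by
  suffices (bar M).comp (bar M) = 0 from LinearMap.congr_fun this v
  refine Finsupp.lhom_ext' fun l => LinearMap.ext_ring ?_
  induction l with
  | nil => simp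
  | cons z l ih =>
    simp only [LinearMap.comp_apply, Finsupp.lsingle_apply, LinearMap.zero_apply] at ih ⊢
    rw [show Finsupp.single (z :: l) (1 : K) = _ from (cons_single z l).symm, bar_cons, map_sub,
      h.bar_headMul, bar_cons, ih]
    simp

end BarComplex

/-- A linear map can be prescribed on a family which consists of zero and of basis vectors. -/
theorem Module.Basis.exists_linearMap {K V W S J : Type*} [Field K] [AddCommGroup V] [Module K V]
    [AddCommGroup W] [Module K W] (b : Module.Basis J K V) (φ : S → V) (ψ : S → W)
    (h : ∀ s, φ s = 0 ∨ ∃ j, φ s = b j) (h0 : ∀ s, φ s = 0 → ψ s = 0)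
    (h1 : ∀ s s', φ s = φ s' → ψ s = ψ s') : ∃ f : V →ₗ[K] W, ∀ s, f (φ s) = ψ s := by
  classical
  refine ⟨b.constr K fun j => if hj : ∃ s, φ s = b j then ψ hj.choose else 0, fun s => ?_⟩
  obtain hs | ⟨j, hs⟩ := h s
  · rw [hs, map_zero, h0 s hs]
  · have hj : ∃ s, φ s = b j := ⟨s, hs⟩
    rw [hs, b.constr_basis, dif_pos hj]
    exact h1 _ _ (hj.choose_spec.trans hs.symm)

/-! ### The Koszul complex as a quotient of a bar complex -/

namespace quadraticOperad

open BarComplex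

variable {K : Type u} [Field K] {X : Type}

/-- A function on trees which represents an element of the dual basis. -/
def TreeBasis.IsDual {R : Submodule K ((freeOperad K X).Op 2)} {ι : Type} (B : TreeBasis R ι)
    (i : ι) (χ : DTree X → K) : Prop :=
  χ (B.tree i) = 1 ∧ ∀ j, j ≠ i → χ (B.tree j) = 0

theorem TreeBasis.IsDual.form_eq [Finite X] {R : Submodule K ((freeOperad K X).Op 2)} {ι : Type}
    {B : TreeBasis R ι} {i : ι} {χ : DTree X → K} (h : B.IsDual i χ) (hχ : IsWeight R χ) {n : ℕ}
    (hi : (B.tree i).nodes = n) : hχ.form n = B.formBasis n ⟨i, hi⟩ := by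
  classical
  rw [formBasis_apply]
  refine (B.opBasis n).ext fun j => ?_
  rw [opBasis_apply, IsWeight.form_tree, IsWeight.form_tree]
  by_cases hj : j.1 = i
  · rw [hj, h.1, B.weight_self]
  · rw [h.2 _ hj, B.weight_of_ne _ _ (Ne.symm hj)]

variable [Fintype X]

/-- A presentation of a quadratic operad with linear forms on its dual operad which are indexed by
lists of colours. -/
structure Coloring (R : Submodule K ((freeOperad K X).Op 2)) (Γ ι κ : Type) [LinearOrder Γ] where
  basis : TreeBasis R ι
  dual : TreeBasis (dualRelations R) κ
  rel : Γ → Γ → X → Bool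
  weight : List Γ → DTree X → K
  isWeight : ∀ w, IsWeight (dualRelations R) (weight w)
  weight_graft : ∀ (t : DTree X) (x : X) (p r : List Γ) (c c' : Γ),
    t.nodes = p.length + r.length →
    weight (p ++ c :: c' :: r) (t.graft p.length (.node x .leaf .leaf)) =
      if rel c c' x then weight (p ++ max c c' :: r) t else 0
  -- Each list of colours gives zero or a vector of the dual basis, and every vector of the dual
  -- basis is obtained; several lists may give the same one.
  weight_eq : ∀ w, (∀ j, weight w (dual.tree j) = 0) ∨
    ∃ i, w.length = (dual.tree i).nodes + 1 ∧ dual.IsDual i (weight w)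
  exists_list : ∀ i, ∃ w, w.length = (dual.tree i).nodes + 1 ∧ dual.IsDual i (weight w)
  assoc : ∀ (c₁ c₂ c₃ : Γ) (x y z : (quadraticOperad K X R).FreeAlgebra),
    colOp rel R (max c₁ c₂) c₃ (colOp rel R c₁ c₂ x y) z =
      colOp rel R c₁ (max c₂ c₃) x (colOp rel R c₂ c₃ y z)
  leaf : ι
  tree_leaf : basis.tree leaf = .leaf
  weight_leaf : ∀ x l r, basis.weight leaf (.node x l r) = 0

namespace Coloring

variable {R : Submodule K ((freeOperad K X).Op 2)} {Γ ι κ : Type} [LinearOrder Γ]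
  (C : Coloring R Γ ι κ)

/-- The linear form on the dual operad given by a list of colours. -/
noncomputable def form (w : List Γ) (k : ℕ) : Module.Dual K ((koszulDual R).Op k) :=
  (C.isWeight w).form k

/-- The element of the Koszul complex given by lists of colours and of elements. -/
noncomputable def chain (k : ℕ) (w : List Γ) (l : List (quadraticOperad K X R).FreeAlgebra) :
    KoszulChain R k :=
  C.form w k ⊗ₜ[K] PiTensorProduct.tprod K fun j : Fin (k + 1) => l.getD j 0

theorem getD_append_cons {A : Type*} (q s : List A) (v d : A) (j : ℕ) :
    (q ++ v :: s).getD j d = if j < q.length then q.getD j d else if j = q.length then v else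
      s.getD (j - q.length - 1) d := by
  split_ifs with h1 h2
  · rw [List.getD_append _ _ _ _ h1]
  · rw [List.getD_append_right _ _ _ _ h2.ge, h2, Nat.sub_self, List.getD_cons_zero]
  · rw [List.getD_append_right _ _ _ _ (by omega)]
    obtain ⟨m, hm⟩ : ∃ m, j - q.length = m + 1 := ⟨j - q.length - 1, by omega⟩
    rw [hm, List.getD_cons_succ, Nat.add_sub_cancel]

theorem exists_slot (k : ℕ) (w : List Γ) (q s : List (quadraticOperad K X R).FreeAlgebra)
    (hq : q.length ≤ k) : ∃ f : (quadraticOperad K X R).FreeAlgebra →ₗ[K] KoszulChain R k,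
      ∀ v, f v = C.chain k w (q ++ v :: s) := by
  refine ⟨TensorProduct.mk K _ _ (C.form w k) ∘ₗ
    (PiTensorProduct.tprod K).toLinearMap (fun j : Fin (k + 1) => (q ++ 0 :: s).getD j 0)
      ⟨q.length, by omega⟩, fun v => ?_⟩
  rw [LinearMap.comp_apply, MultilinearMap.toLinearMap_apply, TensorProduct.mk_apply, chain]
  congr 2
  funext j
  rw [Function.update_apply]
  simp only [getD_append_cons, Fin.ext_iff]
  split_ifs <;> first | rfl | omega

theorem form_dualMap (x : X) (p r : List Γ) (c c' : Γ) (k : ℕ) (i : Fin (k + 1))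
    (hi : (i : ℕ) = p.length) (hk : p.length + r.length = k) :
    (((koszulDual R).comp (m := 1) rfl i).flip (gen (dualRelations R) x)).dualMap
      (C.form (p ++ c :: c' :: r) (k + 1)) =
      if C.rel c c' x then C.form (p ++ max c c' :: r) k else 0 := by
  refine hom_ext (dualRelations R) fun t ht => ?_
  refine (congrArg (C.form (p ++ c :: c' :: r) (k + 1))
    (comp_tree (dualRelations R) rfl i t _ ht _)).trans ?_
  refine (IsWeight.form_tree _ _ _).trans ?_
  rw [hi, C.weight_graft t x p r c c' (by omega)]
  split_ifs
  · exact (IsWeight.form_tree _ _ _).symm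
  · rfl

theorem merge_tprod {X : Type} {R : Submodule K ((freeOperad K X).Op 2)} (x : X) (q s : List (quadraticOperad K X R).FreeAlgebra)
    (a a' : (quadraticOperad K X R).FreeAlgebra) (k : ℕ) (i : Fin (k + 1))
    (hi : (i : ℕ) = q.length) :
    merge ((quadraticOperad K X R).act (gen R x)) i (PiTensorProduct.tprod K
      fun j : Fin (k + 2) => (q ++ a :: a' :: s).getD j 0) =
      PiTensorProduct.tprod K fun j : Fin (k + 1) => (q ++ op R x a a' :: s).getD j 0 := by
  rw [merge, PiTensorProduct.lift.tprod]
  refine congrArg (PiTensorProduct.tprod K) ?_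
  funext j
  have h : ∀ n : ℕ, q.length < n → (q ++ a :: a' :: s).getD (n + 1) 0 =
      s.getD (n - q.length - 1) 0 := by
    intro n hn
    rw [getD_append_cons, if_neg (by omega), if_neg (by omega)]
    obtain ⟨m, hm⟩ : ∃ m, n - q.length = m + 1 := ⟨n - q.length - 1, by omega⟩
    have hm' : n + 1 - q.length - 1 = m + 1 := by omega
    rw [hm', hm, List.getD_cons_succ, Nat.add_sub_cancel]
  simp only [mergeFun, Fin.val_castSucc, Fin.val_succ, Fin.lt_def, Fin.ext_iff, hi]
  rw [getD_append_cons q s (op R x a a')]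
  split_ifs with h1 h2
  · rw [getD_append_cons, if_pos h1]
  · congr 1
    · rw [getD_append_cons, if_neg (by omega), if_pos rfl]
    · rw [getD_append_cons, if_neg (by omega), if_neg (by omega)]
      simp
  · exact h _ (by omega)

/-- The faces of an element of the Koszul complex. -/
theorem sum_map_chain (p r : List Γ) (c c' : Γ)
    (q s : List (quadraticOperad K X R).FreeAlgebra) (a a' : (quadraticOperad K X R).FreeAlgebra)
    (k : ℕ) (i : Fin (k + 1)) (hi : (i : ℕ) = p.length) (hk : p.length + r.length = k)
    (hq : q.length = p.length) :
    (∑ x : X, TensorProduct.map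
      ((((koszulDual R).comp (m := 1) rfl i).flip (gen (dualRelations R) x)).dualMap)
      (merge ((quadraticOperad K X R).act (gen R x)) i))
        (C.chain (k + 1) (p ++ c :: c' :: r) (q ++ a :: a' :: s)) =
      C.chain k (p ++ max c c' :: r) (q ++ colOp C.rel R c c' a a' :: s) := by
  obtain ⟨f, hf⟩ := C.exists_slot k (p ++ max c c' :: r) q s (by omega)
  rw [LinearMap.sum_apply, ← hf, colOp, LinearMap.sum_apply, LinearMap.sum_apply, map_sum]
  refine Finset.sum_congr rfl fun x _ => ?_
  rw [chain, TensorProduct.map_tmul, C.form_dualMap x p r c c' k i hi hk,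
    merge_tprod x q s a a' k i (by omega)]
  split_ifs
  · rw [hf, chain]
  · simp

/-- The value of a letter. -/
noncomputable abbrev value (y : Γ × ι) : (quadraticOperad K X R).FreeAlgebra :=
  C.basis.algBasis y.2

/-- The product of two letters. -/
noncomputable def prod (y z : Γ × ι) : Γ × ι →₀ K :=
  Finsupp.lmapDomain K K (Prod.mk (max y.1 z.1))
    (C.basis.algBasis.repr (colOp C.rel R y.1 z.1 (C.value y) (C.value z)))

theorem mul_prod (c c' : Γ) (a a' : (quadraticOperad K X R).FreeAlgebra) :
    mul C.prod (Finsupp.lmapDomain K K (Prod.mk c) (C.basis.algBasis.repr a))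
      (Finsupp.lmapDomain K K (Prod.mk c') (C.basis.algBasis.repr a')) =
      Finsupp.lmapDomain K K (Prod.mk (max c c'))
        (C.basis.algBasis.repr (colOp C.rel R c c' a a')) := by
  have h : (mul C.prod).compl₁₂
      (Finsupp.lmapDomain K K (Prod.mk c) ∘ₗ C.basis.algBasis.repr.toLinearMap)
      (Finsupp.lmapDomain K K (Prod.mk c') ∘ₗ C.basis.algBasis.repr.toLinearMap) =
      (colOp C.rel R c c').compr₂
        (Finsupp.lmapDomain K K (Prod.mk (max c c')) ∘ₗ C.basis.algBasis.repr.toLinearMap) := by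
    refine C.basis.algBasis.ext fun i => C.basis.algBasis.ext fun j => ?_
    simp [prod]
  exact LinearMap.congr_fun (LinearMap.congr_fun h a) a'

theorem assoc_prod : Assoc C.prod := by
  intro x y z
  have h : ∀ y : Γ × ι, (Finsupp.single y (1 : K)) =
      Finsupp.lmapDomain K K (Prod.mk y.1) (C.basis.algBasis.repr (C.value y)) := by
    intro y
    simp
  rw [word, word, h z, h x, prod, prod, mul_prod, mul_prod, C.assoc, max_assoc]

/-- The projection of the bar complex onto the Koszul complex. -/
noncomputable def toChain (k : ℕ) : (List (Γ × ι) →₀ K) →ₗ[K] KoszulChain R k :=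
  Finsupp.linearCombination K fun l =>
    if l.length = k + 1 then C.chain k (l.map Prod.fst) (l.map C.value) else 0

theorem toChain_single (k : ℕ) (l : List (Γ × ι)) : C.toChain k (Finsupp.single l 1) =
    if l.length = k + 1 then C.chain k (l.map Prod.fst) (l.map C.value) else 0 := by
  simp [toChain]

theorem toChain_append_cons (k : ℕ) (p r : List (Γ × ι)) (c : Γ)
    (v : (quadraticOperad K X R).FreeAlgebra) (hk : p.length + r.length = k) :
    C.toChain k (Finsupp.lmapDomain K K (p ++ ·)
      (cons (Finsupp.lmapDomain K K (Prod.mk c) (C.basis.algBasis.repr v)) (word K r))) =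
      C.chain k (p.map Prod.fst ++ c :: r.map Prod.fst) (p.map C.value ++ v :: r.map C.value) := by
  obtain ⟨f, hf⟩ := C.exists_slot k (p.map Prod.fst ++ c :: r.map Prod.fst) (p.map C.value)
    (r.map C.value) (by simp; omega)
  rw [← hf]
  suffices C.toChain k ∘ₗ Finsupp.lmapDomain K K (p ++ ·) ∘ₗ cons.flip (word K r) ∘ₗ
      Finsupp.lmapDomain K K (Prod.mk c) ∘ₗ C.basis.algBasis.repr.toLinearMap = f from
    LinearMap.congr_fun this v
  refine C.basis.algBasis.ext fun a => ?_
  have hl : (p ++ (c, a) :: r).length = k + 1 := by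
    simp only [List.length_append, List.length_cons]
    omega
  simp only [LinearMap.comp_apply, LinearEquiv.coe_coe, Module.Basis.repr_self,
    Finsupp.lmapDomain_apply, Finsupp.mapDomain_single, LinearMap.flip_apply, cons_single,
    toChain_single, hl, if_true, hf]
  simp

/-- Induction on the tail `l`, the prefix `p` being already passed: the faces of index at least
`p.length` are those of `l`, and the recursive minus sign of `barList` becomes the sign `(-1) ^ i`.
The summation is over natural numbers so that the first face can be split off. -/
theorem sum_toChain (k : ℕ) (p l : List (Γ × ι)) (h : p.length + l.length = k + 2) :
    (∑ i ∈ Finset.Ico p.length (k + 1), if hi : i < k + 1 then (-1 : K) ^ i • (∑ x : X,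
      TensorProduct.map ((((koszulDual R).comp (m := 1) rfl (⟨i, hi⟩ : Fin (k + 1))).flip
        (gen (dualRelations R) x)).dualMap)
        (merge ((quadraticOperad K X R).act (gen R x)) ⟨i, hi⟩))
          (C.toChain (k + 1) (word K (p ++ l))) else 0) =
      (-1 : K) ^ p.length • C.toChain k (Finsupp.lmapDomain K K (p ++ ·) (barList C.prod l)) := by
  induction l generalizing p with
  | nil =>
    rw [Finset.Ico_eq_empty (by simp at h; omega)]
    simp
  | cons y l ih =>
    cases l with
    | nil =>
      rw [Finset.Ico_eq_empty (by simp at h; omega)]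
      simp [barList_singleton]
    | cons z l =>
      simp only [List.length_cons] at h
      have hp : p.length < k + 1 := by omega
      have ih' := ih (p ++ [y]) (by simp; omega)
      simp only [List.append_assoc, List.singleton_append, List.length_append,
        List.length_singleton] at ih'
      have hl : (p ++ y :: z :: l).length = k + 1 + 1 := by simp; omega
      rw [Finset.sum_eq_sum_Ico_succ_bot hp, ih', dif_pos hp, toChain_single, if_pos hl,
        barList_cons_cons, sub_eq_add_neg, map_add, map_add, smul_add]
      have hm : ∀ v, Finsupp.lmapDomain K K (fun l => p ++ y :: l) v =
          Finsupp.lmapDomain K K (p ++ ·) (cons (word K y) v) := by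
        intro v
        suffices Finsupp.lmapDomain K K (fun l => p ++ y :: l) =
          Finsupp.lmapDomain K K (p ++ ·) ∘ₗ cons (word K y) from LinearMap.congr_fun this v
        refine Finsupp.lhom_ext' fun l => LinearMap.ext_ring ?_
        simp
      have := C.sum_map_chain (p.map Prod.fst) (l.map Prod.fst) y.1 z.1 (p.map C.value)
        (l.map C.value) (C.value y) (C.value z) k ⟨p.length, hp⟩ (by simp) (by simp; omega)
        (by simp)
      simp only [List.map_append, List.map_cons]
      rw [this, hm, prod, C.toChain_append_cons k p l _ _ (by omega), pow_succ, mul_smul,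
        ← map_smul, ← map_smul, neg_one_smul, map_smul, ← map_neg]

/-- The Koszul complex is in this way a quotient of the bar complex of the algebra of coloured
elements. -/
theorem koszulDifferential_toChain (k : ℕ) (v : List (Γ × ι) →₀ K) :
    koszulDifferential R k (C.toChain (k + 1) v) = C.toChain k (bar C.prod v) := by
  suffices (koszulDifferential R k) ∘ₗ (C.toChain (k + 1)) = C.toChain k ∘ₗ bar C.prod from
    LinearMap.congr_fun this v
  refine Finsupp.lhom_ext' fun l => LinearMap.ext_ring ?_
  simp only [LinearMap.comp_apply, Finsupp.lsingle_apply, bar_single]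
  by_cases hl : l.length = k + 2
  · have := C.sum_toChain k [] l (by simpa using hl)
    simp only [List.length_nil, List.nil_append, pow_zero, one_smul] at this
    have hid : Finsupp.lmapDomain K K (fun l : List (Γ × ι) => l) = LinearMap.id :=
      Finsupp.lmapDomain_id K K
    rw [hid, LinearMap.id_apply, ← Finset.range_eq_Ico,
      ← Fin.sum_univ_eq_sum_range (fun i => if hi : i < k + 1 then (-1 : K) ^ i • (∑ x : X,
      TensorProduct.map ((((koszulDual R).comp (m := 1) rfl (⟨i, hi⟩ : Fin (k + 1))).flip
        (gen (dualRelations R) x)).dualMap)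
        (merge ((quadraticOperad K X R).act (gen R x)) ⟨i, hi⟩))
          (C.toChain (k + 1) (word K l)) else 0)] at this
    rw [← this, koszulDifferential, LinearMap.sum_apply]
    refine Finset.sum_congr rfl fun i _ => ?_
    rw [dif_pos i.2, LinearMap.smul_apply]
  -- For other lengths both sides vanish, since the bar differential lowers lengths by one.
  · rw [toChain_single, if_neg hl, map_zero]
    have := barList_mem_degree C.prod l
    symm
    rw [← LinearMap.mem_ker]
    refine Submodule.span_le.2 ?_ this
    rintro _ ⟨l', hl', rfl⟩
    rw [SetLike.mem_coe, LinearMap.mem_ker, toChain_single]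
    by_cases hk : l'.length = k + 1
    · exfalso
      apply hl
      omega
    · rw [if_neg hk]

end Coloring

end quadraticOperad

/-! ### Bases of the Koszul complex and descent of a contracting homotopy -/

namespace quadraticOperad

open BarComplex

namespace Coloring

variable {K : Type u} [Field K] {X : Type} [Fintype X]
  {R : Submodule K ((freeOperad K X).Op 2)} {Γ ι κ : Type} [LinearOrder Γ]
  (C : Coloring R Γ ι κ)

/-- The basis of a term of the Koszul complex. -/
noncomputable def chainBasis (k : ℕ) :
    Module.Basis ({i // (C.dual.tree i).nodes = k} × (Fin (k + 1) → ι)) K (KoszulChain R k) :=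
  Module.Basis.tensorProduct (M := Module.Dual K ((koszulDual R).Op k)) (C.dual.formBasis k)
    (Basis.piTensorProduct fun _ : Fin (k + 1) => C.basis.algBasis)

theorem toChain_eq_chainBasis {k : ℕ} {l : List (Γ × ι)} (hl : l.length = k + 1) {i : κ}
    (hi : (C.dual.tree i).nodes = k) (h : C.dual.IsDual i (C.weight (l.map Prod.fst))) :
    C.toChain k (word K l) = C.chainBasis k (⟨i, hi⟩, fun j => (l.get (j.cast hl.symm)).2) := by
  rw [toChain_single, if_pos hl, chainBasis]
  refine Eq.trans ?_ (Module.Basis.tensorProduct_apply _ _ _ _).symm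
  rw [Basis.piTensorProduct_apply, chain, form, h.form_eq _ hi]
  congr 2
  funext j
  rw [List.getD_eq_getElem _ _ (by simp; omega)]
  simp [value]

theorem toChain_eq_zero {k : ℕ} {l : List (Γ × ι)}
    (h : ∀ j, C.weight (l.map Prod.fst) (C.dual.tree j) = 0) : C.toChain k (word K l) = 0 := by
  rw [toChain_single]
  split_ifs
  · have : C.form (l.map Prod.fst) k = 0 := by
      refine (C.dual.opBasis k).ext fun j => ?_
      rw [TreeBasis.opBasis_apply]
      exact (IsWeight.form_tree _ _ _).trans (h j)
    rw [chain, this, TensorProduct.zero_tmul]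
  · rfl

/-- Because of this dichotomy, a map on words descends to the Koszul complex once it respects null
words and words with equal images, which are the first two conditions of a `Homotopy`. -/
theorem toChain_eq_zero_or {k : ℕ} {l : List (Γ × ι)} (hl : l.length = k + 1) :
    C.toChain k (word K l) = 0 ∨ ∃ j, C.toChain k (word K l) = C.chainBasis k j := by
  obtain h | ⟨i, hi, h⟩ := C.weight_eq (l.map Prod.fst)
  · exact Or.inl (C.toChain_eq_zero h)
  · rw [List.length_map] at hi
    exact Or.inr ⟨_, C.toChain_eq_chainBasis hl (by omega) h⟩

theorem span_toChain (k : ℕ) : ⊤ ≤ Submodule.span K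
    (Set.range fun l : {l : List (Γ × ι) // l.length = k + 1} => C.toChain k (word K l.1)) := by
  rw [← (C.chainBasis k).span_eq, Submodule.span_le]
  rintro _ ⟨⟨⟨i, hi⟩, a⟩, rfl⟩
  obtain ⟨w, hw, h⟩ := C.exists_list i
  have hl : (w.zip (List.ofFn a)).length = k + 1 := by
    simp [hw, hi]
  have hm : (w.zip (List.ofFn a)).map Prod.fst = w := List.map_fst_zip (by simp [hw, hi])
  refine Submodule.subset_span ⟨⟨w.zip (List.ofFn a), hl⟩, ?_⟩
  simp only
  rw [C.toChain_eq_chainBasis hl hi (by rwa [hm])]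
  congr 2
  funext j
  simp [-List.ofFn_succ]

theorem hom_ext_toChain {k : ℕ} {V : Type*} [AddCommGroup V] [Module K V]
    {f g : KoszulChain R k →ₗ[K] V} (h : ∀ l : List (Γ × ι), l.length = k + 1 →
      f (C.toChain k (word K l)) = g (C.toChain k (word K l))) : f = g :=
  LinearMap.ext_on_range (eq_top_iff.2 (C.span_toChain k)) fun l => h l.1 l.2

theorem koszulDifferential_comp (C : Coloring R Γ ι κ) (k : ℕ) :
    koszulDifferential R k ∘ₗ koszulDifferential R (k + 1) = 0 := by
  refine C.hom_ext_toChain (V := KoszulChain R k) fun l _ => ?_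
  rw [LinearMap.comp_apply, koszulDifferential_toChain, koszulDifferential_toChain,
    C.assoc_prod.bar_bar, map_zero, LinearMap.zero_apply]

/-- The coefficient of the generator of the free algebra, in the first term of the Koszul
complex. -/
noncomputable def leafCoeff : KoszulChain R 0 →ₗ[K] Module.Dual K ((koszulDual R).Op 0) :=
  (TensorProduct.rid K _).toLinearMap ∘ₗ TensorProduct.map LinearMap.id
    ((C.basis.isWeight C.leaf).algForm ∘ₗ
      (PiTensorProduct.subsingletonEquiv (R := K) (0 : Fin 1)).toLinearMap)

theorem leafCoeff_tmul (f : Module.Dual K ((koszulDual R).Op 0))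
    (a : Fin 1 → (quadraticOperad K X R).FreeAlgebra) :
    C.leafCoeff (f ⊗ₜ[K] PiTensorProduct.tprod K a) =
      (C.basis.isWeight C.leaf).algForm (a 0) • f := by
  simp [leafCoeff]

theorem algForm_leaf_op (x : X) (a b : (quadraticOperad K X R).FreeAlgebra) :
    (C.basis.isWeight C.leaf).algForm (op R x a b) = 0 := by
  suffices (op R x).compr₂ (C.basis.isWeight C.leaf).algForm = 0 from
    LinearMap.congr_fun (LinearMap.congr_fun this a) b
  refine C.basis.algBasis.ext fun i => C.basis.algBasis.ext fun j => ?_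
  simp [TreeBasis.algBasis_apply, op_mon, IsWeight.algForm_mon, C.weight_leaf]

/-- A product has no component on the generator. Since `leafCoeff` is also a retraction of
`koszulArityOne`, it separates boundaries from the part of arity one. -/
theorem leafCoeff_koszulDifferential : C.leafCoeff ∘ₗ koszulDifferential R 0 = 0 := by
  refine C.hom_ext_toChain fun l hl => ?_
  obtain ⟨y, z, rfl⟩ := List.length_eq_two.1 hl
  rw [LinearMap.comp_apply, koszulDifferential_toChain, bar_single, barList_cons_cons,
    barList_singleton, map_zero, sub_zero]
  have := C.toChain_append_cons 0 [] [] (max y.1 z.1)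
    (colOp C.rel R y.1 z.1 (C.value y) (C.value z)) rfl
  have hid : Finsupp.lmapDomain K K (fun l : List (Γ × ι) => l) = LinearMap.id :=
    Finsupp.lmapDomain_id K K
  simp only [List.nil_append, hid, LinearMap.id_apply] at this
  rw [prod, this, chain, leafCoeff_tmul]
  have h0 : (C.basis.isWeight C.leaf).algForm
      (colOp C.rel R y.1 z.1 (C.value y) (C.value z)) = 0 := by
    rw [colOp, LinearMap.sum_apply, LinearMap.sum_apply, map_sum]
    refine Finset.sum_eq_zero fun x _ => ?_
    split_ifs
    · exact C.algForm_leaf_op x _ _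
    · simp
  simp [h0]

theorem koszulArityOne_apply (f : Module.Dual K ((koszulDual R).Op 0)) :
    koszulArityOne R f = f ⊗ₜ[K] PiTensorProduct.tprod K fun _ => mon R (C.basis.tree C.leaf) := by
  rw [C.tree_leaf]
  rfl

theorem leafCoeff_koszulArityOne : C.leafCoeff ∘ₗ koszulArityOne R = LinearMap.id := by
  refine LinearMap.ext fun f => ?_
  rw [LinearMap.comp_apply, C.koszulArityOne_apply, leafCoeff_tmul, IsWeight.algForm_mon,
    C.basis.weight_self, one_smul, LinearMap.id_apply]

/-- A contracting homotopy of the bar complex, compatible with the projection onto the Koszul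
complex. -/
structure Homotopy where
  map : List (Γ × ι) → (List (Γ × ι) →₀ K)
  map_eq_zero : ∀ k (l : List (Γ × ι)), l.length = k + 1 → C.toChain k (word K l) = 0 →
    C.toChain (k + 1) (map l) = 0
  map_eq : ∀ k (l l' : List (Γ × ι)), l.length = k + 1 → l'.length = k + 1 →
    C.toChain k (word K l) ≠ 0 → C.toChain k (word K l) = C.toChain k (word K l') →
    C.toChain (k + 1) (map l) = C.toChain (k + 1) (map l')
  homotopy : ∀ k (l : List (Γ × ι)), l.length = k + 1 → (∀ c, l ≠ [(c, C.leaf)]) →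
    C.toChain k (word K l) ≠ 0 →
    C.toChain k (bar C.prod (map l) + Finsupp.linearCombination K map (barList C.prod l)) =
      C.toChain k (word K l)

namespace Homotopy

variable {C} (H : C.Homotopy)

theorem exists_linearMap (k : ℕ) : ∃ f : KoszulChain R k →ₗ[K] KoszulChain R (k + 1),
    ∀ v ∈ degree K (Γ × ι) (k + 1), f (C.toChain k v) =
      C.toChain (k + 1) (Finsupp.linearCombination K H.map v) := by
  obtain ⟨f, hf⟩ := (C.chainBasis k).exists_linearMap
    (fun l : {l : List (Γ × ι) // l.length = k + 1} => C.toChain k (word K l.1))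
    (fun l => C.toChain (k + 1) (H.map l.1)) (fun l => C.toChain_eq_zero_or l.2)
    (fun l => H.map_eq_zero k l.1 l.2) (fun l l' h => by
      by_cases h0 : C.toChain k (word K l.1) = 0
      · rw [H.map_eq_zero k l.1 l.2 h0, H.map_eq_zero k l'.1 l'.2 (h ▸ h0)]
      · exact H.map_eq k l.1 l'.1 l.2 l'.2 h0 h)
  refine ⟨f, fun v hv => ?_⟩
  suffices degree K (Γ × ι) (k + 1) ≤ LinearMap.eqLocus (f ∘ₗ C.toChain k)
    (C.toChain (k + 1) ∘ₗ Finsupp.linearCombination K H.map) from this hv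
  refine Submodule.span_le.2 ?_
  rintro _ ⟨l, hl, rfl⟩
  simpa [LinearMap.mem_eqLocus] using hf ⟨l, hl⟩

theorem mem_range_of_length_one (H : C.Homotopy) (l : List (Γ × ι)) (hl : l.length = 1) :
    C.toChain 0 (word K l) ∈
      LinearMap.range (koszulDifferential R 0) ⊔ LinearMap.range (koszulArityOne R) := by
  by_cases h0 : C.toChain 0 (word K l) = 0
  · rw [h0]
    exact zero_mem _
  by_cases hleaf : ∃ c, l = [(c, C.leaf)]
  · obtain ⟨c, rfl⟩ := hleaf
    refine Submodule.mem_sup_right ⟨C.form [c] 0, ?_⟩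
    rw [C.koszulArityOne_apply, toChain_single, if_pos (by simp), chain]
    simp [value, TreeBasis.algBasis_apply]
  · push Not at hleaf
    have := H.homotopy 0 l hl hleaf h0
    obtain ⟨y, rfl⟩ := List.length_eq_one_iff.1 hl
    rw [barList_singleton, map_zero, add_zero, ← koszulDifferential_toChain] at this
    exact Submodule.mem_sup_left ⟨_, this⟩

/-- In positive index the descended maps satisfy `d g + f d = id`, whence exactness. In index zero
every word is a boundary, or is the generator, or is null, so boundaries and the part of arity one
span; `leafCoeff` shows that their sum is direct. -/
theorem acyclic (H : C.Homotopy) : KoszulAcyclic R := by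
  refine ⟨fun k => ?_, ?_⟩
  · obtain ⟨f, hf⟩ := H.exists_linearMap k
    obtain ⟨g, hg⟩ := H.exists_linearMap (k + 1)
    have key : koszulDifferential R (k + 1) ∘ₗ g + f ∘ₗ koszulDifferential R k =
        LinearMap.id := by
      refine C.hom_ext_toChain (V := KoszulChain R (k + 1)) fun l hl => ?_
      have hb : barList C.prod l ∈ degree K (Γ × ι) (k + 1) := by
        have := barList_mem_degree C.prod l
        rwa [hl] at this
      by_cases h0 : C.toChain (k + 1) (word K l) = 0
      · rw [h0, map_zero, map_zero]
      have := H.homotopy (k + 1) l hl (by rintro c rfl; simp at hl) h0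
      rw [LinearMap.add_apply, LinearMap.comp_apply, LinearMap.comp_apply,
        koszulDifferential_toChain, bar_single, hf _ hb,
        hg _ (Submodule.subset_span ⟨l, hl, rfl⟩), koszulDifferential_toChain, ← map_add,
        LinearMap.id_apply, ← this]
      simp
    intro x
    constructor
    · intro hx
      have := LinearMap.congr_fun key x
      rw [LinearMap.add_apply, LinearMap.comp_apply, LinearMap.comp_apply, hx, map_zero,
        add_zero] at this
      exact ⟨g x, this⟩
    · rintro ⟨y, rfl⟩
      exact LinearMap.congr_fun (C.koszulDifferential_comp k) y
  · constructor
    · rw [Submodule.disjoint_def]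
      rintro _ ⟨y, rfl⟩ ⟨f, hf⟩
      have h1 := LinearMap.congr_fun C.leafCoeff_koszulArityOne f
      have h2 := LinearMap.congr_fun C.leafCoeff_koszulDifferential y
      rw [LinearMap.comp_apply] at h1 h2
      rw [hf, h2] at h1
      rw [← hf, ← LinearMap.id_apply (R := K) f, ← h1, LinearMap.zero_apply, map_zero]
    · rw [codisjoint_iff, eq_top_iff]
      refine (C.span_toChain 0).trans (Submodule.span_le.2 ?_)
      rintro _ ⟨⟨l, hl⟩, rfl⟩
      exact H.mem_range_of_length_one l hl

end Homotopy

end Coloring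

end quadraticOperad

namespace quadraticOperad

open BarComplex

theorem Coloring.eq_of_toChain_eq {K : Type u} [Field K] {X : Type} [Fintype X]
    {R : Submodule K ((freeOperad K X).Op 2)} {Γ ι κ : Type} [LinearOrder Γ]
    (C : Coloring R Γ ι κ) {k : ℕ} {l l' : List (Γ × ι)} (hl : l.length = k + 1)
    (hl' : l'.length = k + 1) {i i' : κ} (hi : (C.dual.tree i).nodes = k)
    (hi' : (C.dual.tree i').nodes = k) (h : C.dual.IsDual i (C.weight (l.map Prod.fst)))
    (h' : C.dual.IsDual i' (C.weight (l'.map Prod.fst)))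
    (e : C.toChain k (word K l) = C.toChain k (word K l')) :
    i = i' ∧ l.map Prod.snd = l'.map Prod.snd := by
  rw [C.toChain_eq_chainBasis hl hi h, C.toChain_eq_chainBasis hl' hi' h'] at e
  have := (C.chainBasis k).injective e
  simp only [Prod.mk.injEq, Subtype.mk.injEq] at this
  refine ⟨this.1, List.ext_getElem (by simp [hl, hl']) fun n h1 h2 => ?_⟩
  have h3 := congrFun this.2 ⟨n, by simpa [hl] using h1⟩
  simpa using h3

variable {K : Type u} [Field K]

/-! ### The Koszul complex of dendriform trialgebras -/

/-- The presentation of the operad of dendriform trialgebras with linear forms on the dual operad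
given by lists of marks. -/
noncomputable def dendColoring (K : Type u) [Field K] :
    Coloring (dendriformRelations K) Bool Sch {a : List Bool // true ∈ a} where
  basis := dendBasis rfl
  dual := triasBasis K
  rel := dotRel
  weight := dotWeight K
  isWeight := isWeight_dotWeight
  weight_graft t x p r c c' h := by
    have := t.dots_graft_corolla x p r c c' h
    simp only [dotWeight, this, Bool.max_eq_or]
    split_ifs <;> simp_all
  weight_eq w := by
    by_cases hw : true ∈ w
    · right
      refine ⟨⟨w, hw⟩, ?_, (triasBasis K).weight_self ⟨w, hw⟩,
        fun j hj => (triasBasis K).weight_of_ne ⟨w, hw⟩ j hj.symm⟩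
      have : 0 < w.length := List.length_pos_of_mem hw
      change w.length = (dotTree w).nodes + 1
      rw [nodes_dotTree]
      omega
    · left
      intro j
      rw [dotWeight, if_neg]
      intro h
      exact hw (h ▸ DTree.true_mem_dots _)
  exists_list i := by
    refine ⟨i.1, ?_, (triasBasis K).weight_self i,
      fun j hj => (triasBasis K).weight_of_ne i j hj.symm⟩
    have : 0 < i.1.length := List.length_pos_of_mem i.2
    change i.1.length = (dotTree i.1).nodes + 1
    rw [nodes_dotTree]
    omega
  assoc := dendriform_assoc rfl
  leaf := .node none none
  tree_leaf := by simp [dendBasis, Sch.tree]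
  weight_leaf x l r := by
    refine if_neg fun h => ?_
    have h1 := h.length
    have h2 := (Sch.compat_word (.node none none)).length
    simp [Sch.tree, DTree.nodes] at h1 h2
    omega

theorem dendColoring_isDual {w : List Bool} (hw : true ∈ w) :
    (dendColoring K).dual.IsDual ⟨w, hw⟩ ((dendColoring K).weight w) :=
  ⟨(triasBasis K).weight_self ⟨w, hw⟩, fun j hj => (triasBasis K).weight_of_ne ⟨w, hw⟩ j hj.symm⟩

theorem dendColoring_nodes {w : List Bool} (hw : true ∈ w) {k : ℕ} (h : w.length = k + 1) :
    ((dendColoring K).dual.tree ⟨w, hw⟩).nodes = k := by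
  change (dotTree w).nodes = k
  rw [nodes_dotTree]
  omega

/-- Distinct lists with a mark give distinct vectors of the dual basis. The only words lost are
those without marks, and the Koszul complex is the bar complex relative to the unmarked subalgebra.
-/
theorem dendColoring_toChain_eq_zero_iff {k : ℕ} {l : List (Bool × Sch)} (hl : l.length = k + 1) :
    (dendColoring K).toChain k (word K l) = 0 ↔ true ∉ l.map Prod.fst := by
  constructor
  · intro h hw
    rw [(dendColoring K).toChain_eq_chainBasis hl (dendColoring_nodes hw (by simpa using hl))
      (dendColoring_isDual hw)] at h
    exact ((dendColoring K).chainBasis k).ne_zero _ h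
  · intro hw
    refine (dendColoring K).toChain_eq_zero fun j => if_neg fun h => ?_
    exact hw (h ▸ DTree.true_mem_dots _)

/-- The linear combination of unmarked letters. -/
noncomputable def unmarked : (Sch →₀ K) →ₗ[K] (Bool × Sch →₀ K) :=
  Finsupp.lmapDomain K K (Prod.mk false)

/-- The linear combination of marked letters whose first leaf is the generator. -/
noncomputable def marked : (Option (Bool × Sch) →₀ K) →ₗ[K] (Bool × Sch →₀ K) :=
  Finsupp.lmapDomain K K fun w => (true, .node none w)

@[simp] theorem unmarked_single (s : Sch) :
    unmarked (Finsupp.single s (1 : K)) = word K (false, s) := by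
  simp [unmarked]

@[simp] theorem marked_single (w : Option (Bool × Sch)) :
    marked (Finsupp.single w (1 : K)) = word K (true, .node none w) := by
  simp [marked]

theorem dendColoring_value (y : Bool × Sch) :
    (dendColoring K).value y = schMon (dendriformRelations K) y.2 :=
  TreeBasis.algBasis_apply _ _

theorem prod_unmarked (s t : Sch) :
    ∃ q, (dendColoring K).prod (false, s) (false, t) = unmarked q := ⟨_, rfl⟩

/-- Let `x` be the marked generator. By this and `prod_leaf`, a marked letter is uniquely a product
`u x z` with `u` unmarked or absent and `z` arbitrary or absent: the coloured algebra is the free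
product of its unmarked part and of the free algebra on `x`. -/
theorem prod_unmarked_marked (u : Sch) (w : Option (Bool × Sch)) :
    (dendColoring K).prod (false, u) (true, .node none w) = word K (true, .node (some u) w) := by
  have h : colOp dotRel (dendriformRelations K) false true ((dendColoring K).value (false, u))
      ((dendColoring K).value (true, .node none w)) =
      (dendColoring K).basis.algBasis (.node (some u) w) := by
    rw [dendColoring_value, dendColoring_value, ← schMon_some]
    exact ((dendColoring K).basis.algBasis_apply _).symm
  refine (congrArg (fun v => Finsupp.lmapDomain K K (Prod.mk true)
    ((dendColoring K).basis.algBasis.repr v)) h).trans ?_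
  simp

theorem prod_leaf (z : Bool × Sch) : (dendColoring K).prod (true, .node none none) z =
    word K (true, .node none (some z)) := by
  obtain ⟨b, v⟩ := z
  have h : colOp dotRel (dendriformRelations K) true b
      ((dendColoring K).value (true, .node none none)) ((dendColoring K).value (b, v)) =
      (dendColoring K).basis.algBasis (.node none (some (b, v))) := by
    rw [dendColoring_value, dendColoring_value, ← schMon_none_some]
    exact ((dendColoring K).basis.algBasis_apply _).symm
  refine (congrArg (fun v => Finsupp.lmapDomain K K (Prod.mk (max true b))
    ((dendColoring K).basis.algBasis.repr v)) h).trans ?_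
  simp

/-- The marked letters which begin with `x` span a right ideal, since `(x w) z = x (w z)`. -/
theorem prod_marked (w : Option (Bool × Sch)) (z : Bool × Sch) :
    ∃ q, (dendColoring K).prod (true, .node none w) z = marked q := by
  obtain _ | w := w
  · exact ⟨Finsupp.single (some z) 1, by rw [prod_leaf, marked_single]⟩
  · refine ⟨Finsupp.lmapDomain K K some ((dendColoring K).prod w z), ?_⟩
    have := (dendColoring K).assoc_prod (true, .node none none) w z
    rw [prod_leaf, mul_single] at this
    rw [this]
    suffices mul (dendColoring K).prod (word K (true, .node none none)) =
      marked ∘ₗ Finsupp.lmapDomain K K some from LinearMap.congr_fun this _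
    refine Finsupp.lhom_ext' fun z => LinearMap.ext_ring ?_
    simp [prod_leaf]

/-- The homotopy in the bar complex on the right of an unmarked letter. -/
noncomputable def innerHomotopy (K : Type u) [Field K] :
    List (Bool × Sch) → (List (Bool × Sch) →₀ K)
  | [] => 0
  | (false, t) :: l => -cons (word K (false, t)) (innerHomotopy K l)
  | (true, .node (some u) w) :: l => word K ((false, u) :: (true, .node none w) :: l)
  | (true, .node none _) :: _ => 0

/-- The homotopy in the bar complex. -/
noncomputable def dendHomotopyMap (K : Type u) [Field K] :
    List (Bool × Sch) → (List (Bool × Sch) →₀ K)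
  | (true, .node none (some z)) :: l => word K ((true, .node none none) :: z :: l)
  | l => innerHomotopy K l

/-- The linear extension of `innerHomotopy`. -/
noncomputable abbrev innerLin (K : Type u) [Field K] :
    (List (Bool × Sch) →₀ K) →ₗ[K] (List (Bool × Sch) →₀ K) :=
  Finsupp.linearCombination K (innerHomotopy K)

/-- The linear extension of `dendHomotopyMap`. -/
noncomputable abbrev dendLin (K : Type u) [Field K] :
    (List (Bool × Sch) →₀ K) →ₗ[K] (List (Bool × Sch) →₀ K) :=
  Finsupp.linearCombination K (dendHomotopyMap K)

theorem innerLin_unmarked (q : Sch →₀ K) (v : List (Bool × Sch) →₀ K) :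
    innerLin K (cons (unmarked q) v) = -cons (unmarked q) (innerLin K v) := by
  rw [← map_neg]
  suffices (cons.comp unmarked).compr₂ (innerLin K) =
      (cons.comp unmarked).compl₂ (-innerLin K) from
    LinearMap.congr_fun (LinearMap.congr_fun this q) v
  refine hom_ext₂ fun s l => ?_
  simp [innerHomotopy]

theorem innerLin_marked (q : Option (Bool × Sch) →₀ K) (v : List (Bool × Sch) →₀ K) :
    innerLin K (cons (marked q) v) = 0 := by
  suffices (cons.comp marked).compr₂ (innerLin K) = 0 from
    LinearMap.congr_fun (LinearMap.congr_fun this q) v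
  refine hom_ext₂ fun s l => ?_
  simp [innerHomotopy]

theorem innerLin_mul (q : Sch →₀ K) (q' : Option (Bool × Sch) →₀ K) (v : List (Bool × Sch) →₀ K) :
    innerLin K (cons (mul (dendColoring K).prod (unmarked q) (marked q')) v) =
      cons (unmarked q) (cons (marked q') v) := by
  suffices ∀ u, ((cons.comp (mul (dendColoring K).prod (word K (false, u)))).comp marked).compr₂
      (innerLin K) = (cons.comp marked).compr₂ (cons (word K (false, u))) by
    suffices h : (innerLin K ∘ₗ cons.flip v ∘ₗ (mul (dendColoring K).prod).flip (marked q')) ∘ₗ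
      unmarked = cons.flip (cons (marked q') v) ∘ₗ unmarked from LinearMap.congr_fun h q
    refine Finsupp.lhom_ext' fun u => LinearMap.ext_ring ?_
    simpa using LinearMap.congr_fun (LinearMap.congr_fun (this u) q') v
  refine fun u => hom_ext₂ fun w l => ?_
  simp [innerHomotopy, prod_unmarked_marked]

theorem dendLin_cons_unmarked (t : Sch) (v : List (Bool × Sch) →₀ K) :
    dendLin K (cons (word K (false, t)) v) = innerLin K (cons (word K (false, t)) v) := by
  suffices dendLin K ∘ₗ cons (word K (false, t)) = innerLin K ∘ₗ cons (word K (false, t)) from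
    LinearMap.congr_fun this v
  refine Finsupp.lhom_ext' fun l => LinearMap.ext_ring ?_
  simp [dendHomotopyMap]

/-- The two homotopies differ only on words whose first letter is a product `x z`. A product with an
unmarked left factor has no such term. -/
theorem headMul_unmarked_eq (t : Sch) (l : List (Bool × Sch)) :
    dendLin K (headMul (dendColoring K).prod (word K (false, t)) (word K l)) =
      innerLin K (headMul (dendColoring K).prod (word K (false, t)) (word K l)) := by
  have h0 : ∀ (q : Sch →₀ K) (v : List (Bool × Sch) →₀ K),
      dendLin K (cons (unmarked q) v) = innerLin K (cons (unmarked q) v) := by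
    intro q v
    suffices (dendLin K ∘ₗ cons.flip v) ∘ₗ unmarked = (innerLin K ∘ₗ cons.flip v) ∘ₗ unmarked from
      LinearMap.congr_fun this q
    refine Finsupp.lhom_ext' fun u => LinearMap.ext_ring ?_
    simpa using dendLin_cons_unmarked u v
  have h1 : ∀ (q : Sch →₀ K) (w : Option (Bool × Sch)) (l : List (Bool × Sch)),
      dendLin K (cons (mul (dendColoring K).prod (unmarked q) (word K (true, .node none w)))
        (word K l)) =
      innerLin K (cons (mul (dendColoring K).prod (unmarked q) (word K (true, .node none w)))
        (word K l)) := by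
    intro q w l
    suffices (dendLin K ∘ₗ cons.flip (word K l) ∘ₗ (mul (dendColoring K).prod).flip
        (word K (true, .node none w))) ∘ₗ unmarked =
      (innerLin K ∘ₗ cons.flip (word K l) ∘ₗ (mul (dendColoring K).prod).flip
        (word K (true, .node none w))) ∘ₗ unmarked from LinearMap.congr_fun this q
    refine Finsupp.lhom_ext' fun u => LinearMap.ext_ring ?_
    simp [prod_unmarked_marked, dendHomotopyMap]
  match l with
  | [] => simp
  | (false, s) :: l =>
    obtain ⟨q, hq⟩ := prod_unmarked (K := K) t s
    rw [word_cons, headMul_cons, mul_single, hq, h0]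
  | (true, .node none w) :: l =>
    have := h1 (Finsupp.single t 1) w l
    rw [unmarked_single] at this
    rwa [word_cons, headMul_cons]
  | (true, .node (some u) w) :: l =>
    obtain ⟨q, hq⟩ := prod_unmarked (K := K) t u
    have := h1 q w l
    rwa [← hq, ← mul_single (dendColoring K).prod, (dendColoring K).assoc_prod.mul_assoc,
      mul_single, prod_unmarked_marked, ← headMul_cons, cons_single] at this

theorem innerLin_headMul (u : Sch) (w : Option (Bool × Sch)) (l : List (Bool × Sch)) :
    innerLin K (headMul (dendColoring K).prod (word K (false, u))
      (headMul (dendColoring K).prod (word K (true, .node none w)) (word K l))) =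
      cons (word K (false, u))
        (headMul (dendColoring K).prod (word K (true, .node none w)) (word K l)) := by
  obtain _ | ⟨z, l⟩ := l
  · simp
  · obtain ⟨q, hq⟩ := prod_marked (K := K) w z
    rw [word_cons, headMul_cons, headMul_cons, mul_single, hq, ← unmarked_single, innerLin_mul]

theorem innerLin_headMul_marked (w : Option (Bool × Sch)) (l : List (Bool × Sch)) :
    innerLin K (headMul (dendColoring K).prod (word K (true, .node none w)) (word K l)) = 0 := by
  obtain _ | ⟨z, l⟩ := l
  · simp
  · obtain ⟨q, hq⟩ := prod_marked (K := K) w z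
    rw [word_cons, headMul_cons, mul_single, hq, innerLin_marked]

theorem dendLin_headMul_leaf (a : Bool × Sch →₀ K) (v : List (Bool × Sch) →₀ K) :
    dendLin K (cons (mul (dendColoring K).prod (word K (true, .node none none)) a) v) =
      cons (word K (true, .node none none)) (cons a v) := by
  suffices ((cons.comp (mul (dendColoring K).prod (word K (true, .node none none)))).compr₂
      (dendLin K)) = cons.compr₂ (cons (word K (true, .node none none))) from
    LinearMap.congr_fun (LinearMap.congr_fun this a) v
  refine hom_ext₂ fun w l => ?_
  simp [dendHomotopyMap, prod_leaf]

theorem word_some (u : Sch) (w : Option (Bool × Sch)) : word K (true, .node (some u) w) =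
    mul (dendColoring K).prod (word K (false, u)) (word K (true, .node none w)) := by
  rw [mul_single, prod_unmarked_marked]

/-- The first face of `u | x w | l` restores the word `u x w | l`. The other faces cancel the images
of the faces of this word. -/
theorem bar_innerHomotopy_some (u : Sch) (w : Option (Bool × Sch)) (l : List (Bool × Sch)) :
    bar (dendColoring K).prod (innerHomotopy K ((true, .node (some u) w) :: l)) +
      innerLin K (barList (dendColoring K).prod ((true, .node (some u) w) :: l)) =
      word K ((true, .node (some u) w) :: l) := by
  have h1 : innerHomotopy K ((true, .node (some u) w) :: l) =
      cons (word K (false, u)) (cons (word K (true, .node none w)) (word K l)) := by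
    simp [innerHomotopy]
  have h2 := innerLin_mul (K := K) (Finsupp.single u 1) (Finsupp.single w 1)
    (barList (dendColoring K).prod l)
  rw [unmarked_single, marked_single] at h2
  rw [h1, bar_cons, bar_cons, headMul_cons, barList, word_cons, word_some,
    (dendColoring K).assoc_prod.headMul_mul, map_sub, map_sub, innerLin_headMul, h2, bar_single]
  abel

/-- This is the homotopy identity on the word `s :: l`, expanded by `bar_cons`. The unmarked letter
in front is needed: on `x w :: l` alone the inner homotopy contributes nothing, and the missing word
comes from the product of `s` and `x w`, which is cut again before `x`. -/
theorem inner_homotopy (s : Sch) (l : List (Bool × Sch)) (hl : true ∈ l.map Prod.fst) :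
    cons (word K (false, s)) (bar (dendColoring K).prod (innerHomotopy K l) +
      innerLin K (barList (dendColoring K).prod l)) +
      innerLin K (headMul (dendColoring K).prod (word K (false, s)) (word K l)) -
      headMul (dendColoring K).prod (word K (false, s)) (innerHomotopy K l) =
      cons (word K (false, s)) (word K l) := by
  induction l generalizing s with
  | nil => simp at hl
  | cons y l ih =>
    match y with
    | (false, t) =>
      have h1 : innerHomotopy K ((false, t) :: l) =
          -cons (word K (false, t)) (innerHomotopy K l) := by
        simp [innerHomotopy]
      obtain ⟨q, hq⟩ := prod_unmarked (K := K) s t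
      have h2 := innerLin_unmarked (Finsupp.single t 1) (barList (dendColoring K).prod l)
      rw [unmarked_single] at h2
      have h3 := ih t (by simpa using hl)
      have h4 : innerLin K (word K l) = innerHomotopy K l := by simp
      rw [word_cons, headMul_cons, mul_single, hq, innerLin_unmarked, h4, h1, map_neg, map_neg,
        headMul_cons, mul_single, hq, bar_cons, barList, map_sub, h2, ← h3]
      simp only [map_add, map_sub, map_neg]
      abel
    | (true, .node none w) =>
      have h1 : innerHomotopy K ((true, .node none w) :: l) = 0 := by
        simp [innerHomotopy]
      have h2 := innerLin_mul (K := K) (Finsupp.single s 1) (Finsupp.single w 1) (word K l)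
      have h3 := innerLin_marked (K := K) (Finsupp.single w 1) (barList (dendColoring K).prod l)
      rw [unmarked_single, marked_single] at h2
      rw [marked_single] at h3
      rw [h1, word_cons, headMul_cons, h2, barList, map_sub, innerLin_headMul_marked, h3]
      simp
    | (true, .node (some u) w) =>
      obtain ⟨q, hq⟩ := prod_unmarked (K := K) s u
      have h1 : innerHomotopy K ((true, .node (some u) w) :: l) =
          cons (word K (false, u)) (cons (word K (true, .node none w)) (word K l)) := by
        simp [innerHomotopy]
      have h2 := innerLin_mul (K := K) q (Finsupp.single w 1) (word K l)
      rw [marked_single] at h2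
      rw [bar_innerHomotopy_some, h1, headMul_cons, word_cons, headMul_cons, word_some,
        ← (dendColoring K).assoc_prod.mul_assoc, mul_single (dendColoring K).prod (false, s), hq,
        h2]
      abel

/-- Case analysis on the first letter. An unmarked letter reduces to `inner_homotopy`, a letter `u x
w` to the cut `u | x w`, a letter `x z` to the cut `x | z`. A word which begins with the bare `x`
has zero image, and its first face, the product of `x` with the next letter, is cut back into it;
the one-letter word `x` has no such face. -/
theorem dend_homotopy (l : List (Bool × Sch)) (hl : true ∈ l.map Prod.fst)
    (hne : ∀ c, l ≠ [(c, .node none none)]) :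
    bar (dendColoring K).prod (dendHomotopyMap K l) +
      dendLin K (barList (dendColoring K).prod l) = word K l := by
  obtain _ | ⟨y, l⟩ := l
  · simp at hl
  match y with
  | (false, t) =>
    have h1 : dendHomotopyMap K ((false, t) :: l) =
        -cons (word K (false, t)) (innerHomotopy K l) := by
      simp [dendHomotopyMap, innerHomotopy]
    have h2 := innerLin_unmarked (Finsupp.single t 1) (barList (dendColoring K).prod l)
    rw [unmarked_single] at h2
    rw [h1, map_neg, bar_cons, barList, map_sub, headMul_unmarked_eq, dendLin_cons_unmarked, h2,
      word_cons, ← inner_homotopy t l (by simpa using hl), map_add]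
    abel
  | (true, .node (some u) w) =>
    have h1 : dendHomotopyMap K ((true, .node (some u) w) :: l) =
        innerHomotopy K ((true, .node (some u) w) :: l) := by
      simp [dendHomotopyMap]
    rw [h1, ← bar_innerHomotopy_some u w l]
    congr 1
    have h2 : ∀ v, dendLin K (cons (word K (true, .node (some u) w)) v) =
        innerLin K (cons (word K (true, .node (some u) w)) v) := by
      intro v
      suffices dendLin K ∘ₗ cons (word K (true, .node (some u) w)) =
        innerLin K ∘ₗ cons (word K (true, .node (some u) w)) from LinearMap.congr_fun this v
      refine Finsupp.lhom_ext' fun l => LinearMap.ext_ring ?_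
      simp [dendHomotopyMap]
    rw [barList, map_sub, map_sub, h2]
    congr 1
    -- Reassociating puts the unmarked factor `u` on the left, so the product never begins with `x`.
    rw [word_some, (dendColoring K).assoc_prod.headMul_mul]
    obtain _ | ⟨z, l⟩ := l
    · simp
    · obtain ⟨q, hq⟩ := prod_marked (K := K) w z
      rw [word_cons, headMul_cons, mul_single, hq]
      suffices dendLin K ∘ₗ headMul (dendColoring K).prod (word K (false, u)) =
        innerLin K ∘ₗ headMul (dendColoring K).prod (word K (false, u)) from
        LinearMap.congr_fun this _
      exact Finsupp.lhom_ext' fun l => LinearMap.ext_ring (headMul_unmarked_eq u l)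
  | (true, .node none (some z)) =>
    have h1 : dendHomotopyMap K ((true, .node none (some z)) :: l) =
        cons (word K (true, .node none none)) (cons (word K z) (word K l)) := by
      simp [dendHomotopyMap]
    have h2 : word K (true, .node none (some z)) =
        mul (dendColoring K).prod (word K (true, .node none none)) (word K z) := by
      rw [mul_single, prod_leaf]
    have h3 : dendLin K (headMul (dendColoring K).prod (word K (true, .node none none))
        (headMul (dendColoring K).prod (word K z) (word K l))) =
        cons (word K (true, .node none none))
          (headMul (dendColoring K).prod (word K z) (word K l)) := by
      obtain _ | ⟨z', l⟩ := l
      · simp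
      · rw [word_cons, headMul_cons, headMul_cons, dendLin_headMul_leaf]
    rw [h1, bar_cons, bar_cons, headMul_cons, barList, word_cons, h2,
      (dendColoring K).assoc_prod.headMul_mul, map_sub, map_sub, h3, dendLin_headMul_leaf,
      bar_single]
    abel
  | (true, .node none none) =>
    obtain _ | ⟨z, l⟩ := l
    · exact absurd rfl (hne true)
    · have h1 : dendHomotopyMap K ((true, .node none none) :: z :: l) = 0 := by
        simp [dendHomotopyMap, innerHomotopy]
      have h2 : ∀ v, dendLin K (cons (word K (true, .node none none)) v) = 0 := by
        intro v
        suffices dendLin K ∘ₗ cons (word K (true, .node none none)) = 0 from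
          LinearMap.congr_fun this v
        refine Finsupp.lhom_ext' fun l => LinearMap.ext_ring ?_
        simp [dendHomotopyMap, innerHomotopy]
      rw [h1, barList, map_sub, h2, word_cons z l, headMul_cons, dendLin_headMul_leaf, word_cons,
        word_cons]
      simp

theorem innerHomotopy_eq_zero {l : List (Bool × Sch)} (hl : true ∉ l.map Prod.fst) :
    innerHomotopy K l = 0 := by
  induction l with
  | nil => rfl
  | cons y l ih =>
    obtain ⟨_ | _, t⟩ := y
    · rw [innerHomotopy, ih (by simpa using hl), map_zero, neg_zero]
    · simp at hl

/-- The contracting homotopy for dendriform trialgebras. -/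
noncomputable def dendHomotopy (K : Type u) [Field K] : (dendColoring K).Homotopy where
  map := dendHomotopyMap K
  map_eq_zero k l hl h := by
    rw [dendColoring_toChain_eq_zero_iff hl] at h
    have : dendHomotopyMap K l = innerHomotopy K l := by
      unfold dendHomotopyMap
      split
      · simp at h
      · rfl
    rw [this, innerHomotopy_eq_zero h, map_zero]
  map_eq k l l' hl hl' h e := by
    have h' := e ▸ h
    rw [Ne, dendColoring_toChain_eq_zero_iff hl, not_not] at h
    rw [Ne, dendColoring_toChain_eq_zero_iff hl', not_not] at h'
    obtain ⟨h1, h2⟩ := (dendColoring K).eq_of_toChain_eq hl hl'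
      (dendColoring_nodes h (by simpa using hl)) (dendColoring_nodes h' (by simpa using hl'))
      (dendColoring_isDual h) (dendColoring_isDual h') e
    have h3 : l.map Prod.fst = l'.map Prod.fst := congrArg Subtype.val h1
    have : l = l' := by
      rw [← List.zip_unzip l, ← List.zip_unzip l', List.unzip_fst, List.unzip_snd,
        List.unzip_fst, List.unzip_snd, h2, h3]
    rw [this]
  homotopy k l hl hne h := by
    rw [Ne, dendColoring_toChain_eq_zero_iff hl, not_not] at h
    rw [dend_homotopy l h hne]

theorem koszulAcyclic_dendriformRelations (K : Type u) [Field K] :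
    KoszulAcyclic (dendriformRelations K) :=
  (dendHomotopy K).acyclic

end quadraticOperad

/-! ### Comparisons of maxima over adjacent intervals -/

/-- The maximum of the values of a function on an interval `[p, q)`. -/
def intervalMax (f : ℕ → ℕ) (p q : ℕ) : ℕ := (Finset.Ico p q).sup f

theorem intervalMax_self (f : ℕ → ℕ) (p : ℕ) : intervalMax f p p = 0 := by
  simp [intervalMax]

theorem intervalMax_single (f : ℕ → ℕ) (p : ℕ) : intervalMax f p (p + 1) = f p := by
  simp [intervalMax]

theorem intervalMax_split (f : ℕ → ℕ) {p m q : ℕ} (h : p ≤ m) (h' : m ≤ q) :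
    intervalMax f p q = max (intervalMax f p m) (intervalMax f m q) := by
  rw [intervalMax, ← Finset.Ico_union_Ico_eq_Ico h h', Finset.sup_union]
  rfl

theorem intervalMax_congr {f g : ℕ → ℕ} {p q : ℕ} (h : ∀ t, p ≤ t → t < q → f t = g t) :
    intervalMax f p q = intervalMax g p q :=
  Finset.sup_congr rfl fun t ht => h t (Finset.mem_Ico.1 ht).1 (Finset.mem_Ico.1 ht).2

theorem exists_intervalMax_eq (f : ℕ → ℕ) {p q : ℕ} (h : p < q) :
    ∃ t, p ≤ t ∧ t < q ∧ intervalMax f p q = f t := by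
  obtain ⟨t, ht, e⟩ := Finset.exists_mem_eq_sup (Finset.Ico p q) ⟨p, by simp [h]⟩ f
  exact ⟨t, (Finset.mem_Ico.1 ht).1, (Finset.mem_Ico.1 ht).2, e⟩

theorem intervalMax_comp {f f' g : ℕ → ℕ} (hg : Monotone g) {p q d : ℕ} (h : p < q)
    (hf : ∀ t, p ≤ t → t < q → f' (t + d) = g (f t)) :
    intervalMax f' (p + d) (q + d) = g (intervalMax f p q) := by
  induction q, h using Nat.le_induction with
  | base =>
    rw [show p.succ + d = p + d + 1 by omega, intervalMax_single, intervalMax_single,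
      hf p le_rfl (by omega)]
  | succ q hq ih =>
    rw [intervalMax_split f' (m := q + d) (by omega) (by omega),
      ih fun t h1 h2 => hf t h1 (by omega), show q + 1 + d = q + d + 1 by omega,
      intervalMax_single, intervalMax_split f (m := q) (q := q + 1) (by omega) (by omega),
      intervalMax_single, hf q (by omega) (by omega), hg.map_max]

/-- The maxima over adjacent intervals compare in the same way. -/
def SameComparisons (n : ℕ) (f g : ℕ → ℕ) : Prop :=
  ∀ p m q, p < m → m < q → q ≤ n →
    (intervalMax f p m < intervalMax f m q ↔ intervalMax g p m < intervalMax g m q) ∧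
    (intervalMax f m q < intervalMax f p m ↔ intervalMax g m q < intervalMax g p m)

namespace SameComparisons

/-- Doubling of heights, which makes room for intermediate heights. -/
def dbl (i : ℕ) : ℕ := 2 * i + 1

theorem dbl_mono : Monotone dbl := fun a b h => by simp only [dbl]; omega

theorem dbl_left {n : ℕ} {f f' : ℕ → ℕ} (hf : ∀ t, t < n → f' t = dbl (f t)) :
    SameComparisons n f' f := by
  intro p m q h1 h2 h3
  have e1 := intervalMax_comp (d := 0) dbl_mono h1 fun t _ _ => hf t (by omega)
  have e2 := intervalMax_comp (d := 0) dbl_mono h2 fun t _ _ => hf t (by omega)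
  simp only [add_zero, dbl] at e1 e2
  omega

/-- The height of a leaf which is lower than its neighbours is irrelevant. -/
theorem of_valley {n k : ℕ} {f g : ℕ → ℕ} (h : ∀ t, t < n → t ≠ k → f t = g t)
    (h1 : k + 1 < n → f k < f (k + 1) ∧ g k < f (k + 1))
    (h2 : ∀ t, t + 1 = k → f k < f t ∧ g k < f t) : SameComparisons n f g := by
  -- An interval containing `k` and some other leaf contains a neighbour of `k`, which is higher;
  -- only the interval reduced to `k` sees the height of `k`.
  have key : ∀ p q, p < q → q ≤ n → (p ≠ k ∨ q ≠ k + 1) → intervalMax f p q = intervalMax g p q := by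
    intro p q hpq hq hne
    by_cases hk : p ≤ k ∧ k < q
    · rw [intervalMax_split f hk.1 hk.2.le, intervalMax_split g hk.1 hk.2.le,
        intervalMax_split f (show k ≤ k + 1 by omega) hk.2,
        intervalMax_split g (show k ≤ k + 1 by omega) hk.2, intervalMax_single,
        intervalMax_single,
        intervalMax_congr fun t (_ : p ≤ t) (_ : t < k) => h t (by omega) (by omega),
        intervalMax_congr fun t (_ : k + 1 ≤ t) (_ : t < q) => h t (by omega) (by omega)]
      rcases hne with hne | hne
      · obtain ⟨k, rfl⟩ : ∃ k', k = k' + 1 := ⟨k - 1, by omega⟩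
        have := h2 k rfl
        rw [intervalMax_split g (p := p) (m := k) (by omega) (by omega), intervalMax_single,
          ← h k (by omega) (by omega)]
        omega
      · have := h1 (by omega)
        rw [intervalMax_split g (p := k + 1) (m := k + 2) (by omega) (by omega),
          intervalMax_single, ← h (k + 1) (by omega) (by omega)]
        omega
    · exact intervalMax_congr fun t _ _ => h t (by omega) (by omega)
  intro p m q hp hm hq
  by_cases c1 : p = k ∧ m = k + 1
  · obtain ⟨rfl, rfl⟩ := c1
    have := h1 (by omega)
    rw [← key (p + 1) q hm hq (by omega), intervalMax_single, intervalMax_single,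
      intervalMax_split f (p := p + 1) (m := p + 2) (by omega) (by omega), intervalMax_single]
    omega
  by_cases c2 : m = k ∧ q = k + 1
  · obtain ⟨rfl, rfl⟩ := c2
    obtain ⟨m, rfl⟩ : ∃ m', m = m' + 1 := ⟨m - 1, by omega⟩
    have := h2 m rfl
    rw [← key p (m + 1) hp (by omega) (by omega), intervalMax_single, intervalMax_single,
      intervalMax_split f (p := p) (m := m) (by omega) (by omega), intervalMax_single]
    omega
  · rw [key p m hp (by omega) (by omega), key m q hm hq (by omega)]
    exact ⟨Iff.rfl, Iff.rfl⟩

/-- The heights after a leaf has been replaced by two leaves. -/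
structure Inflation (n k : ℕ) (f f' : ℕ → ℕ) : Prop where
  lt : k < n
  left : ∀ t, t < k → f' t = dbl (f t)
  right : ∀ t, k < t → t < n → f' (t + 1) = dbl (f t)
  max_eq : max (f' k) (f' (k + 1)) = dbl (f k)

namespace Inflation

variable {n k : ℕ} {f f' : ℕ → ℕ}

theorem max_left {p q : ℕ} (h : Inflation n k f f') (hp : p < q) (hq : q ≤ k) :
    intervalMax f' p q = dbl (intervalMax f p q) := by
  simpa using intervalMax_comp (d := 0) dbl_mono hp fun t _ _ => h.left t (by omega)

theorem max_right {p q : ℕ} (h : Inflation n k f f') (hp : k < p) (hpq : p < q) (hq : q ≤ n) :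
    intervalMax f' (p + 1) (q + 1) = dbl (intervalMax f p q) :=
  intervalMax_comp dbl_mono hpq fun t _ _ => h.right t (by omega) (by omega)

theorem max_left_end {p : ℕ} (h : Inflation n k f f') (hp : p < k) :
    intervalMax f' p (k + 1) = max (dbl (intervalMax f p k)) (f' k) := by
  rw [intervalMax_split f' (m := k) hp.le (by omega), intervalMax_single, h.max_left hp le_rfl]

theorem max_right_end {q : ℕ} (h : Inflation n k f f') (hk : k + 1 < q) (hq : q ≤ n) :
    intervalMax f' (k + 1) (q + 1) = max (f' (k + 1)) (dbl (intervalMax f (k + 1) q)) := by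
  rw [intervalMax_split f' (m := k + 1 + 1) (by omega) (by omega), intervalMax_single,
    h.max_right (by omega) hk hq]

theorem max_both {p q : ℕ} (h : Inflation n k f f') (hp : p ≤ k) (hk : k < q) (hq : q ≤ n) :
    intervalMax f' p (q + 1) = dbl (intervalMax f p q) := by
  have e := h.max_eq
  have h1 : intervalMax f' k (q + 1) = dbl (intervalMax f k q) := by
    rw [intervalMax_split f' (m := k + 1) (by omega) (by omega), intervalMax_single,
      intervalMax_split f (m := k + 1) (by omega) (by omega), intervalMax_single]
    rcases (show k + 1 ≤ q from hk).lt_or_eq with hk | rfl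
    · rw [h.max_right_end hk hq]
      simp only [dbl] at e ⊢
      omega
    · rw [intervalMax_single, intervalMax_self]
      simp only [dbl] at e ⊢
      omega
  rcases hp.lt_or_eq with hp | rfl
  · rw [intervalMax_split f' (m := k) hp.le (by omega), h.max_left hp le_rfl, h1,
      intervalMax_split f (m := k) (q := q) hp.le (by omega)]
    simp only [dbl]
    omega
  · exact h1

end Inflation

/-- Replacing a leaf by two leaves preserves comparisons. -/
theorem inflation {n k : ℕ} {f f' g g' : ℕ → ℕ} (h : SameComparisons n f g)
    (hf : Inflation n k f f') (hg : Inflation n k g g')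
    (H : (f' k = 2 * f k ∧ f' (k + 1) = dbl (f k) ∧ g' k = 2 * g k ∧ g' (k + 1) = dbl (g k)) ∨
      (f' k = dbl (f k) ∧ f' (k + 1) = dbl (f k) ∧ g' k = dbl (g k) ∧ g' (k + 1) = dbl (g k)) ∨
      (f' k = dbl (f k) ∧ f' (k + 1) = 2 * f k ∧ g' k = dbl (g k) ∧ g' (k + 1) = 2 * g k)) :
    SameComparisons (n + 1) f' g' := by
  intro p m q hp hm hq
  have hk := hf.lt
  have kk : ∀ a, a < k → intervalMax f a (k + 1) = max (intervalMax f a k) (f k) ∧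
      intervalMax g a (k + 1) = max (intervalMax g a k) (g k) := fun a ha => by
    rw [intervalMax_split f (m := k) ha.le (by omega), intervalMax_single,
      intervalMax_split g (m := k) ha.le (by omega), intervalMax_single]
    exact ⟨rfl, rfl⟩
  have kr : ∀ b, k + 1 < b → intervalMax f k b = max (f k) (intervalMax f (k + 1) b) ∧
      intervalMax g k b = max (g k) (intervalMax g (k + 1) b) := fun b hb => by
    rw [intervalMax_split f (m := k + 1) (by omega) hb.le, intervalMax_single,
      intervalMax_split g (m := k + 1) (by omega) hb.le, intervalMax_single]
    exact ⟨rfl, rfl⟩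
  -- The boundary between the two new leaves is at `k + 1`. When no endpoint is there, all maxima
  -- are doubled; when one is, the comparisons follow from those of `f` and `g` with the boundary
  -- moved to `k` or to `k + 1`, that is, with the leaf `k` on either side.
  rcases lt_trichotomy q (k + 1) with c | rfl | c
  · rw [hf.max_left hp (by omega), hf.max_left hm (by omega), hg.max_left hp (by omega),
      hg.max_left hm (by omega)]
    have := h p m q hp hm (by omega)
    simp only [dbl]
    omega
  · rw [hf.max_left hp (by omega), hg.max_left hp (by omega)]
    rcases (show m ≤ k by omega).lt_or_eq with hmk | rfl
    · rw [hf.max_left_end hmk, hg.max_left_end hmk]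
      have a1 := (h p m k hp hmk (by omega)).2
      have a2 := h p m (k + 1) hp (by omega) (by omega)
      rw [(kk m hmk).1, (kk m hmk).2] at a2
      clear h kk kr hf hg
      simp only [dbl] at H ⊢
      rcases H with ⟨h1, h2, h3, h4⟩ | ⟨h1, h2, h3, h4⟩ | ⟨h1, h2, h3, h4⟩ <;> rw [h1, h3] <;>
        clear h1 h2 h3 h4 <;> omega
    · rw [intervalMax_single, intervalMax_single]
      have a1 := h p m (m + 1) hp (by omega) (by omega)
      rw [intervalMax_single, intervalMax_single] at a1
      clear h kk kr hf hg
      simp only [dbl] at H ⊢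
      omega
  · obtain ⟨q, rfl⟩ : ∃ q', q = q' + 1 := ⟨q - 1, by omega⟩
    rcases lt_trichotomy m (k + 1) with d | rfl | d
    · rw [hf.max_left hp (by omega), hg.max_left hp (by omega), hf.max_both (by omega) (by omega)
        (by omega), hg.max_both (by omega) (by omega) (by omega)]
      have := h p m q hp (by omega) (by omega)
      simp only [dbl]
      omega
    · rcases (show p ≤ k by omega).lt_or_eq with hpk | rfl
      · rw [hf.max_left_end hpk, hg.max_left_end hpk]
        have a1 := h p k (k + 1) hpk (by omega) (by omega)
        rw [intervalMax_single, intervalMax_single] at a1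
        rcases (show k + 1 ≤ q by omega).lt_or_eq with hq' | rfl
        · rw [hf.max_right_end hq' (by omega), hg.max_right_end hq' (by omega)]
          have a3 := h p k q hpk (by omega) (by omega)
          have a4 := h p (k + 1) q hp hq' (by omega)
          rw [(kk p hpk).1, (kk p hpk).2] at a4
          rw [(kr q hq').1, (kr q hq').2] at a3
          clear h kk kr hf hg a1
          simp only [dbl] at H ⊢
          rcases H with ⟨h1, h2, h3, h4⟩ | ⟨h1, h2, h3, h4⟩ | ⟨h1, h2, h3, h4⟩ <;>
            rw [h1, h2, h3, h4] <;> clear h1 h2 h3 h4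
          · clear a4
            omega
          · exact ⟨by omega, by omega⟩
          · clear a3
            omega
        · rw [intervalMax_single, intervalMax_single]
          simp only [dbl] at H ⊢
          omega
      · rw [intervalMax_single, intervalMax_single]
        rcases (show p + 1 ≤ q by omega).lt_or_eq with hq' | rfl
        · rw [hf.max_right_end hq' (by omega), hg.max_right_end hq' (by omega)]
          have a2 := h p (p + 1) q (by omega) hq' (by omega)
          rw [intervalMax_single, intervalMax_single] at a2
          simp only [dbl] at H ⊢
          omega
        · rw [intervalMax_single, intervalMax_single]
          simp only [dbl] at H ⊢
          omega
    · obtain ⟨m, rfl⟩ : ∃ m', m = m' + 1 := ⟨m - 1, by omega⟩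
      rw [hf.max_right (p := m) (by omega) (by omega) (by omega),
        hg.max_right (p := m) (by omega) (by omega) (by omega)]
      rcases lt_trichotomy p (k + 1) with e | rfl | e
      · rw [hf.max_both (by omega) (by omega) (by omega),
          hg.max_both (by omega) (by omega) (by omega)]
        have := h p m q (by omega) (by omega) (by omega)
        simp only [dbl]
        omega
      · rcases (show k + 1 ≤ m by omega).lt_or_eq with hm' | rfl
        · rw [hf.max_right_end hm' (by omega), hg.max_right_end hm' (by omega)]
          have a1 := (h (k + 1) m q hm' (by omega) (by omega)).1
          have a3 := h k m q (by omega) (by omega) (by omega)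
          rw [(kr m hm').1, (kr m hm').2] at a3
          clear h kk kr hf hg
          simp only [dbl] at H ⊢
          rcases H with ⟨h1, h2, h3, h4⟩ | ⟨h1, h2, h3, h4⟩ | ⟨h1, h2, h3, h4⟩ <;>
            rw [h2, h4] <;> clear h1 h2 h3 h4 <;> omega
        · rw [intervalMax_single, intervalMax_single]
          have a4 := h k (k + 1) q (by omega) (by omega) (by omega)
          rw [intervalMax_single, intervalMax_single] at a4
          simp only [dbl] at H ⊢
          omega
      · obtain ⟨p, rfl⟩ : ∃ p', p = p' + 1 := ⟨p - 1, by omega⟩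
        rw [hf.max_right (p := p) (by omega) (by omega) (by omega),
          hg.max_right (p := p) (by omega) (by omega) (by omega)]
        have := h p m q (by omega) (by omega) (by omega)
        simp only [dbl]
        omega

/-- Raising a leaf just below the preceding leaf, if the latter is higher, preserves comparisons. -/
theorem raise {n k b c : ℕ} {f f' g g' : ℕ → ℕ} (h : SameComparisons n f g) (hk : k + 1 < n)
    (hf : ∀ t, t < n → t ≠ k + 1 → f' t = f t) (hg : ∀ t, t < n → t ≠ k + 1 → g' t = g t)
    (hfk : f k = 2 * b + 1) (hgk : g k = 2 * c + 1) (hf' : f' (k + 1) = 2 * b)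
    (hg' : g' (k + 1) = 2 * c) (hfl : f (k + 1) ≤ 2 * b) (hgl : g (k + 1) ≤ 2 * c)
    (hfn : ∀ t, k + 1 < t → t < n → f t ≠ 2 * b) (hgn : ∀ t, k + 1 < t → t < n → g t ≠ 2 * c) :
    SameComparisons n f' g' := by
  -- An interval which does not start at `k + 1` either avoids the raised leaf or also contains the
  -- higher leaf `k`, so its maximum does not change.
  have key : ∀ (b : ℕ) (f f' : ℕ → ℕ), (∀ t, t < n → t ≠ k + 1 → f' t = f t) →
      f k = 2 * b + 1 → f' (k + 1) = 2 * b → f (k + 1) ≤ 2 * b → ∀ p q, p < q → q ≤ n →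
      p ≠ k + 1 → intervalMax f' p q = intervalMax f p q := by
    intro b f f' hf h1 h2 h3 p q hpq hq hp
    by_cases hc : p ≤ k ∧ k + 1 < q
    · rw [intervalMax_split f (m := k) (by omega) (by omega),
        intervalMax_split f' (m := k) (by omega) (by omega),
        intervalMax_split f (p := k) (m := k + 1) (by omega) (by omega),
        intervalMax_split f' (p := k) (m := k + 1) (by omega) (by omega),
        intervalMax_split f (p := k + 1) (m := k + 1 + 1) (by omega) (by omega),
        intervalMax_split f' (p := k + 1) (m := k + 1 + 1) (by omega) (by omega),
        intervalMax_single, intervalMax_single, intervalMax_single, intervalMax_single,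
        hf k (by omega) (by omega),
        intervalMax_congr fun t (_ : p ≤ t) (_ : t < k) => hf t (by omega) (by omega),
        intervalMax_congr fun t (_ : k + 1 + 1 ≤ t) (_ : t < q) => hf t (by omega) (by omega)]
      omega
    · exact intervalMax_congr fun t _ _ => hf t (by omega) (by omega)
  have key' : ∀ (b : ℕ) (f f' : ℕ → ℕ), (∀ t, t < n → t ≠ k + 1 → f' t = f t) →
      f' (k + 1) = 2 * b → ∀ q, k + 1 < q → q ≤ n →
      intervalMax f' (k + 1) q = max (2 * b) (intervalMax f (k + 2) q) := by
    intro b f f' hf h2 q hq hq'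
    rw [intervalMax_split f' (m := k + 1 + 1) (by omega) (by omega), intervalMax_single, h2,
      intervalMax_congr fun t (_ : k + 1 + 1 ≤ t) (_ : t < q) => hf t (by omega) (by omega)]
  have sp : ∀ (f : ℕ → ℕ) q, k + 1 < q →
      intervalMax f (k + 1) q = max (f (k + 1)) (intervalMax f (k + 2) q) := fun f q hq => by
    rw [intervalMax_split f (m := k + 1 + 1) (by omega) (by omega), intervalMax_single]
  have ge : ∀ (f : ℕ → ℕ) p, p ≤ k → f k ≤ intervalMax f p (k + 1) := fun f p hp => by
    rw [intervalMax_split f (m := k) hp (by omega), intervalMax_single]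
    omega
  -- No maximum further right equals `2 * b`, so comparing it with `2 * b` amounts to comparing it
  -- with the height `2 * b + 1` of leaf `k`, about which the hypothesis gives information.
  have nm : ∀ (b : ℕ) (f : ℕ → ℕ), (∀ t, k + 1 < t → t < n → f t ≠ 2 * b) → ∀ p q, k + 1 < p →
      p < q → q ≤ n → intervalMax f p q ≠ 2 * b := by
    intro b f hf p q hp hpq hq
    obtain ⟨t, h1, h2, e⟩ := exists_intervalMax_eq f hpq
    rw [e]
    exact hf t (by omega) (by omega)
  intro p m q hp hm hq
  by_cases c1 : p = k + 1
  · subst c1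
    rw [key' b f f' hf hf' m hp (by omega), key' c g g' hg hg' m hp (by omega),
      key b f f' hf hfk hf' hfl m q hm hq (by omega), key c g g' hg hgk hg' hgl m q hm hq (by omega)]
    have a1 := h k (k + 1) m (by omega) hp (by omega)
    have a2 := h k (k + 1) q (by omega) (by omega) (by omega)
    have a3 := h (k + 1) m q hp hm (by omega)
    rw [intervalMax_single, intervalMax_single] at a1 a2
    rw [intervalMax_split f (m := m) hp.le hm.le, intervalMax_split g (m := m) hp.le hm.le] at a2
    rw [sp f m hp, sp g m hp] at a1 a2 a3
    have f1 := nm b f hfn m q hp hm hq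
    have g1 := nm c g hgn m q hp hm hq
    have f2 : intervalMax f (k + 2) m = 0 ∨ intervalMax f (k + 2) m ≠ 2 * b := by
      rcases (show k + 2 ≤ m from hp).lt_or_eq with h' | rfl
      · exact Or.inr (nm b f hfn _ _ (by omega) h' (by omega))
      · exact Or.inl (intervalMax_self _ _)
    have g2 : intervalMax g (k + 2) m = 0 ∨ intervalMax g (k + 2) m ≠ 2 * c := by
      rcases (show k + 2 ≤ m from hp).lt_or_eq with h' | rfl
      · exact Or.inr (nm c g hgn _ _ (by omega) h' (by omega))
      · exact Or.inl (intervalMax_self _ _)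
    clear h key key' sp ge nm hf hg hfn hgn
    by_cases x1 : intervalMax f (k + 2) m ≤ 2 * b
    · have x2 : intervalMax g (k + 2) m ≤ 2 * c := by omega
      by_cases y1 : intervalMax f m q ≤ 2 * b
      · have y2 : intervalMax g m q ≤ 2 * c := by omega
        clear a1 a2 a3
        omega
      · have y2 : ¬ intervalMax g m q ≤ 2 * c := by omega
        clear a1 a2 a3
        omega
    · have x2 : ¬ intervalMax g (k + 2) m ≤ 2 * c := by omega
      clear a1 a2
      omega
  by_cases c2 : m = k + 1
  · subst c2
    rw [key' b f f' hf hf' q hm hq, key' c g g' hg hg' q hm hq,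
      key b f f' hf hfk hf' hfl p _ hp (by omega) c1, key c g g' hg hgk hg' hgl p _ hp (by omega) c1]
    have a1 := h p (k + 1) q hp hm hq
    rw [sp f q hm, sp g q hm] at a1
    have f1 := ge f p (by omega)
    have g1 := ge g p (by omega)
    clear h key key' sp ge nm hf hg hfn hgn
    omega
  · rw [key b f f' hf hfk hf' hfl p m hp (by omega) c1,
      key c g g' hg hgk hg' hgl p m hp (by omega) c1,
      key b f f' hf hfk hf' hfl m q hm hq c2, key c g g' hg hgk hg' hgl m q hm hq c2]
    exact h p m q hp hm hq

end SameComparisons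

/-! ### Lists of heights with the same comparisons -/

theorem maxHeight_eq_intervalMax (A B E : List ℕ) : maxHeight B =
    intervalMax (fun t => (A ++ B ++ E).getD t 0) A.length (A.length + B.length) := by
  induction B generalizing A with
  | nil => simp [intervalMax_self]
  | cons b B ih =>
    rw [intervalMax_split _ (m := A.length + 1) (by omega) (by simp), intervalMax_single]
    have := ih (A ++ [b])
    simp only [List.append_assoc, List.singleton_append, List.length_append,
      List.length_singleton] at this
    rw [maxHeight_cons, this]
    simp [Nat.add_assoc, Nat.add_comm 1]

/-- The maxima over adjacent segments of two lists of heights compare in the same way. -/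
def SameHeights (w w' : List ℕ) : Prop :=
  w.length = w'.length ∧ SameComparisons w.length (fun t => w.getD t 0) fun t => w'.getD t 0

namespace SameHeights

theorem symm {w w' : List ℕ} (h : SameHeights w w') : SameHeights w' w :=
  ⟨h.1.symm, fun p m q h1 h2 h3 =>
    have := h.2 p m q h1 h2 (h.1 ▸ h3)
    ⟨this.1.symm, this.2.symm⟩⟩

theorem segments {A B C E A' B' C' E' : List ℕ}
    (h : SameHeights (A ++ B ++ C ++ E) (A' ++ B' ++ C' ++ E')) (hA : A.length = A'.length)
    (hB : B.length = B'.length) (hC : C.length = C'.length) (hB0 : B ≠ []) (hC0 : C ≠ []) :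
    (maxHeight B < maxHeight C ↔ maxHeight B' < maxHeight C') ∧
      (maxHeight C < maxHeight B ↔ maxHeight C' < maxHeight B') := by
  have hB1 := List.length_pos_iff.2 hB0
  have hC1 := List.length_pos_iff.2 hC0
  have := h.2 A.length (A.length + B.length) (A.length + B.length + C.length) (by omega) (by omega)
    (by simp; omega)
  have e1 := maxHeight_eq_intervalMax A B (C ++ E)
  have e2 := maxHeight_eq_intervalMax (A ++ B) C E
  have e3 := maxHeight_eq_intervalMax A' B' (C' ++ E')
  have e4 := maxHeight_eq_intervalMax (A' ++ B') C' E'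
  simp only [List.length_append, ← List.append_assoc] at e1 e2 e3 e4
  rw [hA, hB, hC] at this
  rw [hA, hB] at e1
  rw [hA, hB, hC] at e2
  rwa [← e1, ← e2, ← e3, ← e4] at this

theorem heightRel_eq {a b a' b' : ℕ} (h : a < b ↔ a' < b') (h' : b < a ↔ b' < a') (x : TriOp) :
    heightRel a b x = heightRel a' b' x := by
  cases x <;> simp only [heightRel, decide_eq_decide]
  · exact h'
  · exact h
  · omega

/-- A subtree covers a segment of the list, and its root compares two adjacent segments; the
contexts `A` and `E` allow the induction on subtrees. -/
theorem compat_of_append {A B E A' B' E' : List ℕ} (t : DTree TriOp)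
    (h : SameHeights (A ++ B ++ E) (A' ++ B' ++ E')) (hA : A.length = A'.length)
    (hB : B.length = B'.length) (ht : t.Compat B) : t.Compat B' := by
  induction t generalizing A B E A' B' E' with
  | leaf =>
    obtain ⟨b, rfl⟩ := ht
    exact List.length_eq_one_iff.1 hB.symm
  | node x l r hl hr =>
    obtain ⟨p, q, rfl, h1, h2, h3⟩ := ht
    obtain ⟨p', q', rfl, hp, hq⟩ : ∃ p' q', B' = p' ++ q' ∧ p.length = p'.length ∧
        q.length = q'.length := by
      rw [List.length_append] at hB
      exact ⟨B'.take p.length, B'.drop p.length, by simp, by simp; omega, by simp; omega⟩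
    refine ⟨p', q', rfl, hl (A := A) (E := q ++ E) (A' := A') (E' := q' ++ E') (by simpa using h)
      hA hp h1, hr (A := A ++ p) (E := E) (A' := A' ++ p') (E' := E') (by simpa using h)
      (by simp [hA, hp]) hq h2, ?_⟩
    have hp0 : p ≠ [] := by
      rintro rfl
      have := h1.length
      simp at this
    have hq0 : q ≠ [] := by
      rintro rfl
      have := h2.length
      simp at this
    have := segments (A := A) (E := E) (A' := A') (E' := E') (by simpa using h) hA hp hq hp0 hq0
    rw [← h3]
    exact heightRel_eq this.1.symm this.2.symm x

theorem compat_iff {w w' : List ℕ} (h : SameHeights w w') (t : DTree TriOp) :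
    t.Compat w ↔ t.Compat w' := by
  constructor
  · exact compat_of_append (A := []) (E := []) (A' := []) (E' := []) t (by simpa using h) rfl h.1
  · exact compat_of_append (A := []) (E := []) (A' := []) (E' := []) t (by simpa using h.symm) rfl
      h.1.symm

theorem exists_heightRel (a b : ℕ) : ∃ x, heightRel a b x = true := by
  rcases lt_trichotomy a b with h | h | h
  · exact ⟨right, by simp [heightRel, h]⟩
  · exact ⟨mid, by simp [heightRel, h]⟩
  · exact ⟨left, by simp [heightRel, h]⟩

theorem compat_node_iff (x : TriOp) {l r : DTree TriOp} {p q : List ℕ} (h : p.length = l.nodes + 1) :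
    (DTree.node x l r).Compat (p ++ q) ↔ l.Compat p ∧ r.Compat q ∧
      heightRel (maxHeight p) (maxHeight q) x = true := by
  constructor
  · rintro ⟨p', q', e, h1, h2, h3⟩
    obtain ⟨rfl, rfl⟩ := List.append_inj e (by rw [h, h1.length])
    exact ⟨h1, h2, h3⟩
  · rintro ⟨h1, h2, h3⟩
    exact ⟨p, q, rfl, h1, h2, h3⟩

/-- A tree on a segment extends to a tree on a longer list whose compatibility with any other list
still tests the original tree. This version extends to the left, the next one to the right. -/
theorem exists_compat_append {A B : List ℕ} (t : DTree TriOp) (ht : t.Compat B) :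
    ∃ t' : DTree TriOp, t'.Compat (A ++ B) ∧
      ∀ A' B', A'.length = A.length → B'.length = B.length → t'.Compat (A' ++ B') → t.Compat B' := by
  by_cases hA : A = []
  · subst hA
    refine ⟨t, by simpa using ht, fun A' B' h _ h' => ?_⟩
    rw [List.length_nil, List.length_eq_zero_iff] at h
    subst h
    simpa using h'
  · obtain ⟨s, hs⟩ := Sch.exists_compat A hA
    obtain ⟨x, hx⟩ := exists_heightRel (maxHeight A) (maxHeight B)
    refine ⟨.node x s.tree t, ⟨A, B, rfl, hs, ht, hx⟩, fun A' B' h _ h' => ?_⟩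
    exact ((compat_node_iff x (h.trans hs.length)).1 h').2.1

theorem exists_compat_append' {B E : List ℕ} (t : DTree TriOp) (ht : t.Compat B) :
    ∃ t' : DTree TriOp, t'.Compat (B ++ E) ∧
      ∀ B' E', B'.length = B.length → E'.length = E.length → t'.Compat (B' ++ E') → t.Compat B' := by
  by_cases hE : E = []
  · subst hE
    refine ⟨t, by simpa using ht, fun B' E' _ h h' => ?_⟩
    rw [List.length_nil, List.length_eq_zero_iff] at h
    subst h
    simpa using h'
  · obtain ⟨s, hs⟩ := Sch.exists_compat E hE
    obtain ⟨x, hx⟩ := exists_heightRel (maxHeight B) (maxHeight E)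
    refine ⟨.node x t s.tree, ⟨B, E, rfl, ht, hs, hx⟩, fun B' E' h _ h' => ?_⟩
    exact ((compat_node_iff x (h.trans ht.length)).1 h').1

/-- The trees which are compatible with a list of heights determine the comparisons. -/
theorem of_compat {w w' : List ℕ} (hw : w.length = w'.length)
    (h : ∀ t : DTree TriOp, t.Compat w → t.Compat w') : SameHeights w w' := by
  refine ⟨hw, fun p m q hp hm hq => ?_⟩
  have key : ∀ v : List ℕ, v.length = w.length →
      v.take p ++ (v.drop p).take (m - p) ++ (v.drop m).take (q - m) ++ v.drop q = v ∧
      maxHeight ((v.drop p).take (m - p)) = intervalMax (fun t => v.getD t 0) p m ∧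
      maxHeight ((v.drop m).take (q - m)) = intervalMax (fun t => v.getD t 0) m q := by
    intro v hv
    have e1 : v.take p ++ (v.drop p).take (m - p) = v.take m := by
      rw [← List.take_append_drop p (v.take m), List.take_take, List.drop_take,
        min_eq_left hp.le]
    have e2 : v.take m ++ (v.drop m).take (q - m) = v.take q := by
      rw [← List.take_append_drop m (v.take q), List.take_take, List.drop_take,
        min_eq_left hm.le]
    have e3 : v.take p ++ (v.drop p).take (m - p) ++ v.drop m = v := by
      rw [e1, List.take_append_drop]
    have e4 : v.take m ++ (v.drop m).take (q - m) ++ v.drop q = v := by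
      rw [e2, List.take_append_drop]
    refine ⟨by rw [e1, e4], ?_, ?_⟩
    · rw [maxHeight_eq_intervalMax (v.take p) _ (v.drop m), e3]
      simp only [List.length_take, List.length_drop]
      congr 1 <;> omega
    · rw [maxHeight_eq_intervalMax (v.take m) _ (v.drop q), e4]
      simp only [List.length_take, List.length_drop]
      congr 1 <;> omega
  obtain ⟨k1, k2, k3⟩ := key w rfl
  obtain ⟨k1', k2', k3'⟩ := key w' hw.symm
  rw [← k2, ← k3, ← k2', ← k3']
  -- A test tree is built with a node which compares exactly the two chosen segments; its operation
  -- records the result of the comparison.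
  obtain ⟨s, hs⟩ := Sch.exists_compat ((w.drop p).take (m - p)) (by
    rw [Ne, ← List.length_eq_zero_iff]
    simp
    omega)
  obtain ⟨s', hs'⟩ := Sch.exists_compat ((w.drop m).take (q - m)) (by
    rw [Ne, ← List.length_eq_zero_iff]
    simp
    omega)
  obtain ⟨x, hx⟩ := exists_heightRel (maxHeight ((w.drop p).take (m - p)))
    (maxHeight ((w.drop m).take (q - m)))
  obtain ⟨t, ht, ht'⟩ := exists_compat_append (A := w.take p) (.node x s.tree s'.tree)
    ⟨_, _, rfl, hs, hs', hx⟩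
  obtain ⟨t', ht1, ht1'⟩ := exists_compat_append' (E := w.drop q) t ht
  have h1 := h t' (by rwa [← List.append_assoc, k1] at ht1)
  rw [← k1', List.append_assoc (w'.take p)] at h1
  have h2 := ht1' _ _ (by simp; omega) (by simp; omega) h1
  have h3 := ht' _ _ (by simp; omega) (by simp; omega) h2
  have h4 := ((compat_node_iff x (by rw [← hs.length]; simp; omega)).1 h3).2.2
  cases x <;> simp only [heightRel, decide_eq_true_eq] at hx h4 <;> omega

open SameComparisons

theorem getD_map_dbl {l : List ℕ} {t : ℕ} (ht : t < l.length) :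
    (l.map dbl).getD t 0 = dbl (l.getD t 0) := by
  rw [List.getD_eq_getElem _ _ ht, List.getD_eq_getElem _ _ (by simpa using ht)]
  simp

theorem map_dbl (w : List ℕ) : SameHeights (w.map dbl) w :=
  ⟨by simp, SameComparisons.dbl_left fun t ht => getD_map_dbl (by simpa using ht)⟩

theorem append_cons_of_lt {p r : List ℕ} {e e' : ℕ} (hp : ∀ a ∈ p.getLast?, e < a ∧ e' < a)
    (hr : ∀ a ∈ r.head?, e < a ∧ e' < a) : SameHeights (p ++ e :: r) (p ++ e' :: r) := by
  refine ⟨by simp, SameComparisons.of_valley (k := p.length) (fun t _ ht => ?_) (fun h => ?_)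
    fun t ht => ?_⟩
  · simp only [quadraticOperad.Coloring.getD_append_cons, if_neg ht]
  · obtain _ | ⟨a, r⟩ := r
    · simp at h
    · simpa [quadraticOperad.Coloring.getD_append_cons] using hr a rfl
  · have ht' : t < p.length := by omega
    have h1 := hp (p.getD t 0) (by
      rw [List.getLast?_eq_getElem?, ← ht]
      simp [ht'])
    simpa only [quadraticOperad.Coloring.getD_append_cons, if_pos ht', lt_irrefl, if_false,
      if_true] using h1

theorem head_iff {p r p' r' : List ℕ} {a b a' b' : ℕ}
    (h : SameHeights (p ++ a :: b :: r) (p' ++ a' :: b' :: r')) (hp : p.length = p'.length) :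
    (a < b ↔ a' < b') ∧ (b < a ↔ b' < a') := by
  simpa using segments (A := p) (B := [a]) (C := [b]) (E := r) (A' := p') (B' := [a']) (C' := [b'])
    (E' := r') (by simpa using h) hp rfl rfl (by simp) (by simp)

theorem inflation_append {p l : List ℕ} {j u v : ℕ} (h : max u v = dbl j) :
    Inflation (p ++ j :: l).length p.length (fun t => (p ++ j :: l).getD t 0)
      fun t => (p.map dbl ++ u :: v :: l.map dbl).getD t 0 := by
  refine ⟨by simp, fun t ht => ?_, fun t ht ht' => ?_, ?_⟩
  · simp only [quadraticOperad.Coloring.getD_append_cons, List.length_map, if_pos ht]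
    exact getD_map_dbl ht
  · obtain ⟨t, rfl⟩ : ∃ s, t = p.length + 1 + s := ⟨t - (p.length + 1), by omega⟩
    simp only [List.length_append, List.length_cons] at ht'
    simp only [quadraticOperad.Coloring.getD_append_cons, List.length_map]
    rw [if_neg (by omega), if_neg (by omega), if_neg (by omega), if_neg (by omega),
      show p.length + 1 + t + 1 - p.length - 1 = t + 1 by omega,
      show p.length + 1 + t - p.length - 1 = t by omega, List.getD_cons_succ]
    exact getD_map_dbl (by omega)
  · simp [h]

theorem inflation {p l p' l' : List ℕ} {j j' u v u' v' : ℕ}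
    (h : SameHeights (p ++ j :: l) (p' ++ j' :: l')) (hp : p.length = p'.length)
    (H : (u = 2 * j ∧ v = dbl j ∧ u' = 2 * j' ∧ v' = dbl j') ∨
      (u = dbl j ∧ v = dbl j ∧ u' = dbl j' ∧ v' = dbl j') ∨
      (u = dbl j ∧ v = 2 * j ∧ u' = dbl j' ∧ v' = 2 * j')) :
    SameHeights (p.map dbl ++ u :: v :: l.map dbl) (p'.map dbl ++ u' :: v' :: l'.map dbl) := by
  have h1 : max u v = dbl j := by
    simp only [dbl] at H ⊢
    omega
  have h2 : max u' v' = dbl j' := by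
    simp only [dbl] at H ⊢
    omega
  have h3 := h.1
  simp only [List.length_append, List.length_cons] at h3
  have h4 := inflation_append (p := p') (l := l') h2
  rw [← h.1, ← hp] at h4
  have := SameComparisons.inflation h.2 (inflation_append (p := p) (l := l) h1) h4
    (by simpa [quadraticOperad.Coloring.getD_append_cons, hp] using H)
  refine ⟨by simp; omega, ?_⟩
  convert this using 1
  simp
  omega

theorem raise {p r p' r' : List ℕ} {b c e e' : ℕ}
    (h : SameHeights (p ++ (2 * b + 1) :: e :: r) (p' ++ (2 * c + 1) :: e' :: r'))
    (hp : p.length = p'.length) (he : e ≤ 2 * b) (he' : e' ≤ 2 * c) (hr : 2 * b ∉ r)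
    (hr' : 2 * c ∉ r') :
    SameHeights (p ++ (2 * b + 1) :: (2 * b) :: r) (p' ++ (2 * c + 1) :: (2 * c) :: r') := by
  have h3 := h.1
  simp only [List.length_append, List.length_cons] at h3
  have hd : ∀ (p r : List ℕ) (x y z t : ℕ), t ≠ p.length + 1 →
      (p ++ x :: y :: r).getD t 0 = (p ++ x :: z :: r).getD t 0 := by
    intro p r x y z t ht
    simp only [quadraticOperad.Coloring.getD_append_cons]
    split_ifs with h1 h2
    · rfl
    · rfl
    · obtain ⟨s, hs⟩ : ∃ s, t - p.length - 1 = s + 1 := ⟨t - p.length - 2, by omega⟩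
      rw [hs, List.getD_cons_succ, List.getD_cons_succ]
  have hn : ∀ (p r : List ℕ) (x y z t : ℕ), z ∉ r → p.length + 1 < t →
      t < (p ++ x :: y :: r).length → (p ++ x :: y :: r).getD t 0 ≠ z := by
    intro p r x y z t hz ht ht' e
    simp only [List.length_append, List.length_cons] at ht'
    obtain ⟨s, rfl⟩ : ∃ s, t = p.length + 2 + s := ⟨t - (p.length + 2), by omega⟩
    rw [quadraticOperad.Coloring.getD_append_cons, if_neg (by omega), if_neg (by omega),
      show p.length + 2 + s - p.length - 1 = s + 1 by omega, List.getD_cons_succ,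
      List.getD_eq_getElem _ _ (by omega)] at e
    exact hz (e ▸ List.getElem_mem _)
  have h0 : ∀ (p r : List ℕ) (x y : ℕ), (p ++ x :: y :: r).getD p.length 0 = x ∧
      (p ++ x :: y :: r).getD (p.length + 1) 0 = y := by
    intro p r x y
    simp
  refine ⟨by simp; omega, ?_⟩
  have := SameComparisons.raise (k := p.length) (b := b) (c := c) h.2 (by simp)
    (fun t _ ht => hd p r (2 * b + 1) (2 * b) e t ht)
    (fun t _ ht => hd p' r' (2 * c + 1) (2 * c) e' t (by omega))
    (h0 p r _ _).1 (by rw [hp]; exact (h0 p' r' _ _).1) (h0 p r _ _).2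
    (by rw [hp]; exact (h0 p' r' _ _).2) ((h0 p r _ _).2.trans_le he)
    (by rw [hp]; exact (h0 p' r' _ _).2.trans_le he')
    (fun t h1 h2 => hn p r _ _ _ t hr h1 h2)
    (fun t h1 h2 => hn p' r' _ _ _ t hr' (by omega) (by rw [← h.1]; exact h2))
  simpa using this

end SameHeights

namespace quadraticOperad

open BarComplex

variable {K : Type u} [Field K]

/-! ### The Koszul complex of associative trialgebras -/

/-- The operation given by the comparison of two heights. -/
def heightOp (a b : ℕ) : TriOp := if a < b then right else if b < a then left else mid

theorem heightRel_iff (a b : ℕ) (x : TriOp) : heightRel a b x = true ↔ heightOp a b = x := by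
  unfold heightOp
  split_ifs <;> cases x <;> simp [heightRel] <;> omega

theorem colOp_heightRel (R : Submodule K ((freeOperad K TriOp).Op 2)) (a b : ℕ) :
    colOp heightRel R a b = op R (heightOp a b) := by
  classical
  simp [colOp, heightRel_iff]

/-- Both bracketings mark exactly the leaves of greatest height among the three. This gives
associativity of the coloured product. -/
theorem dots_heightOp (a b c : ℕ) :
    (DTree.node (heightOp (max a b) c) (.node (heightOp a b) .leaf .leaf) .leaf).dots =
      (DTree.node (heightOp a (max b c)) .leaf (.node (heightOp b c) .leaf .leaf)).dots := by
  have e : ∀ {a b x}, heightRel a b x = true → heightOp a b = x := (heightRel_iff _ _ _).1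
  rcases lt_trichotomy a b with h | h | h <;> rcases lt_trichotomy b c with h' | h' | h' <;>
  rcases lt_trichotomy a c with h'' | h'' | h'' <;>
  first
  | (exfalso; omega)
  | simp [heightOp, DTree.dots, h, h', h'', h.not_gt, h'.not_gt, h''.not_gt, h.le, h'.le]

theorem heightWeight_eq_zero {w : List ℕ} (hw : w.length = 0) (t : DTree TriOp) :
    heightWeight K w t = 0 := by
  refine if_neg fun h => ?_
  have := h.length
  omega

theorem isDual_heightWeight {R : Submodule K ((freeOperad K TriOp).Op 2)}
    (hR : R = dendriformRelations K) {w : List ℕ} {s : Sch} (h : s.tree.Compat w) :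
    (dendBasis hR).IsDual s (heightWeight K w) := by
  classical
  refine ⟨?_, fun t ht => ?_⟩
  · exact (heightWeight_tree h s).trans (if_pos rfl)
  · exact (heightWeight_tree h t).trans (if_neg ht)

/-- The presentation of the operad of associative trialgebras with linear forms on the dual operad
given by lists of heights. -/
noncomputable def triasColoring (K : Type u) [Field K] :
    Coloring (triasRelations K) ℕ {a : List Bool // true ∈ a} Sch where
  basis := triasBasis K
  dual := dendBasis dualRelations_dualRelations
  rel := heightRel
  weight := heightWeight K
  isWeight w := dualRelations_dualRelations (K := K) ▸ isWeight_heightWeight w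
  weight_graft t x p r c c' h := by
    classical
    simp only [heightWeight, t.compat_graft_corolla x p r c c' h]
    split_ifs <;> simp_all
  weight_eq w := by
    by_cases hw : w = []
    · exact Or.inl fun j => heightWeight_eq_zero (by simp [hw]) _
    · obtain ⟨s, hs⟩ := Sch.exists_compat w hw
      exact Or.inr ⟨s, hs.length, isDual_heightWeight _ hs⟩
  exists_list s := ⟨s.word, s.compat_word.length, isDual_heightWeight _ s.compat_word⟩
  assoc a b c x y z := by
    simp only [colOp_heightRel]
    exact op_op_eq_of_dots (dots_heightOp a b c) x y z
  leaf := ⟨[true], by simp⟩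
  tree_leaf := by simp [triasBasis, dotTree]
  weight_leaf x l r := by
    refine if_neg fun h => ?_
    have h1 := congrArg List.length h
    rw [DTree.length_dots, DTree.nodes] at h1
    simp at h1

/-- The letters of the bar complex of associative trialgebras. -/
abbrev TLetter : Type := ℕ × {a : List Bool // true ∈ a}

/-- The product of two letters. -/
def TLetter.mul (y z : TLetter) : TLetter :=
  (max y.1 z.1, ⟨(if z.1 ≤ y.1 then y.2.1 else y.2.1.map fun _ => false) ++
    if y.1 ≤ z.1 then z.2.1 else z.2.1.map fun _ => false, by
      rcases le_total y.1 z.1 with h | h <;> simp [h, y.2.2, z.2.2]⟩)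

/-- The product of two letters is a single letter, so the bar complex here is that of a semigroup
algebra. -/
theorem triasColoring_prod (y z : TLetter) : (triasColoring K).prod y z = word K (y.mul z) := by
  have h : colOp heightRel (triasRelations K) y.1 z.1 ((triasColoring K).value y)
      ((triasColoring K).value z) = (triasColoring K).basis.algBasis (y.mul z).2 := by
    rw [colOp_heightRel, Coloring.value, Coloring.value, TreeBasis.algBasis_apply,
      TreeBasis.algBasis_apply, TreeBasis.algBasis_apply, op_mon]
    refine mon_eq_of_dots ?_
    change _ = (dotTree (y.mul z).2.1).dots
    have e1 : ((triasColoring K).basis.tree y.2).dots = y.2.1 := dots_dotTree _ y.2.2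
    have e2 : ((triasColoring K).basis.tree z.2).dots = z.2.1 := dots_dotTree _ z.2.2
    rw [dots_dotTree _ (y.mul z).2.2]
    rcases lt_trichotomy y.1 z.1 with h | h | h <;>
      simp [heightOp, DTree.dots, TLetter.mul, e1, e2, h, h.not_gt, h.le]
  refine (congrArg (fun v => Finsupp.lmapDomain K K (Prod.mk (max y.1 z.1))
    ((triasColoring K).basis.algBasis.repr v)) h).trans ?_
  simp [TLetter.mul]

theorem IsWeight.form_congr {X : Type} {R : Submodule K ((freeOperad K X).Op 2)}
    {χ χ' : DTree X → K} (h : IsWeight R χ) (h' : IsWeight R χ') (e : χ = χ') (n : ℕ) :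
    h.form n = h'.form n := by
  subst e
  rfl

theorem heightWeight_congr {w w' : List ℕ} (h : SameHeights w w') :
    heightWeight K w = heightWeight K w' := by
  classical
  funext t
  simp only [heightWeight, h.compat_iff t]

theorem triasColoring_toChain_congr {l l' : List TLetter}
    (h : SameHeights (l.map Prod.fst) (l'.map Prod.fst))
    (h' : l.map Prod.snd = l'.map Prod.snd) (k : ℕ) :
    (triasColoring K).toChain k (word K l) = (triasColoring K).toChain k (word K l') := by
  have h1 : l.length = l'.length := by simpa using h.1
  have h2 : l.map (triasColoring K).value = l'.map (triasColoring K).value := by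
    have := congrArg (List.map (triasColoring K).basis.algBasis) h'
    rwa [List.map_map, List.map_map] at this
  rw [Coloring.toChain_single, Coloring.toChain_single, h1, h2]
  split_ifs
  · rw [Coloring.chain, Coloring.chain]
    congr 1
    exact IsWeight.form_congr _ _ (heightWeight_congr h) k
  · rfl

/-- Equal images come from the same vector of the dual basis, so the same trees are compatible with
both lists of heights, and `SameHeights.of_compat` applies. Conversely `triasColoring_toChain_congr`
holds, so equality in the Koszul complex is fully understood. -/
theorem triasColoring_sameHeights {k : ℕ} {l l' : List TLetter} (hl : l.length = k + 1)
    (hl' : l'.length = k + 1)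
    (h : (triasColoring K).toChain k (word K l) = (triasColoring K).toChain k (word K l')) :
    SameHeights (l.map Prod.fst) (l'.map Prod.fst) ∧ l.map Prod.snd = l'.map Prod.snd := by
  have hne : ∀ {l : List TLetter}, l.length = k + 1 → l.map Prod.fst ≠ [] := by
    rintro l hl h
    rw [List.map_eq_nil_iff] at h
    simp [h] at hl
  obtain ⟨s, hs⟩ := Sch.exists_compat _ (hne hl)
  obtain ⟨s', hs'⟩ := Sch.exists_compat _ (hne hl')
  have hn : ∀ {l : List TLetter} {s : Sch}, l.length = k + 1 → s.tree.Compat (l.map Prod.fst) →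
      s.tree.nodes = k := by
    intro l s hl h
    have := h.length
    rw [List.length_map] at this
    omega
  have d1 := isDual_heightWeight (K := K) dualRelations_dualRelations hs
  have d2 := isDual_heightWeight (K := K) dualRelations_dualRelations hs'
  obtain ⟨rfl, h2⟩ := (triasColoring K).eq_of_toChain_eq hl hl' (hn hl hs) (hn hl' hs') d1 d2 h
  refine ⟨SameHeights.of_compat (by simp [hl, hl']) fun t ht => ?_, h2⟩
  have e1 := d1.form_eq ((triasColoring K).isWeight _) (hn hl hs)
  have e2 := d2.form_eq ((triasColoring K).isWeight _) (hn hl hs)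
  have ht' : t.nodes = k := by
    have := ht.length
    rw [List.length_map] at this
    omega
  have e3 := LinearMap.congr_fun (e1.trans e2.symm) (tree _ t ht')
  replace e3 := (IsWeight.form_tree _ t ht').symm.trans (e3.trans (IsWeight.form_tree _ t ht'))
  by_contra hc
  change heightWeight K _ t = heightWeight K _ t at e3
  rw [heightWeight, heightWeight, if_pos ht, if_neg hc] at e3
  exact one_ne_zero e3

end quadraticOperad

/-! ### Letters of the trialgebra bar complex: doubling and splitting -/

namespace quadraticOperad

open BarComplex

variable {K : Type u} [Field K]

namespace TLetter

/-- The block with a single leaf. -/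
def point : {a : List Bool // true ∈ a} := ⟨[true], by simp⟩

/-- Doubling of the height of a letter. -/
def dbl (y : TLetter) : TLetter := (SameComparisons.dbl y.1, y.2)

/-- The first letter of the inflation of a letter. -/
def fst (y : TLetter) : TLetter :=
  (if y.2.1.head? = some true then SameComparisons.dbl y.1 else 2 * y.1, point)

/-- The second letter of the inflation of a letter. -/
def snd (y : TLetter) : TLetter :=
  if h : true ∈ y.2.1.tail then (SameComparisons.dbl y.1, ⟨y.2.1.tail, h⟩)
  else (2 * y.1, ⟨true :: y.2.1.tail.tail, by simp⟩)

theorem ext_iff' {y z : TLetter} : y = z ↔ y.1 = z.1 ∧ y.2.1 = z.2.1 := by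
  rw [Prod.ext_iff, Subtype.ext_iff]

/-- Either the rest of the block has a mark, and then it keeps the full height while the first leaf
gets it only if marked; or the first leaf is the only mark, and the rest goes to the lower height `2
* i`. In that case its marks do not matter for `fst_mul_snd`, and its first leaf is marked by
convention. -/
theorem fst_snd_cases {y : TLetter} (h : y.2.1.tail ≠ []) :
    (∃ (i : ℕ) (a : Bool) (c : List Bool) (hc : true ∈ c), y = (i, ⟨a :: c, by simp [hc]⟩) ∧
      y.fst = (if a then SameComparisons.dbl i else 2 * i, point) ∧
      y.snd = (SameComparisons.dbl i, ⟨c, hc⟩)) ∨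
    ∃ i n : ℕ, y = (i, ⟨true :: false :: List.replicate n false, by simp⟩) ∧
      y.fst = (SameComparisons.dbl i, point) ∧
      y.snd = (2 * i, ⟨true :: List.replicate n false, by simp⟩) := by
  obtain ⟨i, ⟨_ | ⟨a, c⟩, ha⟩⟩ := y
  · simp at ha
  by_cases hc : true ∈ c
  · exact Or.inl ⟨i, a, c, hc, rfl, by simp [fst], by simp [snd, hc]⟩
  · right
    obtain rfl : true = a := by simpa [hc] using ha
    obtain _ | ⟨b, c⟩ := c
    · simp at h
    obtain ⟨rfl, e⟩ : b = false ∧ c = List.replicate c.length false := by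
      rw [List.eq_replicate_iff]
      simp only [List.mem_cons, not_or] at hc
      exact ⟨by simpa using hc.1, rfl, fun x hx => by
        cases x
        · rfl
        · exact absurd hx hc.2⟩
    refine ⟨i, c.length, ?_, by simp [fst], ?_⟩
    · rw [ext_iff']
      exact ⟨rfl, congrArg (fun c => true :: false :: c) e⟩
    · refine (dif_neg hc).trans ?_
      rw [ext_iff']
      exact ⟨rfl, congrArg (fun c => true :: c) e⟩

theorem mul_of_lt {y z : TLetter} (h : y.1 < z.1) :
    y.mul z = (z.1, ⟨(y.2.1.map fun _ => false) ++ z.2.1, by simp [z.2.2]⟩) := by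
  rw [ext_iff']
  simp only [mul, if_neg h.not_ge, if_pos h.le]
  exact ⟨max_eq_right h.le, trivial⟩

theorem mul_of_gt {y z : TLetter} (h : z.1 < y.1) :
    y.mul z = (y.1, ⟨y.2.1 ++ z.2.1.map fun _ => false, by simp [y.2.2]⟩) := by
  rw [ext_iff']
  simp only [mul, if_neg h.not_ge, if_pos h.le]
  exact ⟨max_eq_left h.le, trivial⟩

theorem mul_of_eq {y z : TLetter} (h : y.1 = z.1) :
    y.mul z = (z.1, ⟨y.2.1 ++ z.2.1, by simp [z.2.2]⟩) := by
  rw [ext_iff']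
  simp only [mul, if_pos h.le, if_pos h.ge]
  exact ⟨max_eq_right h.le, trivial⟩

theorem snd_of_mem {i : ℕ} {a : {a : List Bool // true ∈ a}} (h : true ∈ a.1.tail) :
    snd (i, a) = (SameComparisons.dbl i, ⟨a.1.tail, h⟩) := dif_pos h

theorem snd_of_not_mem {i : ℕ} {a : {a : List Bool // true ∈ a}} (h : true ∉ a.1.tail) :
    snd (i, a) = (2 * i, ⟨true :: a.1.tail.tail, by simp⟩) := dif_neg h

theorem dbl_mul (y z : TLetter) : (y.mul z).dbl = y.dbl.mul z.dbl := by
  rcases lt_trichotomy y.1 z.1 with h | h | h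
  · have h' : y.dbl.1 < z.dbl.1 := by
      simp only [dbl, SameComparisons.dbl]
      omega
    rw [mul_of_lt h, mul_of_lt h']
    rfl
  · have h' : y.dbl.1 = z.dbl.1 := by
      simp only [dbl, SameComparisons.dbl]
      omega
    rw [mul_of_eq h, mul_of_eq h']
    rfl
  · have h' : z.dbl.1 < y.dbl.1 := by
      simp only [dbl, SameComparisons.dbl]
      omega
    rw [mul_of_gt h, mul_of_gt h']
    rfl

theorem tail_mul_ne (y z : TLetter) : (y.mul z).2.1.tail ≠ [] := by
  have h1 := List.length_pos_of_mem y.2.2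
  have h2 := List.length_pos_of_mem z.2.2
  rw [Ne, ← List.length_eq_zero_iff]
  simp only [mul, List.length_tail, List.length_append]
  split_ifs <;> (try simp only [List.length_map]) <;> omega

theorem eq_point {y : TLetter} (h : y.2.1.tail = []) : y.2 = point := by
  obtain ⟨i, ⟨_ | ⟨a, _ | ⟨b, c⟩⟩, ha⟩⟩ := y
  · simp at ha
  · rw [Subtype.ext_iff]
    simpa [point, eq_comm] using ha
  · simp at h

theorem fst_mul_snd {y : TLetter} (h : y.2.1.tail ≠ []) : y.fst.mul y.snd = y.dbl := by
  obtain ⟨i, a, c, hc, rfl, e1, e2⟩ | ⟨i, n, rfl, e1, e2⟩ := fst_snd_cases h <;>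
    rw [e1, e2, ext_iff']
  · cases a <;> simp [mul, dbl, point, SameComparisons.dbl]
  · simp [mul, dbl, point, SameComparisons.dbl]

/-- Splitting off the first leaf commutes with multiplication on the right. This uses that `2 * i`
lies strictly between the doubled heights of `i - 1` and of `i`, so the lower rest compares
correctly with every doubled letter. -/
theorem snd_mul {y : TLetter} (h : y.2.1.tail ≠ []) (z : TLetter) :
    (y.mul z).snd = y.snd.mul z.dbl := by
  obtain ⟨i, a, c, hc, rfl, e1, e2⟩ | ⟨i, n, rfl, e1, e2⟩ := fst_snd_cases h <;>
    rw [e2] <;> rcases lt_trichotomy i z.1 with h | h | h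
  · rw [mul_of_lt h, mul_of_lt (by simp only [dbl, SameComparisons.dbl]; omega),
      snd_of_mem (by simp [z.2.2])]
    rfl
  · rw [mul_of_eq h, mul_of_eq (by simp only [dbl, SameComparisons.dbl]; omega),
      snd_of_mem (by simp [z.2.2])]
    rfl
  · rw [mul_of_gt h, mul_of_gt (by simp only [dbl, SameComparisons.dbl]; omega),
      snd_of_mem (by simp [hc])]
    rfl
  · rw [mul_of_lt h, mul_of_lt (by simp only [dbl, SameComparisons.dbl]; omega),
      snd_of_mem (by simp [z.2.2]), ext_iff']
    simp [dbl]
  · rw [mul_of_eq h, mul_of_lt (by simp only [dbl, SameComparisons.dbl]; omega),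
      snd_of_mem (by simp [z.2.2]), ext_iff']
    simp [dbl]
  · rw [mul_of_gt h, mul_of_gt (by simp only [dbl, SameComparisons.dbl]; omega),
      snd_of_not_mem (by simp), ext_iff']
    simp [dbl]

theorem fst_mul_of_le {y z : TLetter} (h : z.1 ≤ y.1) : (y.mul z).fst = y.fst := by
  obtain ⟨i, ⟨_ | ⟨a, c⟩, ha⟩⟩ := y
  · simp at ha
  · have h' : z.1 ≤ i := h
    simp [fst, mul, h']

/-- A higher right factor erases the marks of `y`, so the first leaf is placed just below the height
of `z`, instead of its height in `y.fst`. This change of height is the source of the terms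
`IsSmall`. -/
theorem fst_mul_of_lt {y z : TLetter} (h : y.1 < z.1) : (y.mul z).fst = (2 * z.1, point) := by
  obtain ⟨i, ⟨_ | ⟨a, c⟩, ha⟩⟩ := y
  · simp at ha
  · have h' : i < z.1 := h
    simp [fst, mul, h'.not_ge, h'.le]

theorem snd_mul_of_lt {y z : TLetter} (h : y.2.1.tail = []) (h' : y.1 < z.1) :
    (y.mul z).snd = z.dbl := by
  obtain ⟨i, a⟩ := y
  obtain rfl : a = point := eq_point h
  have h' : i < z.1 := h'
  rw [ext_iff']
  simp [snd, mul, h'.not_ge, h'.le, point, dbl, z.2.2]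

/-- Raising the first letter of a list, if it is low, to the height just below a given height. -/
def raise (b : ℕ) : List TLetter → List TLetter
  | [] => []
  | y :: l => if y.1 ≤ 2 * b then
      (2 * b, ⟨true :: y.2.1.tail.map fun _ => false, by simp⟩) :: l else y :: l

/-- This is where `raise` comes from: after a single leaf at least as high as `z`, splitting the
product does not give back the doubled letter `z` but its raised form. -/
theorem snd_mul_of_le {y z : TLetter} (h : y.2.1.tail = []) (h' : z.1 ≤ y.1) (l : List TLetter) :
    (y.mul z).snd :: l = raise y.1 (z.dbl :: l) := by
  obtain ⟨i, a⟩ := y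
  obtain rfl : a = point := eq_point h
  obtain ⟨j, ⟨_ | ⟨a, c⟩, ha⟩⟩ := z
  · simp at ha
  have h' : j ≤ i := h'
  rcases h'.lt_or_eq with h' | rfl
  · have : SameComparisons.dbl j ≤ 2 * i := by
      simp only [SameComparisons.dbl]
      omega
    refine Eq.trans ?_ (if_pos this).symm
    congr 1
    rw [ext_iff']
    simp [snd, mul, h'.not_ge, h'.le, point, dbl]
  · have : ¬ SameComparisons.dbl j ≤ 2 * j := by
      simp only [SameComparisons.dbl]
      omega
    refine Eq.trans ?_ (if_neg this).symm
    congr 1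
    rw [ext_iff']
    rw [mul_of_eq (y := (j, point)) (z := (j, ⟨a :: c, ha⟩)) rfl, snd_of_mem (by simpa [point] using ha)]
    simp [point, dbl]

end TLetter

end quadraticOperad

/-! ### Raising and the homotopy on words -/

namespace quadraticOperad

open BarComplex

variable {K : Type u} [Field K]

namespace TLetter

/-- The product of letters as a linear combination. -/
noncomputable abbrev prod (K : Type u) [Field K] (y z : TLetter) : TLetter →₀ K := word K (y.mul z)

theorem triasColoring_prod_eq : (triasColoring K).prod = prod K :=
  funext fun y => funext fun z => triasColoring_prod y z

theorem headMul_word_cons (y z : TLetter) (l : List TLetter) :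
    headMul (prod K) (word K y) (word K (z :: l)) = word K (y.mul z :: l) := by
  rw [word_cons, headMul_cons, mul_single, cons_single]

/-- Doubling of the heights of lists. -/
noncomputable def dblLin : (List TLetter →₀ K) →ₗ[K] (List TLetter →₀ K) :=
  Finsupp.lmapDomain K K (List.map dbl)

@[simp] theorem dblLin_single (l : List TLetter) :
    dblLin (Finsupp.single l (1 : K)) = word K (l.map dbl) := by
  simp [dblLin]

theorem barList_map_dbl (l : List TLetter) :
    barList (prod K) (l.map dbl) = dblLin (barList (prod K) l) := by
  induction l with
  | nil => simp
  | cons y l ih =>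
    have h1 : ∀ v : List TLetter →₀ K,
        dblLin (cons (word K y) v) = cons (word K y.dbl) (dblLin v) := by
      intro v
      suffices dblLin ∘ₗ cons (word K y) = cons (word K y.dbl) ∘ₗ dblLin (K := K) from
        LinearMap.congr_fun this v
      refine Finsupp.lhom_ext' fun l => LinearMap.ext_ring ?_
      simp
    rw [List.map_cons, barList, barList, map_sub, h1, ih]
    congr 1
    obtain _ | ⟨z, l⟩ := l
    · simp
    · rw [List.map_cons, headMul_word_cons, headMul_word_cons, dblLin_single, List.map_cons, dbl_mul]

/-- The linear extension of `raise`. -/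
noncomputable def raiseLin (b : ℕ) : (List TLetter →₀ K) →ₗ[K] (List TLetter →₀ K) :=
  Finsupp.lmapDomain K K (raise b)

@[simp] theorem raiseLin_single (b : ℕ) (l : List TLetter) :
    raiseLin b (Finsupp.single l (1 : K)) = word K (raise b l) := by
  simp [raiseLin]

theorem raise_of_le {b : ℕ} {y : TLetter} (h : y.1 ≤ 2 * b) (l : List TLetter) :
    raise b (y :: l) = (2 * b, ⟨true :: y.2.1.tail.map fun _ => false, by simp⟩) :: l := if_pos h

theorem raise_of_lt {b : ℕ} {y : TLetter} (h : 2 * b < y.1) (l : List TLetter) :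
    raise b (y :: l) = y :: l := if_neg h.not_ge

/-- A letter of height `2 * b + 1` erases the marks of a following letter of height at most `2 * b`,
so it does not see whether that letter was raised. -/
theorem headMul_raiseLin {y : TLetter} {b : ℕ} (h : y.1 = 2 * b + 1) (v : List TLetter →₀ K) :
    headMul (prod K) (word K y) (raiseLin b v) = headMul (prod K) (word K y) v := by
  suffices headMul (prod K) (word K y) ∘ₗ raiseLin b = headMul (prod K) (word K y) from
    LinearMap.congr_fun this v
  refine Finsupp.lhom_ext' fun l => LinearMap.ext_ring ?_
  simp only [LinearMap.comp_apply, Finsupp.lsingle_apply, raiseLin_single]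
  obtain _ | ⟨z, l⟩ := l
  · rfl
  by_cases hz : z.1 ≤ 2 * b
  · rw [raise_of_le hz, headMul_word_cons, headMul_word_cons, mul_of_gt (by simp; omega),
      mul_of_gt (by omega)]
    congr 4
    obtain ⟨_, ⟨_ | ⟨a, c⟩, ha⟩⟩ := z
    · simp at ha
    · simp
  · rw [raise_of_lt (by omega)]

/-- The heights of the letters after the first one are odd, or lower than the first height. -/
def Odds : List TLetter → Prop
  | [] => True
  | y :: l => ∀ z ∈ l, Odd z.1 ∨ z.1 < y.1

/-- The span of the lists which satisfy `Odds`. -/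
noncomputable abbrev oddsSpan (K : Type u) [Field K] : Submodule K (List TLetter →₀ K) :=
  Submodule.span K {v | ∃ l, Odds l ∧ v = word K l}

theorem Odds.ne {b : ℕ} {y : TLetter} {l : List TLetter} (h : Odds (y :: l)) (hy : y.1 ≤ 2 * b) :
    ∀ z ∈ l, z.1 ≠ 2 * b := by
  rintro z hz e
  rcases h z hz with ⟨m, hm⟩ | h <;> omega

/-- Raising the head preserves the results of its comparisons after multiplication, except with a
letter of height exactly `2 * b`: there the marks of both factors would be kept. `Odds` excludes
such a letter. -/
theorem bar_raiseLin (b : ℕ) {v : List TLetter →₀ K} (hv : v ∈ oddsSpan K) :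
    bar (prod K) (raiseLin b v) = raiseLin b (bar (prod K) v) := by
  suffices oddsSpan K ≤ LinearMap.eqLocus (bar (prod K) ∘ₗ raiseLin b)
    (raiseLin b ∘ₗ bar (prod K)) from this hv
  refine Submodule.span_le.2 ?_
  rintro _ ⟨l, hl, rfl⟩
  simp only [SetLike.mem_coe, LinearMap.mem_eqLocus, LinearMap.comp_apply, raiseLin_single,
    bar_single]
  obtain _ | ⟨y, l⟩ := l
  · simp [raise]
  by_cases hy : y.1 ≤ 2 * b
  · have h1 : ∀ v : List TLetter →₀ K, raiseLin b (cons (word K y) v) =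
        cons (word K (2 * b, ⟨true :: y.2.1.tail.map fun _ => false, by simp⟩)) v := by
      intro v
      suffices raiseLin b ∘ₗ cons (word K y) = cons (K := K)
          (word K ((2 * b, ⟨true :: y.2.1.tail.map fun _ => false, by simp⟩) : TLetter)) from
        LinearMap.congr_fun this v
      refine Finsupp.lhom_ext' fun l => LinearMap.ext_ring ?_
      simp [raise_of_le hy]
    rw [raise_of_le hy, barList, barList, map_sub, h1]
    congr 1
    obtain _ | ⟨z, l⟩ := l
    · simp
    have hz := hl.ne hy z (by simp)
    rw [headMul_word_cons, headMul_word_cons, raiseLin_single]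
    congr 1
    obtain ⟨i, ⟨_ | ⟨a, c⟩, ha⟩⟩ := y
    · simp at ha
    have hy : i ≤ 2 * b := hy
    rcases lt_or_gt_of_ne hz with hz | hz
    · rw [raise_of_le (by simp only [mul]; omega), mul_of_gt hz]
      rcases lt_trichotomy i z.1 with h | h | h
      · rw [mul_of_lt h]
        simp
      · rw [mul_of_eq h]
        simp
      · rw [mul_of_gt h]
        simp
    · rw [raise_of_lt (by simp only [mul]; omega), mul_of_lt (z := z) hz,
        mul_of_lt (y := (i, _)) (lt_of_le_of_lt hy hz)]
      simp
  · have h1 : ∀ v : List TLetter →₀ K, raiseLin b (cons (word K y) v) = cons (word K y) v := by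
      intro v
      suffices raiseLin b ∘ₗ cons (word K y) = cons (K := K) (word K y) from
        LinearMap.congr_fun this v
      refine Finsupp.lhom_ext' fun l => LinearMap.ext_ring ?_
      simp [raise_of_lt (not_le.1 hy)]
    rw [raise_of_lt (not_le.1 hy), barList, map_sub, h1]
    congr 1
    obtain _ | ⟨z, l⟩ := l
    · simp
    · rw [headMul_word_cons, raiseLin_single, raise_of_lt (by simp only [mul]; omega)]

/-- The difference of the identity and of `raiseLin`. -/
noncomputable def subRaise (b : ℕ) : (List TLetter →₀ K) →ₗ[K] (List TLetter →₀ K) :=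
  LinearMap.id - raiseLin b

theorem subRaise_apply (b : ℕ) (v : List TLetter →₀ K) : subRaise b v = v - raiseLin b v := rfl

/-- The contracting homotopy of the bar complex of associative trialgebras. -/
noncomputable def homotopyMap (K : Type u) [Field K] : List TLetter → (List TLetter →₀ K)
  | [] => 0
  | y :: l => if y.2.1.tail = [] then -cons (word K y.dbl) (subRaise y.1 (homotopyMap K l))
    else word K (y.fst :: y.snd :: l.map dbl)

/-- The linear extension of `homotopyMap`. -/
noncomputable abbrev homotopyLin (K : Type u) [Field K] :
    (List TLetter →₀ K) →ₗ[K] (List TLetter →₀ K) :=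
  Finsupp.linearCombination K (homotopyMap K)

theorem homotopyMap_of_eq {y : TLetter} (h : y.2.1.tail = []) (l : List TLetter) :
    homotopyMap K (y :: l) = -cons (word K y.dbl) (subRaise y.1 (homotopyMap K l)) := if_pos h

theorem homotopyMap_of_ne {y : TLetter} (h : y.2.1.tail ≠ []) (l : List TLetter) :
    homotopyMap K (y :: l) = word K (y.fst :: y.snd :: l.map dbl) := if_neg h

theorem homotopyLin_of_eq {y : TLetter} (h : y.2.1.tail = []) (v : List TLetter →₀ K) :
    homotopyLin K (cons (word K y) v) = -cons (word K y.dbl) (subRaise y.1 (homotopyLin K v)) := by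
  suffices homotopyLin K ∘ₗ cons (word K y) =
      -(cons (word K y.dbl) ∘ₗ subRaise y.1 ∘ₗ homotopyLin K) from LinearMap.congr_fun this v
  refine Finsupp.lhom_ext' fun l => LinearMap.ext_ring ?_
  simp [homotopyMap_of_eq h]

theorem homotopyLin_of_ne {y : TLetter} (h : y.2.1.tail ≠ []) (v : List TLetter →₀ K) :
    homotopyLin K (cons (word K y) v) =
      cons (word K y.fst) (cons (word K y.snd) (dblLin v)) := by
  suffices homotopyLin K ∘ₗ cons (word K y) =
      cons (word K y.fst) ∘ₗ cons (word K y.snd) ∘ₗ dblLin from LinearMap.congr_fun this v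
  refine Finsupp.lhom_ext' fun l => LinearMap.ext_ring ?_
  simp [homotopyMap_of_ne h]

theorem fst_fst_le (y : TLetter) : y.fst.1 ≤ 2 * y.1 + 1 := by
  simp only [fst, SameComparisons.dbl]
  split_ifs <;> omega

theorem snd_lt {y : TLetter} (h : y.2.1.tail ≠ []) : Odd y.snd.1 ∨ y.snd.1 < y.fst.1 := by
  obtain ⟨i, a, c, hc, rfl, e1, e2⟩ | ⟨i, n, rfl, e1, e2⟩ := fst_snd_cases h
  · exact Or.inl (e2 ▸ odd_two_mul_add_one i)
  · rw [e1, e2]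
    exact Or.inr (by simp [SameComparisons.dbl])

theorem odds_map_dbl {y : TLetter} {l : List TLetter} (h : ∀ z ∈ l, Odd z.1 ∨ z.1 < y.1)
    (l' : List TLetter) : Odds (y :: (l ++ l'.map dbl)) := by
  intro z hz
  rcases List.mem_append.1 hz with hz | hz
  · exact h z hz
  · obtain ⟨z, -, rfl⟩ := List.mem_map.1 hz
    exact Or.inl (odd_two_mul_add_one z.1)

theorem Odds.cons_odd {y : TLetter} {l : List TLetter} (h : Odds l) {b : ℕ}
    (hl : ∀ z ∈ l.head?, z.1 ≤ 2 * b) (hy : y.1 = 2 * b + 1) : Odds (y :: l) := by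
  obtain _ | ⟨z, l⟩ := l
  · simp [Odds]
  have hz := hl z rfl
  intro w hw
  rcases List.mem_cons.1 hw with rfl | hw
  · exact Or.inr (by omega)
  · rcases h w hw with h | h
    · exact Or.inl h
    · exact Or.inr (by omega)

theorem Odds.raise {y : TLetter} {l : List TLetter} (h : Odds (y :: l)) (b : ℕ) :
    Odds (raise b (y :: l)) := by
  by_cases hy : y.1 ≤ 2 * b
  · rw [raise_of_le hy]
    intro w hw
    rcases h w hw with h | h
    · exact Or.inl h
    · exact Or.inr (by simp only; omega)
  · rwa [raise_of_lt (by omega)]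

/-- Only words whose first letter has height at most `2 * b` survive in `subRaise b`, and this
letter is then lower than `y`, as `Odds` allows. -/
theorem cons_subRaise_mem {y : TLetter} {b : ℕ} (hy : y.1 = 2 * b + 1) {v : List TLetter →₀ K}
    (hv : v ∈ oddsSpan K) : cons (word K y) (subRaise b v) ∈ oddsSpan K := by
  suffices oddsSpan K ≤ (oddsSpan K).comap (cons (word K y) ∘ₗ subRaise b) from this hv
  refine Submodule.span_le.2 ?_
  rintro _ ⟨l, hl, rfl⟩
  simp only [SetLike.mem_coe, Submodule.mem_comap, LinearMap.comp_apply, subRaise_apply,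
    raiseLin_single]
  obtain _ | ⟨z, l⟩ := l
  · simp [raise]
  by_cases hz : z.1 ≤ 2 * b
  · rw [map_sub, cons_single, cons_single]
    refine sub_mem (Submodule.subset_span ⟨_, hl.cons_odd (by simpa using hz) hy, rfl⟩)
      (Submodule.subset_span ⟨_, (hl.raise b).cons_odd ?_ hy, rfl⟩)
    rw [raise_of_le hz]
    simp
  · rw [raise_of_lt (by omega)]
    simp

theorem homotopyMap_mem (l : List TLetter) : homotopyMap K l ∈ oddsSpan K := by
  induction l with
  | nil => exact zero_mem _
  | cons y l ih =>
    by_cases h : y.2.1.tail = []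
    · rw [homotopyMap_of_eq h]
      exact neg_mem (cons_subRaise_mem rfl ih)
    · rw [homotopyMap_of_ne h]
      refine Submodule.subset_span ⟨_, ?_, rfl⟩
      exact odds_map_dbl (l := [y.snd]) (by simpa using snd_lt h) l

end TLetter

end quadraticOperad

/-! ### Vanishing of the defect in the Koszul complex -/

namespace quadraticOperad

open BarComplex

variable {K : Type u} [Field K]

namespace TLetter

/-- The failure of `homotopyMap` to be a homotopy from zero to the doubling of heights. -/
noncomputable def defect (K : Type u) [Field K] (l : List TLetter) : List TLetter →₀ K :=
  bar (prod K) (homotopyMap K l) + homotopyLin K (barList (prod K) l) - word K (l.map dbl)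

/-- Differences of two words whose first letters are lower than the second letter. -/
def IsSmall (v : List TLetter →₀ K) : Prop :=
  v = 0 ∨ ∃ (k e : ℕ) (z : TLetter) (l : List TLetter), e ≤ 2 * k ∧ z.1 = 2 * k + 1 ∧
    v = word K ((2 * k, point) :: z :: l) - word K ((e, point) :: z :: l)

/-- The face `y.fst · y.snd` gives the doubled word, and `snd_mul` matches the face at the next
letter with the splitting of the product. The match is exact unless the next letter is higher, when
only the height of the first leaf differs. -/
theorem defect_of_ne {y : TLetter} (h : y.2.1.tail ≠ []) (l : List TLetter) :
    IsSmall (defect K (y :: l)) := by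
  have h1 : homotopyMap K (y :: l) =
      cons (word K y.fst) (cons (word K y.snd) (word K (l.map dbl))) := by
    rw [homotopyMap_of_ne h, cons_single, cons_single]
  have h2 : defect K (y :: l) = homotopyLin K (headMul (prod K) (word K y) (word K l)) -
      cons (word K y.fst) (headMul (prod K) (word K y.snd) (word K (l.map dbl))) := by
    have h3 : prod K y.fst y.snd = word K y.dbl := congrArg (word K) (fst_mul_snd h)
    rw [defect, h1, bar_cons, bar_cons, headMul_cons, mul_single, h3, barList, map_sub,
      map_sub (homotopyLin K), homotopyLin_of_ne h, bar_single, barList_map_dbl, cons_single,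
      List.map_cons]
    abel
  rw [h2]
  obtain _ | ⟨z, l⟩ := l
  · simp [IsSmall]
  rw [List.map_cons, headMul_word_cons, headMul_word_cons, cons_single, Finsupp.linearCombination_single,
    one_smul, homotopyMap_of_ne (tail_mul_ne y z), snd_mul h]
  rcases le_or_gt z.1 y.1 with hz | hz
  · rw [fst_mul_of_le hz]
    exact Or.inl (sub_self _)
  · rw [fst_mul_of_lt hz]
    have h3 := fst_fst_le y
    refine Or.inr ⟨z.1, y.fst.1, y.snd.mul z.dbl, l.map dbl, by omega, ?_, rfl⟩
    have h4 : y.snd.1 ≤ 2 * y.1 + 1 := by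
      obtain ⟨i, a, c, hc, rfl, e1, e2⟩ | ⟨i, n, rfl, e1, e2⟩ := fst_snd_cases h <;>
        simp [e2, SameComparisons.dbl]
    simp only [mul, dbl, SameComparisons.dbl]
    omega

/-- The defect of the tail reappears under `subRaise`. The new term compares the splitting of `y`
times the next letter with the raised doubled tail, and `snd_mul_of_le` makes them agree up to a
small term. For a one-leaf word there is no next letter, and the whole doubled word is missing. -/
theorem defect_of_eq {y : TLetter} (h : y.2.1.tail = []) (l : List TLetter) :
    ∃ v, defect K (y :: l) = cons (word K y.dbl) (subRaise y.1 (defect K l)) + v ∧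
      (IsSmall v ∨ l = [] ∧ v = -word K [y.dbl]) := by
  have h2 : defect K (y :: l) = cons (word K y.dbl) (subRaise y.1 (defect K l)) +
      (homotopyLin K (headMul (prod K) (word K y) (word K l)) -
        cons (word K y.dbl) (word K (raise y.1 (l.map dbl)))) := by
    rw [defect, homotopyMap_of_eq h, map_neg, bar_cons, subRaise_apply, map_sub (bar _),
      bar_raiseLin _ (homotopyMap_mem l), map_sub (headMul _ _), headMul_raiseLin rfl, barList,
      map_sub (homotopyLin K), homotopyLin_of_eq h, defect, subRaise_apply, subRaise_apply,
      ← raiseLin_single y.1 (l.map dbl), List.map_cons, ← cons_single]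
    simp only [map_sub, map_add]
    abel
  refine ⟨_, h2, ?_⟩
  obtain _ | ⟨z, l⟩ := l
  · exact Or.inr ⟨rfl, by simp [raise]⟩
  left
  rw [headMul_word_cons, cons_single, Finsupp.linearCombination_single,
    one_smul, homotopyMap_of_ne (tail_mul_ne y z)]
  rcases le_or_gt z.1 y.1 with hz | hz
  · rw [fst_mul_of_le hz, snd_mul_of_le h hz, List.map_cons]
    have : y.fst = y.dbl := by
      obtain ⟨i, a⟩ := y
      obtain rfl : a = point := eq_point h
      simp [fst, point, dbl]
    rw [this]
    exact Or.inl (sub_self _)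
  · have h3 : 2 * y.1 < z.dbl.1 := by
      simp only [dbl, SameComparisons.dbl]
      omega
    rw [fst_mul_of_lt hz, snd_mul_of_lt h hz, List.map_cons, raise_of_lt h3]
    obtain ⟨i, a⟩ := y
    obtain rfl : a = point := eq_point h
    have hz : i < z.1 := hz
    refine Or.inr ⟨z.1, SameComparisons.dbl i, z.dbl, l.map dbl, ?_, rfl, rfl⟩
    simp only [SameComparisons.dbl]
    omega

/-- The linear combinations of lists which vanish in the Koszul complex after a list of letters. -/
noncomputable def nullAfter (K : Type u) [Field K] (p : List TLetter) :
    Submodule K (List TLetter →₀ K) :=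
  ⨅ k, LinearMap.ker ((triasColoring K).toChain k ∘ₗ Finsupp.lmapDomain K K (p ++ ·))

theorem mem_nullAfter {p : List TLetter} {v : List TLetter →₀ K} : v ∈ nullAfter K p ↔
    ∀ k, (triasColoring K).toChain k (Finsupp.lmapDomain K K (p ++ ·) v) = 0 := by
  simp [nullAfter]

/-- At both heights the letter is lower than the letters next to it, so by
`SameHeights.append_cons_of_lt` its height is irrelevant in the Koszul complex. -/
theorem word_sub_word_mem {p r : List TLetter} {e e' : ℕ} {a : {a : List Bool // true ∈ a}}
    (hp : ∀ y ∈ p.getLast?, e < y.1 ∧ e' < y.1) (hr : ∀ y ∈ r.head?, e < y.1 ∧ e' < y.1) :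
    word K ((e, a) :: r) - word K ((e', a) :: r) ∈ nullAfter K p := by
  rw [mem_nullAfter]
  intro k
  rw [map_sub, map_sub, sub_eq_zero]
  simp only [Finsupp.lmapDomain_apply, Finsupp.mapDomain_single]
  refine triasColoring_toChain_congr ?_ (by simp) k
  rw [List.map_append, List.map_append]
  refine SameHeights.append_cons_of_lt ?_ ?_
  · intro x hx
    rw [List.getLast?_map] at hx
    obtain ⟨y, hy, rfl⟩ := Option.mem_map.1 hx
    exact hp y hy
  · intro x hx
    rw [List.head?_map] at hx
    obtain ⟨y, hy, rfl⟩ := Option.mem_map.1 hx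
    exact hr y hy

theorem cons_mem_nullAfter {p : List TLetter} {y : TLetter} {v : List TLetter →₀ K}
    (hv : v ∈ nullAfter K (p ++ [y])) : cons (word K y) v ∈ nullAfter K p := by
  rw [mem_nullAfter] at hv ⊢
  intro k
  rw [← hv k]
  congr 1
  suffices Finsupp.lmapDomain K K (p ++ ·) ∘ₗ cons (word K y) =
      Finsupp.lmapDomain K K (p ++ [y] ++ ·) from LinearMap.congr_fun this v
  refine Finsupp.lhom_ext' fun l => LinearMap.ext_ring ?_
  simp

theorem IsSmall.mem {v : List TLetter →₀ K} (h : IsSmall v) : v ∈ nullAfter K [] := by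
  obtain rfl | ⟨k, e, z, l, he, hz, rfl⟩ := h
  · exact zero_mem _
  · refine word_sub_word_mem (by simp) ?_
    simp only [List.head?_cons, Option.mem_some_iff]
    rintro _ rfl
    omega

theorem raise_point {e b : ℕ} (h : e ≤ 2 * b) (l : List TLetter) :
    raise b ((e, point) :: l) = (2 * b, point) :: l := raise_of_le h l

/-- A small term alone need not vanish after a prefix, whose last letter may be too low. Under
`subRaise b`, each first leaf of height at most `2 * b` is compared with its form at `2 * b`, still
below the end of the prefix; heights above `2 * b` cancel. -/
theorem IsSmall.subRaise_mem {v : List TLetter →₀ K} (h : IsSmall v) {p : List TLetter} {b : ℕ}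
    (hp : ∀ y ∈ p.getLast?, 2 * b < y.1) : subRaise b v ∈ nullAfter K p := by
  obtain rfl | ⟨k, e, z, l, he, hz, rfl⟩ := h
  · rw [map_zero]
    exact zero_mem _
  rw [subRaise_apply, map_sub, raiseLin_single, raiseLin_single]
  by_cases hb : 2 * k ≤ 2 * b
  · rw [raise_point hb, raise_point (he.trans hb), sub_self, sub_zero]
    refine word_sub_word_mem (fun y hy => ?_) ?_
    · have := hp y hy
      omega
    · simp only [List.head?_cons, Option.mem_some_iff]
      rintro _ rfl
      omega
  · rw [raise_of_lt (not_le.1 hb)]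
    by_cases hb' : e ≤ 2 * b
    · rw [raise_point hb', sub_sub_sub_cancel_left]
      refine word_sub_word_mem (fun y hy => ?_) ?_
      · have := hp y hy
        omega
      · simp only [List.head?_cons, Option.mem_some_iff]
        rintro _ rfl
        omega
    · rw [raise_of_lt (not_le.1 hb'), sub_self]
      exact zero_mem _

/-- Raising either fixes the leaf or moves it up to `2 * b`; the hypothesis is asked for every
greater height so as to cover both words of the difference. -/
theorem subRaise_cons_mem {y : TLetter} (hy : y.2 = point) {b : ℕ} {p : List TLetter}
    {v : List TLetter →₀ K} (h : ∀ e, y.1 ≤ e → v ∈ nullAfter K (p ++ [(e, point)])) :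
    subRaise b (cons (word K y) v) ∈ nullAfter K p := by
  obtain ⟨i, a⟩ := y
  obtain rfl : a = point := hy
  by_cases hb : i ≤ 2 * b
  · have : raiseLin b (cons (word K (i, point)) v) = cons (word K (2 * b, point)) v := by
      suffices raiseLin b ∘ₗ cons (word K (i, point)) = cons (K := K) (word K (2 * b, point)) from
        LinearMap.congr_fun this v
      refine Finsupp.lhom_ext' fun l => LinearMap.ext_ring ?_
      simp [raise_point hb]
    rw [subRaise_apply, this]
    exact sub_mem (cons_mem_nullAfter (h _ le_rfl)) (cons_mem_nullAfter (h _ hb))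
  · have : raiseLin b (cons (word K (i, point)) v) = cons (word K (i, point)) v := by
      suffices raiseLin b ∘ₗ cons (word K (i, point)) = cons (K := K) (word K (i, point)) from
        LinearMap.congr_fun this v
      refine Finsupp.lhom_ext' fun l => LinearMap.ext_ring ?_
      simp [raise_of_lt (y := (i, point)) (not_le.1 hb)]
    rw [subRaise_apply, this, sub_self]
    exact zero_mem _

/-- Induction along the word. Past a single leaf of height `i`, the prefix ends at a height at least
`2 * i + 1`, which is what the next `subRaise i` requires. The missing one-leaf word at the end
becomes a difference of two words whose last leaf is lower than the preceding one, and so vanishes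
too. -/
theorem subRaise_defect_mem (l : List TLetter) {p : List TLetter} {b : ℕ}
    (hp : ∀ y ∈ p.getLast?, 2 * b < y.1) : subRaise b (defect K l) ∈ nullAfter K p := by
  induction l generalizing p b with
  | nil =>
    have : defect K [] = -word K [] := by
      rw [defect, homotopyMap, barList_nil, map_zero, map_zero, zero_add, zero_sub, List.map_nil]
    rw [this, map_neg, subRaise_apply, raiseLin_single, raise, sub_self, neg_zero]
    exact zero_mem _
  | cons y l ih =>
    by_cases h : y.2.1.tail = []
    · obtain ⟨v, e, hv⟩ := defect_of_eq (K := K) h l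
      rw [e, map_add]
      have hy : y.dbl.2 = point := eq_point h
      refine add_mem (subRaise_cons_mem hy fun e he => ih ?_) ?_
      · simp only [List.getLast?_append, List.getLast?_singleton, Option.some_or,
          Option.mem_some_iff]
        rintro _ rfl
        exact lt_of_lt_of_le (Nat.lt_succ_self _) he
      · obtain hv | ⟨-, rfl⟩ := hv
        · exact hv.subRaise_mem hp
        · obtain ⟨i, a⟩ := y
          obtain rfl : a = point := eq_point h
          rw [map_neg, subRaise_apply, raiseLin_single]
          refine neg_mem ?_
          by_cases hb : SameComparisons.dbl i ≤ 2 * b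
          · rw [show raise b [dbl (i, point)] = [(2 * b, point)] from raise_point hb []]
            refine word_sub_word_mem (fun y hy => ?_) (by simp)
            have := hp y hy
            exact ⟨lt_of_le_of_lt hb this, this⟩
          · rw [raise_of_lt (y := dbl (i, point)) (not_le.1 hb), sub_self]
            exact zero_mem _
    · exact (defect_of_ne h l).subRaise_mem hp

theorem defect_mem {l : List TLetter} (hl : l ≠ []) (hl' : ∀ i, l ≠ [(i, point)]) :
    defect K l ∈ nullAfter K [] := by
  obtain _ | ⟨y, l⟩ := l
  · exact absurd rfl hl
  by_cases h : y.2.1.tail = []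
  · obtain ⟨v, e, hv⟩ := defect_of_eq (K := K) h l
    rw [e]
    refine add_mem (cons_mem_nullAfter (subRaise_defect_mem l ?_)) ?_
    · simp only [List.nil_append, List.getLast?_singleton, Option.mem_some_iff]
      rintro _ rfl
      exact Nat.lt_succ_self _
    · obtain hv | ⟨rfl, rfl⟩ := hv
      · exact hv.mem
      · exact absurd (by rw [← eq_point h]) (hl' y.1)
  · exact (defect_of_ne h l).mem

theorem toChain_homotopy {l : List TLetter} (hl : l ≠ []) (hl' : ∀ i, l ≠ [(i, point)]) (k : ℕ) :
    (triasColoring K).toChain k (bar (triasColoring K).prod (homotopyMap K l) +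
      homotopyLin K (barList (triasColoring K).prod l)) =
      (triasColoring K).toChain k (word K l) := by
  have h := mem_nullAfter.1 (defect_mem (K := K) hl hl') k
  have hid : Finsupp.lmapDomain K K (fun l : List TLetter => [] ++ l) = LinearMap.id :=
    Finsupp.lmapDomain_id K K
  rw [hid, LinearMap.id_apply, defect, map_sub, sub_eq_zero] at h
  rw [triasColoring_prod_eq, h]
  refine triasColoring_toChain_congr ?_ ?_ k
  · have := SameHeights.map_dbl (l.map Prod.fst)
    rw [List.map_map] at this ⊢
    exact this
  · rw [List.map_map]
    rfl

end TLetter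

end quadraticOperad

/-! ### Independence of the chosen list of heights -/

namespace quadraticOperad

open BarComplex

variable {K : Type u} [Field K]

namespace TLetter

/-- Pairs of linear combinations of lists which agree in the Koszul complex after lists of
heights. -/
noncomputable abbrev agree (K : Type u) [Field K] (p p' : List ℕ) :
    Submodule K ((List TLetter →₀ K) × (List TLetter →₀ K)) :=
  Submodule.span K {v | ∃ l l' : List TLetter, l.map Prod.snd = l'.map Prod.snd ∧
    SameHeights (p ++ l.map Prod.fst) (p' ++ l'.map Prod.fst) ∧ Odds l ∧ Odds l' ∧
    v = (word K l, word K l')}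

theorem toChain_eq_of_mem_agree {v : (List TLetter →₀ K) × (List TLetter →₀ K)}
    (hv : v ∈ agree K [] []) (k : ℕ) :
    (triasColoring K).toChain k v.1 = (triasColoring K).toChain k v.2 := by
  suffices agree K [] [] ≤ LinearMap.eqLocus
      ((triasColoring K).toChain k ∘ₗ LinearMap.fst K _ _)
      ((triasColoring K).toChain k ∘ₗ LinearMap.snd K _ _) from this hv
  refine Submodule.span_le.2 ?_
  rintro _ ⟨l, l', h, h', -, -, rfl⟩
  exact triasColoring_toChain_congr h' h k

/-- The second letters compare in the same way with the letters of heights `2 * b + 1` and `2 * b' +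
1`, so they are both raised or both left alone. `Odds` excludes the heights `2 * b` and `2 * b'`
further right, as `SameHeights.raise` requires. -/
theorem cons_subRaise_mem_agree {p p' : List ℕ} (hp : p.length = p'.length) {y y' : TLetter}
    {b b' : ℕ} (hy : y.1 = 2 * b + 1) (hy' : y'.1 = 2 * b' + 1) (e : y.2 = y'.2)
    {v : (List TLetter →₀ K) × (List TLetter →₀ K)}
    (hv : v ∈ agree K (p ++ [y.1]) (p' ++ [y'.1])) :
    (cons (word K y) (subRaise b v.1), cons (word K y') (subRaise b' v.2)) ∈ agree K p p' := by
  suffices agree K (p ++ [y.1]) (p' ++ [y'.1]) ≤ (agree K p p').comap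
      ((cons (word K y) ∘ₗ subRaise b).prodMap (cons (word K y') ∘ₗ subRaise b')) from this hv
  refine Submodule.span_le.2 ?_
  rintro _ ⟨l, l', h, h', ho, ho', rfl⟩
  simp only [SetLike.mem_coe, Submodule.mem_comap, LinearMap.prodMap_apply, LinearMap.comp_apply,
    subRaise_apply, raiseLin_single]
  have hl : l.length = l'.length := by simpa using congrArg List.length h
  obtain _ | ⟨z, l⟩ := l <;> obtain _ | ⟨z', l'⟩ := l'
  · rw [raise, raise, sub_self, map_zero, map_zero]
    exact zero_mem _
  · simp at hl
  · simp at hl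
  simp only [List.map_cons, List.cons.injEq, List.append_assoc, List.singleton_append] at h h'
  have hz := (h'.head_iff hp).2
  by_cases hb : z.1 ≤ 2 * b
  · have hb' : z'.1 ≤ 2 * b' := by omega
    have h1 : (word K (y :: z :: l), word K (y' :: z' :: l')) ∈ agree K p p' :=
      Submodule.subset_span ⟨y :: z :: l, y' :: z' :: l', by simp [h, e], h',
        ho.cons_odd (by simpa using hb) hy, ho'.cons_odd (by simpa using hb') hy', rfl⟩
    have h2 : (word K (y :: raise b (z :: l)), word K (y' :: raise b' (z' :: l'))) ∈
        agree K p p' := by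
      refine Submodule.subset_span ⟨_, _, ?_, ?_, (ho.raise b).cons_odd ?_ hy,
        (ho'.raise b').cons_odd ?_ hy', rfl⟩
      · rw [raise_of_le hb, raise_of_le hb']
        simp [h, e]
      · rw [raise_of_le hb, raise_of_le hb']
        simp only [List.map_cons]
        rw [hy, hy'] at h' ⊢
        refine h'.raise hp hb hb' ?_ ?_
        · intro hm
          obtain ⟨w, hw, hw'⟩ := List.mem_map.1 hm
          exact ho.ne hb w hw hw'
        · intro hm
          obtain ⟨w, hw, hw'⟩ := List.mem_map.1 hm
          exact ho'.ne hb' w hw hw'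
      · rw [raise_of_le hb]
        simp
      · rw [raise_of_le hb']
        simp
    rw [map_sub, map_sub, cons_single, cons_single, cons_single, cons_single]
    exact sub_mem h1 h2
  · have hb' : ¬ z'.1 ≤ 2 * b' := by omega
    rw [raise_of_lt (not_le.1 hb), raise_of_lt (not_le.1 hb'), sub_self, sub_self, map_zero,
      map_zero]
    exact zero_mem _

/-- The homotopy branches only on the shape of the blocks, so it treats both words in parallel. The
prefixes `p` and `p'` keep the heights of the letters already passed: `SameHeights.inflation`
handles a splitting and `cons_subRaise_mem_agree` the passage over a single leaf. -/
theorem homotopyMap_mem_agree {l l' : List TLetter} {p p' : List ℕ} (hp : p.length = p'.length)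
    (h : l.map Prod.snd = l'.map Prod.snd)
    (h' : SameHeights (p ++ l.map Prod.fst) (p' ++ l'.map Prod.fst)) :
    (homotopyMap K l, homotopyMap K l') ∈
      agree K (p.map SameComparisons.dbl) (p'.map SameComparisons.dbl) := by
  have hl : l.length = l'.length := by simpa using congrArg List.length h
  induction l generalizing l' p p' with
  | nil =>
    obtain rfl : l' = [] := List.length_eq_zero_iff.1 hl.symm
    exact zero_mem _
  | cons y l ih =>
    obtain _ | ⟨y', l'⟩ := l'
    · simp at hl
    simp only [List.map_cons, List.cons.injEq, List.length_cons, Nat.add_right_cancel_iff] at h h' hl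
    by_cases ht : y.2.1.tail = []
    · rw [homotopyMap_of_eq ht, homotopyMap_of_eq (h.1 ▸ ht)]
      have h1 := ih (l' := l') (p := p ++ [y.1]) (p' := p' ++ [y'.1]) (by simp [hp]) h.2
        (by simpa using h') hl
      rw [List.map_append, List.map_append] at h1
      exact neg_mem (cons_subRaise_mem_agree (y := y.dbl) (y' := y'.dbl) (by simp [hp]) rfl rfl h.1
        h1)
    · have ht' : y'.2.1.tail ≠ [] := h.1 ▸ ht
      have e1 : ∀ l : List TLetter, (l.map dbl).map Prod.snd = l.map Prod.snd := fun l => by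
        rw [List.map_map]
        rfl
      have e2 : ∀ l : List TLetter, (l.map dbl).map Prod.fst =
          (l.map Prod.fst).map SameComparisons.dbl := fun l => by
        rw [List.map_map, List.map_map]
        rfl
      rw [homotopyMap_of_ne ht, homotopyMap_of_ne ht']
      refine Submodule.subset_span ⟨y.fst :: y.snd :: l.map dbl, y'.fst :: y'.snd :: l'.map dbl,
        ?_, ?_, odds_map_dbl (l := [y.snd]) (by
        simpa using snd_lt ht) l, odds_map_dbl (l := [y'.snd]) (by simpa using snd_lt ht') l', rfl⟩
      · obtain ⟨i, a⟩ := y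
        obtain ⟨j, a'⟩ := y'
        obtain rfl : a = a' := h.1
        have e3 : (snd (i, a)).2 = (snd (j, a)).2 := by
          by_cases hm : true ∈ a.1.tail
          · rw [snd_of_mem hm, snd_of_mem hm]
          · rw [snd_of_not_mem hm, snd_of_not_mem hm]
        simp only [List.map_cons, e1, h.2, e3]
        rfl
      · simp only [List.map_cons, e2]
        refine h'.inflation hp ?_
        obtain ⟨i, a⟩ := y
        obtain ⟨j, a'⟩ := y'
        obtain rfl : a = a' := h.1
        by_cases hm : true ∈ a.1.tail
        · rw [snd_of_mem hm, snd_of_mem hm]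
          by_cases ha : a.1.head? = some true <;> simp [fst, ha]
        · rw [snd_of_not_mem hm, snd_of_not_mem hm]
          have ha : a.1.head? = some true := by
            obtain ⟨_ | ⟨b, c⟩, ha⟩ := a
            · simp at ha
            · have hm : true ∉ c := hm
              simpa [hm, eq_comm] using ha
          simp [fst, ha]

end TLetter

/-- The contracting homotopy for associative trialgebras. -/
noncomputable def triasHomotopy (K : Type u) [Field K] : (triasColoring K).Homotopy where
  map := TLetter.homotopyMap K
  map_eq_zero k l hl h := by
    -- Every nonempty list of heights is compatible with a Schröder tree, so no word of length `k +
    -- 1` is null and the hypothesis is contradictory.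
    obtain ⟨s, hs⟩ := Sch.exists_compat (l.map Prod.fst) (by
      rintro h
      rw [List.map_eq_nil_iff] at h
      simp [h] at hl)
    have hn := hs.length
    rw [List.length_map] at hn
    rw [(triasColoring K).toChain_eq_chainBasis hl (i := s)
      (show s.tree.nodes = k by omega) (isDual_heightWeight dualRelations_dualRelations hs)] at h
    exact absurd h (((triasColoring K).chainBasis k).ne_zero _)
  map_eq k l l' hl hl' _ h := by
    obtain ⟨h1, h2⟩ := triasColoring_sameHeights hl hl' h
    exact TLetter.toChain_eq_of_mem_agree
      (TLetter.homotopyMap_mem_agree (p := []) (p' := []) rfl h2 h1) (k + 1)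
  homotopy k l hl hne _ := by
    refine TLetter.toChain_homotopy ?_ hne k
    rintro rfl
    simp at hl

theorem koszulAcyclic_triasRelations (K : Type u) [Field K] :
    KoszulAcyclic (triasRelations K) :=
  (triasHomotopy K).acyclic

end quadraticOperad

/-! ### Koszulness of both operads -/

theorem mainTheorem1 (K : Type u) [Field K] :
    (simplexOperad K).IsKoszul ∧ (dendriformOperad K).IsKoszul :=
  ⟨⟨TriOp, inferInstance, quadraticOperad.triasRelations K, ⟨quadraticOperad.simplexIso K⟩,
    quadraticOperad.koszulAcyclic_triasRelations K⟩,
  ⟨TriOp, inferInstance, dendriformRelations K, ⟨⟨fun _ => LinearEquiv.refl K _, rfl, fun _ _ _ _ => rfl⟩⟩,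
    quadraticOperad.koszulAcyclic_dendriformRelations K⟩⟩
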